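/- For $z\in\mathbb C\setminus[0,8]$ and $n=(n_1,n_2)\in\mathbb Z^2$ let $$G(z,n)=(2\pi)^{-2}\int_{(\mathbb R/2\pi\mathbb Z)^2}\frac{e^{i(n_1\theta_1+n_2\theta_2)}}{4-2\cos\theta_1-2\cos\theta_2-z}\,d\theta ,$$ and write $|n|=|n_1|+|n_2|$, $(q)_0=1$, $(q)_k=q(q+1)\cdots(q+k-1)$ for $k\ge 1$, $\psi=\Gamma'/\Gamma$, $\log$ for the principal branch (cut along $(-\infty,0]$), and $${}_4F_3\left(\genfrac{}{}{0pt}{}{a_1,a_2,a_3,a_4}{b_1,b_2,b_3};w\right)=\sum_{k=0}^\infty\frac{(a_1)_k(a_2)_k(a_3)_k(a_4)_k}{(b_1)_k(b_2)_k(b_3)_k}\frac{w^k}{k!}\qquad(|w|<1).$$ Let $z\in\mathbb C$ with $|z-4|<4$ and $\operatorname{Im}z>0$, let $n\in\mathbb Z^2$, and put $M=\max\{|n_1|,|n_2|\}$. Then all series below converge absolutely, and the following holds. (a) If $|n|$ is even, then $$\begin{aligned} G(z,n)&=(-1)^{M}\,\frac{|n_1+n_2|}2\,\frac{|n_1-n_2|}2\,\frac{z-4}{4}\;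 {}_4F_3\left(\genfrac{}{}{0pt}{}{\frac{2+n_1+n_2}2,\frac{2-n_1-n_2}2,\frac{2+n_1-n_2}2,\frac{2-n_1+n_2}2}{1,\frac32,\frac32};\frac{(z-4)^2}{16}\right)\\ &\quad+\frac{i(-1)^{M}}{4\pi}\sum_{k=0}^\infty \frac{\left(\frac{1+n_1+n_2}2\right)_k\left(\frac{1+n_1-n_2}2\right)_k\left(\frac{1-n_1+n_2}2\right)_k\left(\frac{1-n_1-n_2}2\right)_k}{k!\,k!\left(\frac12\right)_k\left(\frac12\right)_k}\left(\frac{z-4}4\right)^{2k}\\ &\qquad\cdot\Bigl[2\psi(1+k)+2\psi\left(\tfrac12+k\right)-\psi\left(\tfrac{1+n_1+n_2}2+k\right)-\psi\left(\tfrac{1+n_1-n_2}2+k\right)\\ &\qquad\quad-\psi\left(\tfrac{1-n_1+n_2}2+k\right)-\psi\left(\tfrac{1-n_1-n_2}2+k\right)-\log\left(-\tfrac{(z-4)^2}{16}\right)\Bigr]. \end{aligned}$$ (b) If $|n|$ is odd, then $$\begin{aligned} G(z,n)&=\frac{(-1)^{M}}4\; {}_4F_3\left(\genfrac{}{}{0pt}{}{\frac{1+n_1+n_2}2,\frac{1+n_1-n_2}2,\frac{1-n_1+n_2}2,\frac{1-n_1-n_2}2}{1,\frac12,\frac12};\frac{(z-4)^2}{16}\right)\\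 &\quad+\frac{i(-1)^{M}}{\pi}\,\frac{|n_1+n_2|}2\,\frac{|n_1-n_2|}2\,\frac{z-4}4\\ &\qquad\cdot\sum_{k=0}^\infty \frac{\left(\frac{2+n_1+n_2}2\right)_k\left(\frac{2+n_1-n_2}2\right)_k\left(\frac{2-n_1+n_2}2\right)_k\left(\frac{2-n_1-n_2}2\right)_k}{k!\,k!\left(\frac32\right)_k\left(\frac32\right)_k}\left(\frac{z-4}4\right)^{2k}\\ &\qquad\cdot\Bigl[2\psi(1+k)+2\psi\left(\tfrac32+k\right)-\psi\left(\tfrac{2+n_1+n_2}2+k\right)-\psi\left(\tfrac{2+n_1-n_2}2+k\right)\\ &\qquad\quad-\psi\left(\tfrac{2-n_1+n_2}2+k\right)-\psi\left(\tfrac{2-n_1-n_2}2+k\right)-\log\left(-\tfrac{(z-4)^2}{16}\right)\Bigr]. \end{aligned}$$ -/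

import Mathlib

noncomputable section

/-- The one-norm `|n| = |n₁| + ⋯ + |n_d|` of a lattice point. -/
def latticeNorm {d : ℕ} (n : Fin d → ℤ) : ℕ := ∑ j, (n j).natAbs

/-- The kernel `G(z, n)` of the resolvent `(H₀ - z)⁻¹` of the discrete Laplacian on `ℤ^d`,
given by the integral over the torus `𝕋^d = (ℝ / 2πℤ)^d`, which is represented by its
fundamental domain `(-π, π]^d`. -/
def latticeGreen (d : ℕ) (z : ℂ) (n : Fin d → ℤ) : ℂ :=
  ((2 * Real.pi : ℝ) : ℂ) ^ (-(d : ℤ)) *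
    ∫ θ in Set.univ.pi (fun _ : Fin d => Set.Ioc (-Real.pi) Real.pi),
      Complex.exp (Complex.I * ∑ j, (n j : ℂ) * (θ j : ℂ)) /
        (2 * (d : ℂ) - ∑ j, 2 * Complex.cos (θ j : ℂ) - z)

/-- The Pochhammer symbol `(q)_k = q (q + 1) ⋯ (q + k - 1)`, with `(q)_0 = 1`. -/
def poch (q : ℂ) (k : ℕ) : ℂ := ∏ i ∈ Finset.range k, (q + i)

/-- The `k`-th term of the series of the generalized hypergeometric function `_pF_q` with the
upper parameters `a` and the lower parameters `b`, at the point `w`. -/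
def pFqTerm (a b : List ℂ) (w : ℂ) (k : ℕ) : ℂ :=
  (a.map fun q => poch q k).prod / (b.map fun q => poch q k).prod * (w ^ k / (k.factorial : ℂ))

/-- The generalized hypergeometric function `_pF_q`, as the sum of its power series
(used inside the disc of convergence only). -/
def pFq (a b : List ℂ) (w : ℂ) : ℂ := ∑' k, pFqTerm a b w k

/-- The `k`-th term of the logarithmic series that occurs for even `|n|`. -/
def evenLogTerm (z : ℂ) (n : Fin 2 → ℤ) (k : ℕ) : ℂ :=
  poch ((1 + n 0 + n 1) / 2) k * poch ((1 + n 0 - n 1) / 2) k *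
      poch ((1 - n 0 + n 1) / 2) k * poch ((1 - n 0 - n 1) / 2) k /
    ((k.factorial : ℂ) * (k.factorial : ℂ) * poch (1 / 2) k * poch (1 / 2) k) *
  ((z - 4) / 4) ^ (2 * k) *
  (2 * Complex.digamma (1 + k) + 2 * Complex.digamma (1 / 2 + k)
    - Complex.digamma ((1 + n 0 + n 1) / 2 + k) - Complex.digamma ((1 + n 0 - n 1) / 2 + k)
    - Complex.digamma ((1 - n 0 + n 1) / 2 + k) - Complex.digamma ((1 - n 0 - n 1) / 2 + k)
    - Complex.log (-((z - 4) ^ 2 / 16)))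

/-- The `k`-th term of the logarithmic series that occurs for odd `|n|`. -/
def oddLogTerm (z : ℂ) (n : Fin 2 → ℤ) (k : ℕ) : ℂ :=
  poch ((2 + n 0 + n 1) / 2) k * poch ((2 + n 0 - n 1) / 2) k *
      poch ((2 - n 0 + n 1) / 2) k * poch ((2 - n 0 - n 1) / 2) k /
    ((k.factorial : ℂ) * (k.factorial : ℂ) * poch (3 / 2) k * poch (3 / 2) k) *
  ((z - 4) / 4) ^ (2 * k) *
  (2 * Complex.digamma (1 + k) + 2 * Complex.digamma (3 / 2 + k)
    - Complex.digamma ((2 + n 0 + n 1) / 2 + k) - Complex.digamma ((2 + n 0 - n 1) / 2 + k)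
    - Complex.digamma ((2 - n 0 + n 1) / 2 + k) - Complex.digamma ((2 - n 0 - n 1) / 2 + k)
    - Complex.log (-((z - 4) ^ 2 / 16)))

end

open Filter Topology MeasureTheory intervalIntegral

/-! Put w = (z - 4) / 4, a = n₁ + n₂, b = n₁ - n₂. The right-hand sides of (a) and (b) are two
readings of one expansion `greenSeries`. Four times its N-th term is (4w)^N c_N(a) c_N(b), with c_N
= `latticeCoeff N`, times 1 or times a bracket of a logarithm and digamma values, according to the
parity of N + a. Splitting N into even and odd gives the hypergeometric and the logarithmic series.

The coefficients satisfy c_{N+1}(a+1) + c_{N+1}(a-1) = i c_N(a), and so do their products with the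
digamma sums. In rotated coordinates the four nearest neighbours are (a±1, b±1), so multiplying the
relations for a and b gives the lattice equation power by power; N = 0 produces the point source
(`greenSeries_recursion`). The kernel G solves the same inhomogeneous equation
(`torusGreen_recursion`), and both are invariant under swapping and reflecting coordinates. A
function with these symmetries that solves the homogeneous equation and vanishes on the diagonal is
zero (`lattice_unique`), so only n = (m, m) remains.

There b = 0 and the odd powers drop out. In t = -w² the expansion is a constant times -P log t + Q,
a Frobenius solution at t = 0 of t(1+t)y'' + (1+2t)y' + (1/4 - m²)y = 0. For w = iy one torus
integral can be evaluated, and G becomes a multiple of ∫₀^{π/2} cos(2mα) (t + sin² α)^(-1/2) dα with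
t = y². This integral solves the same equation (`sinKernel_cos_ode`), and its logarithm and constant
term at t = 0⁺ agree with those of the series. A Wronskian argument (`legendre_unique`) identifies
the two for small t, and the identity theorem extends the equality to the half disc |z - 4| < 4, Im
z > 0 (`torusGreen_diag`). -/

/-! ### Coefficients and digamma sums: recursions in N and a -/

/-- The central binomial polynomial `binom((a + N - 1) / 2, N)`. -/
noncomputable def centralCoeff (N : ℕ) (a : ℂ) : ℂ :=
  (∏ j ∈ Finset.range N, ((a + N - 1) / 2 - j)) / (N.factorial : ℂ)

/-- The coefficient `i^|a| binom((|a| + N - 1) / 2, N)`. -/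
noncomputable def latticeCoeff (N : ℕ) (a : ℤ) : ℂ := Complex.I ^ a.natAbs * centralCoeff N a.natAbs

/-- The digamma combination attached to one of the two rotated coordinates. -/
noncomputable def digammaSum (N : ℕ) (a : ℂ) : ℂ :=
  Complex.digamma (1 + N / 2) + Complex.digamma ((1 + N) / 2)
    - Complex.digamma ((1 + a + N) / 2) - Complex.digamma ((1 - a + N) / 2)

lemma centralCoeff_zero (a : ℂ) : centralCoeff 0 a = 1 := by simp [centralCoeff]

lemma centralCoeff_one (a : ℂ) : centralCoeff 1 a = a / 2 := by simp [centralCoeff]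

/-- Raising both N and a by 1 raises the top factor (a + N - 1)/2 by 1 and keeps the others; raising
N while lowering a keeps the top and appends a factor at the bottom. These two ratios drive every
later recursion. -/
lemma centralCoeff_succ_add_one (N : ℕ) (a : ℂ) :
    centralCoeff (N + 1) (a + 1) = centralCoeff N a * ((a + (N + 1)) / (2 * (N + 1))) := by
  have h1 : (N : ℂ) + 1 ≠ 0 := by exact_mod_cast N.succ_ne_zero
  have h2 : (N.factorial : ℂ) ≠ 0 := by exact_mod_cast N.factorial_ne_zero
  have h3 : ∀ j : ℕ, (a + 1 + ((N + 1 : ℕ) : ℂ) - 1) / 2 - ((j + 1 : ℕ) : ℂ)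
      = (a + N - 1) / 2 - j := fun j => by push_cast; ring
  simp only [centralCoeff, Finset.prod_range_succ', h3, Nat.factorial_succ]
  push_cast
  field_simp
  ring

lemma centralCoeff_succ_sub_one (N : ℕ) (a : ℂ) :
    centralCoeff (N + 1) (a - 1) = centralCoeff N a * ((a - (N + 1)) / (2 * (N + 1))) := by
  have h1 : (N : ℂ) + 1 ≠ 0 := by exact_mod_cast N.succ_ne_zero
  have h2 : (N.factorial : ℂ) ≠ 0 := by exact_mod_cast N.factorial_ne_zero
  have h3 : ∀ j : ℕ, (a - 1 + ((N + 1 : ℕ) : ℂ) - 1) / 2 - (j : ℂ)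
      = (a + N - 1) / 2 - j := fun j => by push_cast; ring
  simp only [centralCoeff, Finset.prod_range_succ, h3, Nat.factorial_succ]
  push_cast
  field_simp
  ring

lemma centralCoeff_add_two (N : ℕ) (a : ℂ) :
    centralCoeff (N + 2) a =
      centralCoeff N a * ((a ^ 2 - (N + 1) ^ 2) / (4 * ((N + 1) * (N + 2)))) := by
  have h1 : (N : ℂ) + 1 ≠ 0 := by exact_mod_cast N.succ_ne_zero
  have h2 : (N : ℂ) + 2 ≠ 0 := by exact_mod_cast (N + 1).succ_ne_zero
  have := centralCoeff_succ_add_one (N + 1) (a - 1)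
  rw [sub_add_cancel, centralCoeff_succ_sub_one] at this
  rw [this]
  have h3 : ((N + 1 : ℕ) : ℂ) + 1 = N + 2 := by push_cast; ring
  rw [h3]
  field_simp
  ring

/-- This is the case a = 0 of the lattice recursion, where |a| has its kink and the neighbours 1 and
-1 coincide. -/
lemma two_mul_centralCoeff_succ_one (N : ℕ) : 2 * centralCoeff (N + 1) 1 = centralCoeff N 0 := by
  have h1 : (N : ℂ) + 1 ≠ 0 := by exact_mod_cast N.succ_ne_zero
  have := centralCoeff_succ_add_one N 0
  rw [zero_add] at this
  rw [this]
  field_simp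
  ring

lemma latticeCoeff_neg (N : ℕ) (a : ℤ) : latticeCoeff N (-a) = latticeCoeff N a := by
  simp [latticeCoeff]

lemma latticeCoeff_natCast (N a : ℕ) :
    latticeCoeff N a = Complex.I ^ a * centralCoeff N a := by
  simp [latticeCoeff]

/-- For a > 0 the powers of i at a + 1 and a - 1 have opposite signs, so the two ratios (a ± (N+1))
/ (2(N+1)) are subtracted and their difference is free of a. -/
lemma latticeCoeff_succ (N : ℕ) (a : ℤ) :
    latticeCoeff (N + 1) (a + 1) + latticeCoeff (N + 1) (a - 1)
      = Complex.I * latticeCoeff N a := by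
  have key : ∀ a : ℕ, latticeCoeff (N + 1) (a + 1) + latticeCoeff (N + 1) (a - 1)
      = Complex.I * latticeCoeff N a := by
    intro a
    have h1 : (N : ℂ) + 1 ≠ 0 := by exact_mod_cast N.succ_ne_zero
    rcases a with _ | a
    · have e1 : ((0 : ℕ) : ℤ) + 1 = ((1 : ℕ) : ℤ) := by simp
      have e2 : ((0 : ℕ) : ℤ) - 1 = -((1 : ℕ) : ℤ) := by simp
      rw [e1, e2, latticeCoeff_neg, latticeCoeff_natCast, latticeCoeff_natCast]
      have := two_mul_centralCoeff_succ_one N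
      simp only [Nat.cast_one, Nat.cast_zero, pow_one, pow_zero]
      linear_combination Complex.I * this
    · have e1 : ((a + 1 : ℕ) : ℤ) + 1 = ((a + 2 : ℕ) : ℤ) := by push_cast; ring
      have e2 : ((a + 1 : ℕ) : ℤ) - 1 = ((a : ℕ) : ℤ) := by push_cast; ring
      rw [e1, e2, latticeCoeff_natCast, latticeCoeff_natCast, latticeCoeff_natCast]
      have h2 := centralCoeff_succ_add_one N (a + 1)
      have h3 := centralCoeff_succ_sub_one N (a + 1)
      rw [add_sub_cancel_right] at h3
      have e3 : ((a + 2 : ℕ) : ℂ) = (a : ℂ) + 1 + 1 := by push_cast; ring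
      have e4 : ((a + 1 : ℕ) : ℂ) = (a : ℂ) + 1 := by push_cast; ring
      rw [e3, e4, h2, h3, pow_add, Complex.I_sq, pow_succ]
      field_simp
      rw [pow_two, Complex.I_mul_I]
      ring
  rcases Int.natAbs_eq a with h | h
  · rw [h]; exact key _
  · have := key a.natAbs
    rw [h, latticeCoeff_neg N, ← this, ← latticeCoeff_neg _ (-_ + 1), ← latticeCoeff_neg _ (-_ - 1)]
    rw [add_comm]
    congr 2 <;> ring

/-- At N = 0 the coefficient is i^|a|, so the neighbours cancel except at the kink a = 0. This
defect is the origin of the delta source. -/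
lemma latticeCoeff_zero (a : ℤ) :
    latticeCoeff 0 (a + 1) + latticeCoeff 0 (a - 1) = if a = 0 then 2 * Complex.I else 0 := by
  have key : ∀ a : ℕ, latticeCoeff 0 (a + 1) + latticeCoeff 0 (a - 1)
      = if (a : ℤ) = 0 then 2 * Complex.I else 0 := by
    intro a
    rcases a with _ | a
    · simp [latticeCoeff, centralCoeff_zero]; ring
    · have e1 : ((a + 1 : ℕ) : ℤ) + 1 = ((a + 2 : ℕ) : ℤ) := by push_cast; ring
      have e2 : ((a + 1 : ℕ) : ℤ) - 1 = ((a : ℕ) : ℤ) := by push_cast; ring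
      rw [e1, e2, latticeCoeff_natCast, latticeCoeff_natCast, centralCoeff_zero, centralCoeff_zero,
        if_neg (by exact_mod_cast a.succ_ne_zero), pow_add, Complex.I_sq]
      ring
  rcases Int.natAbs_eq a with h | h
  · rw [h]; exact key _
  · have := key a.natAbs
    rw [h, ← latticeCoeff_neg _ (-_ + 1), ← latticeCoeff_neg _ (-_ - 1), add_comm]
    rw [show -(-(a.natAbs : ℤ) - 1) = a.natAbs + 1 by ring,
      show -(-(a.natAbs : ℤ) + 1) = a.natAbs - 1 by ring, this]
    simp

lemma digammaSum_neg (N : ℕ) (a : ℂ) : digammaSum N (-a) = digammaSum N a := by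
  simp only [digammaSum, sub_neg_eq_add, ← sub_eq_add_neg]
  ring

lemma half_int_ne_neg_nat {k : ℤ} (hk : Odd k) (m : ℕ) : (k : ℂ) / 2 ≠ -(m : ℂ) := by
  intro h
  have : (k : ℂ) = ((-2 * m : ℤ) : ℂ) := by push_cast; linear_combination 2 * h
  have : k = -2 * m := by exact_mod_cast this
  rw [this] at hk
  exact (Int.not_even_iff_odd.mpr hk) ⟨-m, by ring⟩

/-- Under (N, a) → (N+1, a+1) two of the four arguments move up by 1 and the other two are
unchanged, after the first pair trades places. Parity makes the shifted argument containing a half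
an odd integer, hence never a pole of digamma. -/
lemma digammaSum_succ_add_one (N : ℕ) (a : ℤ) (h : Even (N + a)) :
    digammaSum (N + 1) (a + 1) = digammaSum N a + 2 / (N + 1) - 2 / (N + 1 + a) := by
  have hodd : Odd (1 + a + N) := by
    have : 1 + a + N = (N + a) + 1 := by ring
    rw [this]; exact h.add_one
  have h1 := Complex.digamma_apply_add_one (((1 + a + N : ℤ) : ℂ) / 2) (half_int_ne_neg_nat hodd)
  have h2 := Complex.digamma_apply_add_one ((1 + N : ℂ) / 2) (fun m hm => by
    have h3 : (1 + N + 2 * m : ℂ) = 0 := by linear_combination 2 * hm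
    have h4 : 1 + N + 2 * m = 0 := by exact_mod_cast h3
    omega)
  simp only [digammaSum]
  have e1 : (1 : ℂ) + ((N + 1 : ℕ) : ℂ) / 2 = (1 + N : ℂ) / 2 + 1 := by push_cast; ring
  have e2 : ((1 : ℂ) + ((N + 1 : ℕ) : ℂ)) / 2 = 1 + N / 2 := by push_cast; ring
  have e3 : ((1 : ℂ) + (a + 1) + ((N + 1 : ℕ) : ℂ)) / 2 = ((1 + a + N : ℤ) : ℂ) / 2 + 1 := by
    push_cast; ring
  have e4 : ((1 : ℂ) - (a + 1) + ((N + 1 : ℕ) : ℂ)) / 2 = (1 - a + N) / 2 := by push_cast; ring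
  rw [e1, e2, e3, e4, h1, h2]
  push_cast
  rw [inv_div, inv_div, show (N : ℂ) + 1 = 1 + N by ring, show (1 : ℂ) + N + a = 1 + a + N by ring]
  ring

lemma digammaSum_succ_sub_one (N : ℕ) (a : ℤ) (h : Even (N + a)) :
    digammaSum (N + 1) (a - 1) = digammaSum N a + 2 / (N + 1) - 2 / (N + 1 - a) := by
  have h' : Even (N + -a) := by
    have : (N : ℤ) + -a = (N + a) - 2 * a := by ring
    rw [this]; exact h.sub (even_two_mul a)
  have := digammaSum_succ_add_one N (-a) h'
  push_cast at this
  rw [show -(a : ℂ) + 1 = -(a - 1) by ring, digammaSum_neg, digammaSum_neg] at this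
  rw [this]; ring

lemma digammaSum_add_two (N : ℕ) (a : ℤ) (h : Even (N + a)) :
    digammaSum (N + 2) a = digammaSum N a + 2 / (N + 1) + 2 / (N + 2)
      - 2 / (N + 1 - a) - 2 / (N + 1 + a) := by
  have h1 := digammaSum_succ_sub_one N a h
  have h2 := digammaSum_succ_add_one (N + 1) (a - 1) (by
    have : ((N + 1 : ℕ) : ℤ) + (a - 1) = N + a := by push_cast; ring
    rwa [this])
  push_cast at h2
  rw [sub_add_cancel, h1] at h2
  rw [h2, show (N : ℂ) + 1 + 1 = N + 2 by ring, show (N : ℂ) + 2 + (a - 1) = N + 1 + a by ring]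
  ring

lemma int_cast_ne_zero_of_odd {k : ℤ} (hk : Odd k) : (k : ℂ) ≠ 0 := by
  intro h
  have : k = 0 := by exact_mod_cast h
  subst this
  exact (by decide : ¬ Odd (0 : ℤ)) hk

/-- The rational increments of the digamma sums must cancel. For a > 0, multiplied by the
coefficient ratios they become a/(N+1)² at both neighbours, and i^(a+1) = -i^(a-1) makes them
annihilate; at a = 0 both neighbours have the same increment, which is 0. -/
lemma latticeCoeff_mul_digammaSum_succ (N : ℕ) (a : ℤ) (h : Even (N + a)) :
    latticeCoeff (N + 1) (a + 1) * digammaSum (N + 1) (a + 1)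
      + latticeCoeff (N + 1) (a - 1) * digammaSum (N + 1) (a - 1)
      = Complex.I * (latticeCoeff N a * digammaSum N a) := by
  have key : ∀ a : ℕ, Even ((N : ℤ) + a) →
      latticeCoeff (N + 1) (a + 1) * digammaSum (N + 1) (a + 1)
      + latticeCoeff (N + 1) (a - 1) * digammaSum (N + 1) (a - 1)
      = Complex.I * (latticeCoeff N a * digammaSum N a) := by
    intro a h
    have h1 : (N : ℂ) + 1 ≠ 0 := by exact_mod_cast N.succ_ne_zero
    have hp : Odd ((N : ℤ) + 1 + a) := by
      rw [show (N : ℤ) + 1 + a = N + a + 1 by ring]; exact h.add_one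
    have hm : Odd ((N : ℤ) + 1 - a) := by
      rw [show (N : ℤ) + 1 - a = N + 1 + a - 2 * a by ring]; exact hp.sub_even (even_two_mul _)
    have hp' : (N : ℂ) + 1 + a ≠ 0 := by exact_mod_cast int_cast_ne_zero_of_odd hp
    have hm' : (N : ℂ) + 1 - a ≠ 0 := by exact_mod_cast int_cast_ne_zero_of_odd hm
    have hD1 := digammaSum_succ_add_one N a h
    have hD2 := digammaSum_succ_sub_one N a h
    simp only [Int.cast_natCast] at hD1 hD2
    rw [hD1, hD2]
    rcases a with _ | a
    · have e1 : ((0 : ℕ) : ℤ) + 1 = ((1 : ℕ) : ℤ) := by simp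
      have e2 : ((0 : ℕ) : ℤ) - 1 = -((1 : ℕ) : ℤ) := by simp
      rw [e1, e2, latticeCoeff_neg, latticeCoeff_natCast, latticeCoeff_natCast]
      have := two_mul_centralCoeff_succ_one N
      simp only [Nat.cast_one, Nat.cast_zero, pow_one, pow_zero, add_zero, sub_zero]
      linear_combination Complex.I * digammaSum N 0 * this
    · have e1 : ((a + 1 : ℕ) : ℤ) + 1 = ((a + 2 : ℕ) : ℤ) := by push_cast; ring
      have e2 : ((a + 1 : ℕ) : ℤ) - 1 = ((a : ℕ) : ℤ) := by push_cast; ring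
      rw [e1, e2, latticeCoeff_natCast, latticeCoeff_natCast, latticeCoeff_natCast]
      have h2 := centralCoeff_succ_add_one N (a + 1)
      have h3 := centralCoeff_succ_sub_one N (a + 1)
      rw [add_sub_cancel_right] at h3
      have e3 : ((a + 2 : ℕ) : ℂ) = (a : ℂ) + 1 + 1 := by push_cast; ring
      have e4 : ((a + 1 : ℕ) : ℂ) = (a : ℂ) + 1 := by push_cast; ring
      rw [e4] at hp' hm'
      rw [e3, e4, h2, h3, pow_add, Complex.I_sq, pow_succ]
      generalize digammaSum N ((a : ℂ) + 1) = D
      generalize centralCoeff N ((a : ℂ) + 1) = Q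
      have hI : Complex.I * Complex.I = -1 := Complex.I_mul_I
      have e5 : Complex.I * (Complex.I ^ a * Complex.I * Q * D) = - (Complex.I ^ a * Q * D) := by
        linear_combination Complex.I ^ a * Q * D * hI
      rw [e5]
      field_simp
      ring
  rcases Int.natAbs_eq a with e | e
  · rw [e] at h ⊢
    have := key _ h
    simpa only [Int.cast_natCast] using this
  · have h' : Even ((N : ℤ) + a.natAbs) := by
      rw [show (N : ℤ) + a.natAbs = N + a - 2 * a by
        have : (a.natAbs : ℤ) = -a := by omega
        rw [this]; ring]
      exact h.sub (even_two_mul a)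
    have := key a.natAbs h'
    have e6 : (a : ℂ) = -(a.natAbs : ℂ) := by exact_mod_cast congrArg (Int.cast : ℤ → ℂ) e
    rw [e6, digammaSum_neg, ← digammaSum_neg _ (-_ + 1), ← digammaSum_neg _ (-_ - 1),
      ← latticeCoeff_neg _ (a + 1), ← latticeCoeff_neg _ (a - 1), ← latticeCoeff_neg N a,
      show -(a + 1) = (a.natAbs : ℤ) - 1 by omega, show -(a - 1) = (a.natAbs : ℤ) + 1 by omega,
      show -a = (a.natAbs : ℤ) by omega, ← this, add_comm]
    congr 3 <;> ring

/-! ### The expansion solves the lattice equation -/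

/-- The `N`-th term of the expansion of `4 G` in powers of `w = (z - 4) / 4`, in the rotated
coordinates `a = n₁ + n₂`, `b = n₁ - n₂`. -/
noncomputable def greenTerm (w : ℂ) (a b : ℤ) (N : ℕ) : ℂ :=
  (4 * w) ^ N * (latticeCoeff N a * latticeCoeff N b) *
    if Even (N + a) then Complex.I / Real.pi *
      (-Complex.log (-w ^ 2) + digammaSum N a + digammaSum N b) else 1

/-- The sum over (a±1, b±1) factors into a sum over a times a sum over b, and i · i = -1 supplies
the sign. The bracket is a function of a plus a function of b, so only one factor at a time carries
a digamma sum. -/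
lemma greenTerm_succ (w : ℂ) (a b : ℤ) (hab : Even (a + b)) (N : ℕ) :
    greenTerm w (a + 1) (b + 1) (N + 1) + greenTerm w (a - 1) (b - 1) (N + 1)
      + greenTerm w (a + 1) (b - 1) (N + 1) + greenTerm w (a - 1) (b + 1) (N + 1)
      = -(4 * w) * greenTerm w a b N := by
  have hI : Complex.I * Complex.I = -1 := Complex.I_mul_I
  have ha := latticeCoeff_succ N a
  have hb := latticeCoeff_succ N b
  -- Passing to N + 1 and a ± 1 preserves the parity of N + a, so all five points lie in the same
  -- branch.
  have e1 : Even (((N + 1 : ℕ) : ℤ) + (a + 1)) ↔ Even (N + a) := by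
    push_cast; simp only [Int.even_add]; tauto
  have e2 : Even (((N + 1 : ℕ) : ℤ) + (a - 1)) ↔ Even (N + a) := by
    push_cast; rw [show (N : ℤ) + 1 + (a - 1) = N + a by ring]
  simp only [greenTerm, e1, e2]
  by_cases h : Even (N + a)
  · have h' : Even (N + b) := by
      rw [show (N : ℤ) + b = N + a + (a + b) - 2 * a by ring]
      exact (h.add hab).sub (even_two_mul a)
    have hDa := latticeCoeff_mul_digammaSum_succ N a h
    have hDb := latticeCoeff_mul_digammaSum_succ N b h'
    simp only [h, if_true]
    push_cast
    generalize latticeCoeff (N + 1) (a + 1) = u1 at *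
    generalize latticeCoeff (N + 1) (a - 1) = u2 at *
    generalize latticeCoeff (N + 1) (b + 1) = v1 at *
    generalize latticeCoeff (N + 1) (b - 1) = v2 at *
    generalize digammaSum (N + 1) (a + 1) = d1 at *
    generalize digammaSum (N + 1) (a - 1) = d2 at *
    generalize digammaSum (N + 1) (b + 1) = f1 at *
    generalize digammaSum (N + 1) (b - 1) = f2 at *
    generalize Complex.log (-w ^ 2) = l at *
    have key : (u1 * v1 * (-l + d1 + f1) + u2 * v2 * (-l + d2 + f2) + u1 * v2 * (-l + d1 + f2)
        + u2 * v1 * (-l + d2 + f1)) = - (latticeCoeff N a * latticeCoeff N b) *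
          (-l + digammaSum N a + digammaSum N b) := by
      have : (u1 * v1 * (-l + d1 + f1) + u2 * v2 * (-l + d2 + f2) + u1 * v2 * (-l + d1 + f2)
        + u2 * v1 * (-l + d2 + f1)) = -l * ((u1 + u2) * (v1 + v2)) +
          (u1 * d1 + u2 * d2) * (v1 + v2) + (u1 + u2) * (v1 * f1 + v2 * f2) := by ring
      rw [this, ha, hb, hDa, hDb]
      linear_combination (latticeCoeff N a * latticeCoeff N b) *
          (-l + digammaSum N a + digammaSum N b) * hI
    linear_combination (4 * w) ^ (N + 1) * (Complex.I / Real.pi) * key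
  · simp only [h, if_false]
    have : (latticeCoeff (N + 1) (a + 1) + latticeCoeff (N + 1) (a - 1)) *
        (latticeCoeff (N + 1) (b + 1) + latticeCoeff (N + 1) (b - 1))
        = - (latticeCoeff N a * latticeCoeff N b) := by
      rw [ha, hb]; linear_combination (latticeCoeff N a * latticeCoeff N b) * hI
    linear_combination (4 * w) ^ (N + 1) * this

/-- For even a the neighbours lie in the branch without logarithm and (2i)(2i) = -4 is the source.
For odd a the coefficients alternate, leaving a mixed second difference of a bracket of the form
f(a) + g(b), which vanishes. -/
lemma greenTerm_zero (w : ℂ) (a b : ℤ) (hab : Even (a + b)) :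
    greenTerm w (a + 1) (b + 1) 0 + greenTerm w (a - 1) (b - 1) 0
      + greenTerm w (a + 1) (b - 1) 0 + greenTerm w (a - 1) (b + 1) 0
      = if a = 0 ∧ b = 0 then -4 else 0 := by
  have hI : Complex.I * Complex.I = -1 := Complex.I_mul_I
  have ha := latticeCoeff_zero a
  have hb := latticeCoeff_zero b
  have e1 : Even (((0 : ℕ) : ℤ) + (a + 1)) ↔ ¬ Even a := by simp
  have e2 : Even (((0 : ℕ) : ℤ) + (a - 1)) ↔ ¬ Even a := by simp
  simp only [greenTerm, e1, e2, pow_zero, one_mul]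
  by_cases h : Even a
  · simp only [h, not_true, if_false, mul_one]
    have : (latticeCoeff 0 (a + 1) + latticeCoeff 0 (a - 1)) *
        (latticeCoeff 0 (b + 1) + latticeCoeff 0 (b - 1))
        = if a = 0 ∧ b = 0 then -4 else 0 := by
      rw [ha, hb]
      by_cases h1 : a = 0 <;> by_cases h2 : b = 0 <;> simp [h1, h2]
      linear_combination 4 * hI
    rw [← this]; ring
  · have h' : ¬ Even b := by rw [Int.even_add] at hab; tauto
    have ha0 : a ≠ 0 := by rintro rfl; exact h Even.zero
    have hb0 : b ≠ 0 := by rintro rfl; exact h' Even.zero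
    rw [if_neg ha0] at ha
    rw [if_neg hb0] at hb
    simp only [h, not_false_eq_true, if_true, ha0, hb0, and_self, if_false]
    rw [eq_neg_of_add_eq_zero_left ha, eq_neg_of_add_eq_zero_left hb]
    push_cast
    ring

/-! ### Growth bounds, convergence and symmetry of the expansion -/

lemma bounded_of_le_two_step (s : ℕ → ℝ) (K : ℕ) (hs : ∀ N, 0 ≤ s N)
    (h : ∀ N, K ≤ N → s (N + 2) ≤ s N) : ∃ C, ∀ N, s N ≤ C := by
  refine ⟨∑ j ∈ Finset.range (K + 2), s j, fun N => ?_⟩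
  induction N using Nat.strong_induction_on with
  | _ N ih =>
    by_cases hN : N < K + 2
    · exact Finset.single_le_sum (f := s) (fun i _ => hs i) (Finset.mem_range.mpr hN)
    · obtain ⟨M, rfl⟩ : ∃ M, N = M + 2 := ⟨N - 2, by omega⟩
      exact (h M (by omega)).trans (ih M (by omega))

/-- Once N ≥ |a| the two-step ratio has modulus at most 1/4, so 2^N |c_N(a)| decreases along each
parity class. The 4^N in the expansion is thus absorbed by the two coefficients. -/
lemma exists_norm_latticeCoeff_le (a : ℤ) :
    ∃ C, ∀ N, ‖latticeCoeff N a‖ * 2 ^ N ≤ C := by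
  have e : ∀ N, ‖latticeCoeff N a‖ = ‖centralCoeff N a.natAbs‖ := fun N => by
    simp [latticeCoeff]
  simp only [e]
  refine bounded_of_le_two_step _ a.natAbs (fun N => by positivity) fun N hN => ?_
  set m := a.natAbs
  have h1 : ‖((m : ℂ) ^ 2 - (N + 1) ^ 2) / (4 * ((N + 1) * (N + 2)))‖ ≤ 1 / 4 := by
    have e1 : ((m : ℂ) ^ 2 - (N + 1) ^ 2) / (4 * ((N + 1) * (N + 2)))
      = (((m : ℝ) ^ 2 - (N + 1) ^ 2) / (4 * ((N + 1) * (N + 2))) : ℝ) := by push_cast; ring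
    have hmN : (m : ℝ) ≤ N := by exact_mod_cast hN
    have hm0 : (0 : ℝ) ≤ m := by positivity
    rw [e1, Complex.norm_real, Real.norm_eq_abs, abs_div, abs_of_pos (a := 4 * _) (by positivity),
      div_le_div_iff₀ (by positivity) (by norm_num), abs_of_nonpos (by nlinarith)]
    nlinarith
  rw [centralCoeff_add_two, norm_mul, pow_add]
  have h2 : 0 ≤ ‖centralCoeff N m‖ * 2 ^ N := by positivity
  nlinarith

lemma norm_two_div_le {k : ℤ} (hk : k ≠ 0) : ‖(2 : ℂ) / k‖ ≤ 2 := by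
  rw [norm_div, Complex.norm_ofNat, Complex.norm_intCast]
  have : (1 : ℝ) ≤ |(k : ℝ)| := by exact_mod_cast Int.one_le_abs hk
  rw [div_le_iff₀ (by linarith)]
  linarith

/-- A crude linear bound suffices against a geometric factor: each step N → N + 2 adds four terms
2/k with k a nonzero integer, at most 8 in total. -/
lemma exists_norm_digammaSum_le (a : ℤ) :
    ∃ C, 0 ≤ C ∧ ∀ N : ℕ, Even (N + a) → ‖digammaSum N a‖ ≤ C + 4 * N := by
  refine ⟨‖digammaSum 0 a‖ + ‖digammaSum 1 a‖, by positivity, fun N => ?_⟩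
  induction N using Nat.twoStepInduction with
  | zero => intro _; simp
  | one => intro _; linarith [norm_nonneg (digammaSum 0 a), Nat.cast_one (R := ℝ)]
  | more N h _ =>
    intro hN
    have hN' : Even ((N : ℤ) + a) := by
      rw [show (N : ℤ) + a = ((N + 2 : ℕ) : ℤ) + a - 2 * 1 by push_cast; ring]
      exact hN.sub (even_two_mul 1)
    have h1 := h hN'
    have hp : (N : ℤ) + 1 + a ≠ 0 := by
      rintro h0
      rw [show (N : ℤ) + a = 2 * (-1) + 1 by linarith] at hN'
      exact Int.not_even_two_mul_add_one _ hN'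
    have hm : (N : ℤ) + 1 - a ≠ 0 := by
      rintro h0
      rw [show (N : ℤ) + a = 2 * N + 1 by linarith] at hN'
      exact Int.not_even_two_mul_add_one _ hN'
    rw [digammaSum_add_two N a hN']
    have b1 := norm_two_div_le (k := N + 1) (by omega)
    have b2 := norm_two_div_le (k := N + 2) (by omega)
    have b3 := norm_two_div_le hm
    have b4 := norm_two_div_le hp
    push_cast at b1 b2 b3 b4 ⊢
    have := norm_sub_le (digammaSum N a + 2 / (N + 1) + 2 / (N + 2) - 2 / (N + 1 - a) : ℂ)
      (2 / (N + 1 + a))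
    have := norm_sub_le (digammaSum N a + 2 / (N + 1) + 2 / (N + 2) : ℂ) (2 / (N + 1 - a))
    have := norm_add_le (digammaSum N a + 2 / (N + 1) : ℂ) (2 / (N + 2))
    have := norm_add_le (digammaSum N a) (2 / (N + 1) : ℂ)
    linarith

lemma summable_greenTerm {w : ℂ} (hw : ‖w‖ < 1) (a b : ℤ) (hab : Even (a + b)) :
    Summable (greenTerm w a b) := by
  obtain ⟨A, hA⟩ := exists_norm_latticeCoeff_le a
  obtain ⟨B, hB⟩ := exists_norm_latticeCoeff_le b
  obtain ⟨C, hC0, hC⟩ := exists_norm_digammaSum_le a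
  obtain ⟨D, hD0, hD⟩ := exists_norm_digammaSum_le b
  set l := Complex.log (-w ^ 2)
  set c := ‖Complex.I / (Real.pi : ℂ)‖
  have hA0 : 0 ≤ A := le_trans (by positivity) (hA 0)
  have hB0 : 0 ≤ B := le_trans (by positivity) (hB 0)
  have hr : ‖‖w‖‖ < 1 := by simpa using hw
  have s1 := (summable_geometric_of_norm_lt_one hr).mul_left
    (A * B * (c * (‖l‖ + C + D) + 1))
  have s2 := (summable_pow_mul_geometric_of_norm_lt_one 1 hr).mul_left (A * B * (c * 8))
  refine Summable.of_norm_bounded (s1.add s2) fun N => ?_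
  have h1 : ‖(4 * w) ^ N * (latticeCoeff N a * latticeCoeff N b)‖ ≤ ‖w‖ ^ N * (A * B) := by
    have e : ‖(4 * w) ^ N * (latticeCoeff N a * latticeCoeff N b)‖
      = ‖w‖ ^ N * ((‖latticeCoeff N a‖ * 2 ^ N) * (‖latticeCoeff N b‖ * 2 ^ N)) := by
      rw [norm_mul, norm_pow, norm_mul, norm_mul, Complex.norm_ofNat, mul_pow,
        show (4 : ℝ) = 2 * 2 by norm_num, mul_pow]
      ring
    rw [e]
    gcongr
    · exact hA N
    · exact hB N
  have h2 : ‖(if Even (N + a) then Complex.I / Real.pi *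
      (-l + digammaSum N a + digammaSum N b) else 1 : ℂ)‖
        ≤ (c * (‖l‖ + C + D) + 1) + c * 8 * N := by
    split_ifs with h
    · have h' : Even (N + b) := by
        rw [show (N : ℤ) + b = N + a + (a + b) - 2 * a by ring]
        exact (h.add hab).sub (even_two_mul a)
      have h3 := hC N h
      have h4 := hD N h'
      rw [norm_mul]
      have h5 : ‖-l + digammaSum N a + digammaSum N b‖ ≤ ‖l‖ + C + D + 8 * N := by
        have := norm_add_le (-l + digammaSum N a) (digammaSum N b)
        have := norm_add_le (-l) (digammaSum N a)
        rw [norm_neg] at this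
        linarith
      have hc : 0 ≤ c := norm_nonneg _
      have := mul_le_mul_of_nonneg_left h5 hc
      linarith
    · rw [norm_one]
      have : 0 ≤ c := norm_nonneg _
      have : 0 ≤ c * (‖l‖ + C + D) := by positivity
      have : 0 ≤ c * 8 * N := by positivity
      linarith
  rw [greenTerm, norm_mul]
  refine (mul_le_mul h1 h2 (norm_nonneg _) (by positivity)).trans (le_of_eq ?_)
  ring

/-- The sum of the expansion of `G` in powers of `w = (z - 4) / 4`. -/
noncomputable def greenSeries (w : ℂ) (a b : ℤ) : ℂ := (∑' N, greenTerm w a b N) / 4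

lemma greenSeries_recursion {w : ℂ} (hw : ‖w‖ < 1) (a b : ℤ) (hab : Even (a + b)) :
    greenSeries w (a + 1) (b + 1) + greenSeries w (a - 1) (b - 1)
      + greenSeries w (a + 1) (b - 1) + greenSeries w (a - 1) (b + 1)
      = -(4 * w) * greenSeries w a b - if a = 0 ∧ b = 0 then 1 else 0 := by
  have s1 := summable_greenTerm hw (a + 1) (b + 1) (by
    rw [show a + 1 + (b + 1) = a + b + 2 * 1 by ring]; exact hab.add (even_two_mul 1))
  have s2 := summable_greenTerm hw (a - 1) (b - 1) (by
    rw [show a - 1 + (b - 1) = a + b - 2 * 1 by ring]; exact hab.sub (even_two_mul 1))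
  have s3 := summable_greenTerm hw (a + 1) (b - 1) (by
    rwa [show a + 1 + (b - 1) = a + b by ring])
  have s4 := summable_greenTerm hw (a - 1) (b + 1) (by
    rwa [show a - 1 + (b + 1) = a + b by ring])
  have s := ((s1.add s2).add s3).add s4
  have key : (∑' N, greenTerm w (a + 1) (b + 1) N) + (∑' N, greenTerm w (a - 1) (b - 1) N)
      + (∑' N, greenTerm w (a + 1) (b - 1) N) + (∑' N, greenTerm w (a - 1) (b + 1) N)
      = (if a = 0 ∧ b = 0 then -4 else 0) + -(4 * w) * ∑' N, greenTerm w a b N := by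
    -- Peeling off N = 0 leaves the source; the terms N + 1 of the neighbours give -4w times the
    -- N-th term at the centre.
    rw [← s1.tsum_add s2, ← (s1.add s2).tsum_add s3, ← ((s1.add s2).add s3).tsum_add s4,
      s.tsum_eq_zero_add, greenTerm_zero w a b hab, ← tsum_mul_left]
    simp only [greenTerm_succ w a b hab]
  simp only [greenSeries]
  have : (if a = 0 ∧ b = 0 then (-4 : ℂ) else 0) = -4 * if a = 0 ∧ b = 0 then 1 else 0 := by
    split_ifs <;> simp
  rw [this] at key
  linear_combination key / 4

lemma greenTerm_neg_right (w : ℂ) (a b : ℤ) (N : ℕ) :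
    greenTerm w a (-b) N = greenTerm w a b N := by
  simp only [greenTerm, latticeCoeff_neg, Int.cast_neg, digammaSum_neg]

lemma greenTerm_comm (w : ℂ) (a b : ℤ) (hab : Even (a + b)) (N : ℕ) :
    greenTerm w b a N = greenTerm w a b N := by
  have : Even ((N : ℤ) + b) ↔ Even ((N : ℤ) + a) := by
    simp only [Int.even_add] at hab ⊢; tauto
  simp only [greenTerm, this, mul_comm (latticeCoeff N b),
    add_right_comm _ (digammaSum N b) (digammaSum N a)]

lemma greenSeries_neg_right (w : ℂ) (a b : ℤ) : greenSeries w a (-b) = greenSeries w a b := by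
  simp only [greenSeries, greenTerm_neg_right]

lemma greenSeries_comm (w : ℂ) (a b : ℤ) (hab : Even (a + b)) :
    greenSeries w b a = greenSeries w a b := by
  simp only [greenSeries, greenTerm_comm w a b hab]

/-! ### Translation into Pochhammer symbols and hypergeometric series -/

lemma poch_succ (q : ℂ) (k : ℕ) : poch q (k + 1) = poch q k * (q + k) := by
  simp [poch, Finset.prod_range_succ]

lemma poch_zero (q : ℂ) : poch q 0 = 1 := by simp [poch]

lemma poch_one (k : ℕ) : poch 1 k = k.factorial := by
  induction k with
  | zero => simp [poch_zero]
  | succ k ih => rw [poch_succ, ih, Nat.factorial_succ]; push_cast; ring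

lemma poch_ne_zero {x : ℝ} (hx : 0 < x) (k : ℕ) : poch x k ≠ 0 := by
  refine Finset.prod_ne_zero_iff.mpr fun i _ => ?_
  have : (x : ℝ) + i ≠ 0 := by positivity
  exact_mod_cast this

lemma poch_one_half_ne_zero (k : ℕ) : poch (1 / 2) k ≠ 0 := by
  have := poch_ne_zero (x := 1 / 2) (by norm_num) k
  push_cast at this
  exact this

lemma poch_three_halves_ne_zero (k : ℕ) : poch (3 / 2) k ≠ 0 := by
  have := poch_ne_zero (x := 3 / 2) (by norm_num) k
  push_cast at this
  exact this

/-- The two-step recursion factors as a² - (2k+1)² = -(2k+1+a)(2k+1-a), which is one step of each of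
the two Pochhammer symbols. -/
lemma centralCoeff_even (k : ℕ) (a : ℂ) :
    centralCoeff (2 * k) a = (-1) ^ k * (poch ((1 + a) / 2) k * poch ((1 - a) / 2) k) /
      (4 ^ k * ((k.factorial : ℂ) * poch (1 / 2) k)) := by
  induction k with
  | zero => simp [poch_zero, centralCoeff_zero]
  | succ k ih =>
    have h1 : (k.factorial : ℂ) ≠ 0 := by exact_mod_cast k.factorial_ne_zero
    have h2 := poch_one_half_ne_zero k
    have h3 : (k : ℂ) + 1 ≠ 0 := by exact_mod_cast k.succ_ne_zero
    have h4 : (2 * k : ℂ) + 1 ≠ 0 := by exact_mod_cast (2 * k).succ_ne_zero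
    have h5 : (1 : ℂ) / 2 + k = (2 * k + 1) / 2 := by ring
    have h6 : (2 * k : ℂ) + 2 = 2 * (k + 1) := by ring
    rw [show 2 * (k + 1) = 2 * k + 2 by ring, centralCoeff_add_two, ih]
    simp only [poch_succ, Nat.factorial_succ, pow_succ, h5]
    push_cast
    rw [h6]
    field_simp
    ring

lemma centralCoeff_odd (k : ℕ) (a : ℂ) :
    centralCoeff (2 * k + 1) a = a / 2 *
      ((-1) ^ k * (poch ((2 + a) / 2) k * poch ((2 - a) / 2) k) /
        (4 ^ k * ((k.factorial : ℂ) * poch (3 / 2) k))) := by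
  induction k with
  | zero => simp [poch_zero, centralCoeff_one]
  | succ k ih =>
    have h1 : (k.factorial : ℂ) ≠ 0 := by exact_mod_cast k.factorial_ne_zero
    have h2 := poch_three_halves_ne_zero k
    have h3 : (k : ℂ) + 1 ≠ 0 := by exact_mod_cast k.succ_ne_zero
    have h4 : (2 * k : ℂ) + 3 ≠ 0 := by exact_mod_cast (2 * k + 2).succ_ne_zero
    have h5 : (3 : ℂ) / 2 + k = (2 * k + 3) / 2 := by ring
    have h6 : (2 * k : ℂ) + 1 + 1 = 2 * (k + 1) := by ring
    have h7 : (2 * k : ℂ) + 1 + 2 = 2 * k + 3 := by ring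
    rw [show 2 * (k + 1) + 1 = 2 * k + 1 + 2 by ring, centralCoeff_add_two, ih]
    simp only [poch_succ, Nat.factorial_succ, pow_succ, h5]
    push_cast
    rw [h6, h7]
    field_simp
    ring

lemma natCast_natAbs_eq_or (a : ℤ) : ((a.natAbs : ℕ) : ℂ) = a ∨ ((a.natAbs : ℕ) : ℂ) = -a := by
  rcases Int.natAbs_eq a with h | h
  · left
    conv_rhs => rw [h]
    rw [Int.cast_natCast]
  · right
    have := congrArg (Int.cast : ℤ → ℂ) h
    push_cast at this
    rw [this]; simp

lemma latticeCoeff_even (k : ℕ) (a : ℤ) :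
    latticeCoeff (2 * k) a = Complex.I ^ a.natAbs *
      ((-1) ^ k * (poch ((1 + a) / 2) k * poch ((1 - a) / 2) k) /
      (4 ^ k * ((k.factorial : ℂ) * poch (1 / 2) k))) := by
  rw [latticeCoeff, centralCoeff_even]
  rcases natCast_natAbs_eq_or a with h | h <;> rw [h]
  rw [← sub_eq_add_neg, sub_neg_eq_add, mul_comm (poch ((1 - (a : ℂ)) / 2) k)]

lemma latticeCoeff_odd (k : ℕ) (a : ℤ) :
    latticeCoeff (2 * k + 1) a = Complex.I ^ a.natAbs * (((|a| : ℤ) : ℂ) / 2 *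
      ((-1) ^ k * (poch ((2 + a) / 2) k * poch ((2 - a) / 2) k) /
      (4 ^ k * ((k.factorial : ℂ) * poch (3 / 2) k)))) := by
  have e : ((|a| : ℤ) : ℂ) = (a.natAbs : ℂ) := by
    rw [Int.abs_eq_natAbs]; simp
  rw [latticeCoeff, centralCoeff_odd, e]
  rcases natCast_natAbs_eq_or a with h | h <;> rw [h]
  rw [← sub_eq_add_neg, sub_neg_eq_add, mul_comm (poch ((2 - (a : ℂ)) / 2) k)]

/-- The identity |m+n| + |m-n| = 2 max(|m|, |n|) is the source of the sign (-1)^M. -/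
lemma I_pow_natAbs_mul (m n : ℤ) :
    Complex.I ^ (m + n).natAbs * Complex.I ^ (m - n).natAbs
      = (-1) ^ max m.natAbs n.natAbs := by
  rw [← pow_add, show (m + n).natAbs + (m - n).natAbs = 2 * max m.natAbs n.natAbs by omega,
    pow_mul, Complex.I_sq]

lemma neg_one_pow_mul_self_eq_one (k : ℕ) : (-1 : ℂ) ^ k * (-1) ^ k = 1 := by
  rw [← mul_pow]; simp

lemma latticeCoeff_even_mul (k : ℕ) (m n : ℤ) :
    4 ^ (2 * k) * (latticeCoeff (2 * k) (m + n) * latticeCoeff (2 * k) (m - n)) =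
      (-1) ^ max m.natAbs n.natAbs *
      (poch ((1 + m + n) / 2) k * poch ((1 + m - n) / 2) k * poch ((1 - m + n) / 2) k *
        poch ((1 - m - n) / 2) k /
      ((k.factorial : ℂ) * (k.factorial : ℂ) * poch (1 / 2) k * poch (1 / 2) k)) := by
  have h1 : (k.factorial : ℂ) ≠ 0 := by exact_mod_cast k.factorial_ne_zero
  have h2 := poch_one_half_ne_zero k
  rw [latticeCoeff_even, latticeCoeff_even, ← I_pow_natAbs_mul]
  push_cast
  rw [show (1 : ℂ) + (m + n) = 1 + m + n by ring, show (1 : ℂ) - (m + n) = 1 - m - n by ring,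
    show (1 : ℂ) + (m - n) = 1 + m - n by ring, show (1 : ℂ) - (m - n) = 1 - m + n by ring]
  rw [pow_mul', pow_two]
  have := neg_one_pow_mul_self_eq_one k
  generalize (-1 : ℂ) ^ k = s at *
  field_simp
  linear_combination (poch ((1 + (m : ℂ) + n) / 2) k * poch ((1 + (m : ℂ) - n) / 2) k *
    poch ((1 - (m : ℂ) + n) / 2) k * poch ((1 - (m : ℂ) - n) / 2) k) * this

lemma latticeCoeff_odd_mul (k : ℕ) (m n : ℤ) :
    4 ^ (2 * k) * (latticeCoeff (2 * k + 1) (m + n) * latticeCoeff (2 * k + 1) (m - n)) =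
      (-1) ^ max m.natAbs n.natAbs * (((|m + n| : ℤ) : ℂ) / 2) * (((|m - n| : ℤ) : ℂ) / 2) *
      (poch ((2 + m + n) / 2) k * poch ((2 + m - n) / 2) k * poch ((2 - m + n) / 2) k *
        poch ((2 - m - n) / 2) k /
      ((k.factorial : ℂ) * (k.factorial : ℂ) * poch (3 / 2) k * poch (3 / 2) k)) := by
  have h1 : (k.factorial : ℂ) ≠ 0 := by exact_mod_cast k.factorial_ne_zero
  have h2 := poch_three_halves_ne_zero k
  rw [latticeCoeff_odd, latticeCoeff_odd, ← I_pow_natAbs_mul]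
  generalize ((|m + n| : ℤ) : ℂ) = x
  generalize ((|m - n| : ℤ) : ℂ) = y
  push_cast
  rw [show (2 : ℂ) + (m + n) = 2 + m + n by ring, show (2 : ℂ) - (m + n) = 2 - m - n by ring,
    show (2 : ℂ) + (m - n) = 2 + m - n by ring, show (2 : ℂ) - (m - n) = 2 - m + n by ring]
  rw [pow_mul', pow_two]
  have := neg_one_pow_mul_self_eq_one k
  generalize (-1 : ℂ) ^ k = s at *
  field_simp
  linear_combination x * y * (poch ((2 + (m : ℂ) + n) / 2) k * poch ((2 + (m : ℂ) - n) / 2) k *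
    poch ((2 - (m : ℂ) + n) / 2) k * poch ((2 - (m : ℂ) - n) / 2) k) * this

lemma greenTerm_even_even (z : ℂ) (n : Fin 2 → ℤ) (h : Even (n 0 + n 1)) (k : ℕ) :
    greenTerm ((z - 4) / 4) (n 0 + n 1) (n 0 - n 1) (2 * k) =
      (-1) ^ max (n 0).natAbs (n 1).natAbs * (Complex.I / Real.pi) * evenLogTerm z n k := by
  have hp : Even (((2 * k : ℕ) : ℤ) + (n 0 + n 1)) := by
    push_cast; exact (even_two_mul _).add h
  have e := latticeCoeff_even_mul k (n 0) (n 1)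
  simp only [greenTerm, if_pos hp, evenLogTerm, digammaSum]
  rw [mul_pow, mul_right_comm (4 ^ (2 * k)), e]
  push_cast
  rw [show -((z - 4) / 4) ^ 2 = -((z - 4) ^ 2 / 16) by ring,
    show (1 : ℂ) + 2 * k / 2 = 1 + k by ring, show (1 + 2 * k : ℂ) / 2 = 1 / 2 + k by ring,
    show (1 + (n 0 + n 1) + 2 * k : ℂ) / 2 = (1 + n 0 + n 1) / 2 + k by ring,
    show (1 - (n 0 + n 1) + 2 * k : ℂ) / 2 = (1 - n 0 - n 1) / 2 + k by ring,
    show (1 + (n 0 - n 1) + 2 * k : ℂ) / 2 = (1 + n 0 - n 1) / 2 + k by ring,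
    show (1 - (n 0 - n 1) + 2 * k : ℂ) / 2 = (1 - n 0 + n 1) / 2 + k by ring]
  ring

lemma greenTerm_odd_odd (z : ℂ) (n : Fin 2 → ℤ) (h : Odd (n 0 + n 1)) (k : ℕ) :
    greenTerm ((z - 4) / 4) (n 0 + n 1) (n 0 - n 1) (2 * k + 1) =
      4 * ((-1) ^ max (n 0).natAbs (n 1).natAbs * (Complex.I / Real.pi) *
        (((|n 0 + n 1| : ℤ) : ℂ) / 2) * (((|n 0 - n 1| : ℤ) : ℂ) / 2) * ((z - 4) / 4)) *
        oddLogTerm z n k := by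
  have hp : Even (((2 * k + 1 : ℕ) : ℤ) + (n 0 + n 1)) := by
    push_cast; exact (odd_two_mul_add_one _).add_odd h
  have e := latticeCoeff_odd_mul k (n 0) (n 1)
  simp only [greenTerm, if_pos hp, oddLogTerm, digammaSum]
  rw [mul_pow, mul_right_comm (4 ^ (2 * k + 1)), pow_succ' 4, mul_assoc 4, e]
  generalize ((|n 0 + n 1| : ℤ) : ℂ) = x
  generalize ((|n 0 - n 1| : ℤ) : ℂ) = y
  push_cast
  rw [show -((z - 4) / 4) ^ 2 = -((z - 4) ^ 2 / 16) by ring,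
    show (1 : ℂ) + (2 * k + 1) / 2 = 3 / 2 + k by ring,
    show (1 + (2 * k + 1) : ℂ) / 2 = 1 + k by ring,
    show (1 + (n 0 + n 1) + (2 * k + 1) : ℂ) / 2 = (2 + n 0 + n 1) / 2 + k by ring,
    show (1 - (n 0 + n 1) + (2 * k + 1) : ℂ) / 2 = (2 - n 0 - n 1) / 2 + k by ring,
    show (1 + (n 0 - n 1) + (2 * k + 1) : ℂ) / 2 = (2 + n 0 - n 1) / 2 + k by ring,
    show (1 - (n 0 - n 1) + (2 * k + 1) : ℂ) / 2 = (2 - n 0 + n 1) / 2 + k by ring, pow_succ]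
  ring

lemma greenTerm_even_odd (z : ℂ) (n : Fin 2 → ℤ) (h : Even (n 0 + n 1)) (k : ℕ) :
    greenTerm ((z - 4) / 4) (n 0 + n 1) (n 0 - n 1) (2 * k + 1) =
      4 * ((-1) ^ max (n 0).natAbs (n 1).natAbs *
        (((|n 0 + n 1| : ℤ) : ℂ) / 2) * (((|n 0 - n 1| : ℤ) : ℂ) / 2) * ((z - 4) / 4)) *
        pFqTerm
        [(2 + n 0 + n 1) / 2, (2 - n 0 - n 1) / 2, (2 + n 0 - n 1) / 2, (2 - n 0 + n 1) / 2]
        [1, 3 / 2, 3 / 2] ((z - 4) ^ 2 / 16) k := by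
  have hp : ¬ Even (((2 * k + 1 : ℕ) : ℤ) + (n 0 + n 1)) := by
    rw [Int.not_even_iff_odd]
    push_cast; exact (odd_two_mul_add_one _).add_even h
  have e := latticeCoeff_odd_mul k (n 0) (n 1)
  -- The lower parameter 1 contributes a factorial via `poch_one`; together with the k! of the
  -- hypergeometric series it gives the square k! k!.
  simp only [greenTerm, if_neg hp, pFqTerm, List.map_cons, List.map_nil, List.prod_cons,
    List.prod_nil, poch_one]
  rw [mul_pow, mul_right_comm (4 ^ (2 * k + 1)), pow_succ' 4, mul_assoc 4, e,
    show ((z - 4) ^ 2 / 16) ^ k = ((z - 4) / 4) ^ (2 * k) by rw [pow_mul]; congr 1; ring]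
  have h1 : (k.factorial : ℂ) ≠ 0 := by exact_mod_cast k.factorial_ne_zero
  have h2 := poch_three_halves_ne_zero k
  generalize ((|n 0 + n 1| : ℤ) : ℂ) = x
  generalize ((|n 0 - n 1| : ℤ) : ℂ) = y
  generalize (z - 4) / 4 = w
  field_simp
  ring

lemma greenTerm_odd_even (z : ℂ) (n : Fin 2 → ℤ) (h : Odd (n 0 + n 1)) (k : ℕ) :
    greenTerm ((z - 4) / 4) (n 0 + n 1) (n 0 - n 1) (2 * k) =
      (-1) ^ max (n 0).natAbs (n 1).natAbs *
        pFqTerm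
        [(1 + n 0 + n 1) / 2, (1 + n 0 - n 1) / 2, (1 - n 0 + n 1) / 2, (1 - n 0 - n 1) / 2]
        [1, 1 / 2, 1 / 2] ((z - 4) ^ 2 / 16) k := by
  have hp : ¬ Even (((2 * k : ℕ) : ℤ) + (n 0 + n 1)) := by
    rw [Int.not_even_iff_odd]
    push_cast; exact (even_two_mul _).add_odd h
  have e := latticeCoeff_even_mul k (n 0) (n 1)
  simp only [greenTerm, if_neg hp, pFqTerm, List.map_cons, List.map_nil, List.prod_cons,
    List.prod_nil, poch_one]
  rw [mul_pow, mul_right_comm (4 ^ (2 * k)), e,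
    show ((z - 4) ^ 2 / 16) ^ k = ((z - 4) / 4) ^ (2 * k) by rw [pow_mul]; congr 1; ring]
  have h1 : (k.factorial : ℂ) ≠ 0 := by exact_mod_cast k.factorial_ne_zero
  have h2 := poch_one_half_ne_zero k
  generalize (z - 4) / 4 = w
  field_simp

/-- For even |n| the prefactor |n₁+n₂| |n₁-n₂| may vanish, so summability of the hypergeometric
series cannot be read off from `greenTerm`. Hence a direct bound: the ratio of consecutive terms is
((k+1)² - a²/4) / ((k+1)(k+3/2)), which lies in [0, 1] for k ≥ |a|. -/
lemma exists_norm_poch_mul_poch_le (a : ℤ) :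
    ∃ C, ∀ k, ‖poch ((2 + a) / 2) k * poch ((2 - a) / 2) k /
      ((k.factorial : ℂ) * poch (3 / 2) k)‖ ≤ C := by
  have step : ∀ k : ℕ, a.natAbs ≤ k →
      ‖poch ((2 + a) / 2) (k + 1) * poch ((2 - a) / 2) (k + 1) /
        (((k + 1).factorial : ℂ) * poch (3 / 2) (k + 1))‖ ≤
      ‖poch ((2 + a) / 2) k * poch ((2 - a) / 2) k / ((k.factorial : ℂ) * poch (3 / 2) k)‖ := by
    intro k hk
    have h1 : (k.factorial : ℂ) ≠ 0 := by exact_mod_cast k.factorial_ne_zero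
    have h2 := poch_three_halves_ne_zero k
    have h3 : (k : ℂ) + 1 ≠ 0 := by exact_mod_cast k.succ_ne_zero
    have h4 : (2 * k : ℂ) + 3 ≠ 0 := by exact_mod_cast (2 * k + 2).succ_ne_zero
    have h5 : (3 : ℂ) / 2 + k = (2 * k + 3) / 2 := by ring
    have e : poch ((2 + a) / 2) (k + 1) * poch ((2 - a) / 2) (k + 1) /
        (((k + 1).factorial : ℂ) * poch (3 / 2) (k + 1)) =
        (poch ((2 + a) / 2) k * poch ((2 - a) / 2) k / ((k.factorial : ℂ) * poch (3 / 2) k)) *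
        ((((k + 1) ^ 2 - (a : ℝ) ^ 2 / 4) / ((k + 1) * (k + 3 / 2)) : ℝ) : ℂ) := by
      simp only [poch_succ, Nat.factorial_succ, h5]
      push_cast
      rw [add_comm (k : ℂ) (3 / 2), h5]
      field_simp
      ring
    rw [e, norm_mul, Complex.norm_real]
    refine mul_le_of_le_one_right (norm_nonneg _) ?_
    have ha : |(a : ℝ)| ≤ k := by
      rw [← Int.cast_abs, Int.abs_eq_natAbs]; exact_mod_cast hk
    have ha2 : (a : ℝ) ^ 2 ≤ (k : ℝ) ^ 2 := by
      rw [← sq_abs]; gcongr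
    have hk0 : (0 : ℝ) ≤ k := by positivity
    have hpos : 0 ≤ (k + 1) ^ 2 - (a : ℝ) ^ 2 / 4 := by nlinarith
    rw [Real.norm_eq_abs, abs_of_nonneg (by positivity), div_le_one (by positivity)]
    nlinarith [sq_nonneg (a : ℝ)]
  exact bounded_of_le_two_step _ a.natAbs (fun _ => norm_nonneg _)
    fun k hk => (step (k + 1) (by omega)).trans (step k hk)

lemma summable_pFqTerm_three_halves {z : ℂ} (hz : ‖z - 4‖ < 4) (n : Fin 2 → ℤ) :
    Summable (pFqTerm
        [(2 + n 0 + n 1) / 2, (2 - n 0 - n 1) / 2, (2 + n 0 - n 1) / 2, (2 - n 0 + n 1) / 2]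
        [1, 3 / 2, 3 / 2] ((z - 4) ^ 2 / 16)) := by
  obtain ⟨A, hA⟩ := exists_norm_poch_mul_poch_le (n 0 + n 1)
  obtain ⟨B, hB⟩ := exists_norm_poch_mul_poch_le (n 0 - n 1)
  have hA0 : 0 ≤ A := (norm_nonneg _).trans (hA 0)
  set r := ‖(z - 4) ^ 2 / 16‖ with hr
  have hr1 : r < 1 := by
    rw [hr, norm_div, norm_pow, Complex.norm_ofNat, div_lt_one (by norm_num)]
    nlinarith [norm_nonneg (z - 4)]
  refine Summable.of_norm_bounded
    ((summable_geometric_of_lt_one (norm_nonneg _) hr1).mul_left (A * B)) fun k => ?_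
  have e : pFqTerm
        [(2 + n 0 + n 1) / 2, (2 - n 0 - n 1) / 2, (2 + n 0 - n 1) / 2, (2 - n 0 + n 1) / 2]
        [1, 3 / 2, 3 / 2] ((z - 4) ^ 2 / 16) k =
      (poch ((2 + (n 0 + n 1 : ℤ)) / 2) k * poch ((2 - (n 0 + n 1 : ℤ)) / 2) k /
      ((k.factorial : ℂ) * poch (3 / 2) k)) *
      (poch ((2 + (n 0 - n 1 : ℤ)) / 2) k * poch ((2 - (n 0 - n 1 : ℤ)) / 2) k /
      ((k.factorial : ℂ) * poch (3 / 2) k)) * ((z - 4) ^ 2 / 16) ^ k := by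
    simp only [pFqTerm, List.map_cons, List.map_nil, List.prod_cons, List.prod_nil, poch_one]
    push_cast
    rw [show (2 : ℂ) + (n 0 + n 1) = 2 + n 0 + n 1 by ring,
      show (2 : ℂ) - (n 0 + n 1) = 2 - n 0 - n 1 by ring,
      show (2 : ℂ) + (n 0 - n 1) = 2 + n 0 - n 1 by ring,
      show (2 : ℂ) - (n 0 - n 1) = 2 - n 0 + n 1 by ring]
    have h1 : (k.factorial : ℂ) ≠ 0 := by exact_mod_cast k.factorial_ne_zero
    have h2 := poch_three_halves_ne_zero k
    field_simp
  rw [e, norm_mul, norm_mul, norm_pow]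
  gcongr
  · exact hA k
  · exact hB k

lemma summable_and_greenSeries_of_even {z : ℂ} (hz : ‖z - 4‖ < 4) (n : Fin 2 → ℤ)
    (h : Even (n 0 + n 1)) :
    Summable (evenLogTerm z n) ∧
      greenSeries ((z - 4) / 4) (n 0 + n 1) (n 0 - n 1) =
        (-1) ^ max (n 0).natAbs (n 1).natAbs *
            (((|n 0 + n 1| : ℤ) : ℂ) / 2) * (((|n 0 - n 1| : ℤ) : ℂ) / 2) * ((z - 4) / 4) *
            pFq [(2 + n 0 + n 1) / 2, (2 - n 0 - n 1) / 2, (2 + n 0 - n 1) / 2,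
                (2 - n 0 + n 1) / 2]
              [1, 3 / 2, 3 / 2] ((z - 4) ^ 2 / 16) +
          Complex.I * (-1) ^ max (n 0).natAbs (n 1).natAbs / (4 * (Real.pi : ℂ)) *
            ∑' k, evenLogTerm z n k := by
  have hw : ‖(z - 4) / 4‖ < 1 := by
    rw [norm_div, Complex.norm_ofNat, div_lt_one (by norm_num)]; exact hz
  have hs := summable_greenTerm hw (n 0 + n 1) (n 0 - n 1) ⟨n 0, by ring⟩
  have hs0 := hs.comp_injective (mul_right_injective₀ (two_ne_zero (α := ℕ)))
  have hc : (-1 : ℂ) ^ max (n 0).natAbs (n 1).natAbs * (Complex.I / Real.pi) ≠ 0 := by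
    have : (Real.pi : ℂ) ≠ 0 := by exact_mod_cast Real.pi_ne_zero
    simp [this]
  have e0 : greenTerm ((z - 4) / 4) (n 0 + n 1) (n 0 - n 1) ∘ (fun k => 2 * k) =
      fun k => (-1 : ℂ) ^ max (n 0).natAbs (n 1).natAbs * (Complex.I / Real.pi) *
        evenLogTerm z n k := funext fun k => greenTerm_even_even z n h k
  have hlog : Summable (evenLogTerm z n) := by
    rw [e0] at hs0
    exact (summable_mul_left_iff hc).mp hs0
  refine ⟨hlog, ?_⟩
  have hF := summable_pFqTerm_three_halves hz n
  have h0 := hlog.hasSum.mul_left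
    ((-1 : ℂ) ^ max (n 0).natAbs (n 1).natAbs * (Complex.I / Real.pi))
  have h1 := hF.hasSum.mul_left (4 * ((-1) ^ max (n 0).natAbs (n 1).natAbs *
        (((|n 0 + n 1| : ℤ) : ℂ) / 2) * (((|n 0 - n 1| : ℤ) : ℂ) / 2) * ((z - 4) / 4)))
  simp only [← greenTerm_even_even z n h] at h0
  simp only [← greenTerm_even_odd z n h] at h1
  rw [greenSeries, (h0.even_add_odd h1).tsum_eq, pFq]
  ring

lemma summable_and_greenSeries_of_odd {z : ℂ} (hz : ‖z - 4‖ < 4) (hz' : 0 < z.im)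
    (n : Fin 2 → ℤ) (h : Odd (n 0 + n 1)) :
    Summable (pFqTerm
        [(1 + n 0 + n 1) / 2, (1 + n 0 - n 1) / 2, (1 - n 0 + n 1) / 2, (1 - n 0 - n 1) / 2]
        [1, 1 / 2, 1 / 2] ((z - 4) ^ 2 / 16)) ∧
      Summable (oddLogTerm z n) ∧
      greenSeries ((z - 4) / 4) (n 0 + n 1) (n 0 - n 1) =
        (-1) ^ max (n 0).natAbs (n 1).natAbs / 4 *
            pFq [(1 + n 0 + n 1) / 2, (1 + n 0 - n 1) / 2, (1 - n 0 + n 1) / 2,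
                (1 - n 0 - n 1) / 2]
              [1, 1 / 2, 1 / 2] ((z - 4) ^ 2 / 16) +
          Complex.I * (-1) ^ max (n 0).natAbs (n 1).natAbs / (Real.pi : ℂ) *
            (((|n 0 + n 1| : ℤ) : ℂ) / 2) * (((|n 0 - n 1| : ℤ) : ℂ) / 2) * ((z - 4) / 4) *
            ∑' k, oddLogTerm z n k := by
  have hw : ‖(z - 4) / 4‖ < 1 := by
    rw [norm_div, Complex.norm_ofNat, div_lt_one (by norm_num)]; exact hz
  -- For odd |n| all factors of the prefactor are nonzero: a and b are odd, and z ≠ 4 because Im z >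
  -- 0. Summability may therefore be divided out of `greenTerm`.
  have hz4 : z - 4 ≠ 0 := by
    intro h0
    rw [sub_eq_zero.mp h0] at hz'
    simp at hz'
  have h' : Odd (n 0 - n 1) := by
    rw [show n 0 - n 1 = n 0 + n 1 - 2 * n 1 by ring]; exact h.sub_even (even_two_mul _)
  have ha : ((|n 0 + n 1| : ℤ) : ℂ) ≠ 0 := int_cast_ne_zero_of_odd (odd_abs.mpr h)
  have hb : ((|n 0 - n 1| : ℤ) : ℂ) ≠ 0 := int_cast_ne_zero_of_odd (odd_abs.mpr h')
  have hs := summable_greenTerm hw (n 0 + n 1) (n 0 - n 1) ⟨n 0, by ring⟩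
  have hs0 := hs.comp_injective (mul_right_injective₀ (two_ne_zero (α := ℕ)))
  have hs1 := hs.comp_injective (i := fun k : ℕ => 2 * k + 1) (fun i j hij => by
    simp only at hij; omega)
  have hpi : (Real.pi : ℂ) ≠ 0 := by exact_mod_cast Real.pi_ne_zero
  have e0 : greenTerm ((z - 4) / 4) (n 0 + n 1) (n 0 - n 1) ∘ (fun k => 2 * k) = _ :=
    funext fun k => greenTerm_odd_even z n h k
  have e1 : greenTerm ((z - 4) / 4) (n 0 + n 1) (n 0 - n 1) ∘ (fun k => 2 * k + 1) = _ :=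
    funext fun k => greenTerm_odd_odd z n h k
  rw [e0] at hs0
  rw [e1] at hs1
  have hF := (summable_mul_left_iff (by simp)).mp hs0
  have hlog := (summable_mul_left_iff (by
    generalize ((|n 0 + n 1| : ℤ) : ℂ) = x at *
    generalize ((|n 0 - n 1| : ℤ) : ℂ) = y at *
    simp [ha, hb, hpi, hz4])).mp hs1
  refine ⟨hF, hlog, ?_⟩
  have h0 := hF.hasSum.mul_left ((-1 : ℂ) ^ max (n 0).natAbs (n 1).natAbs)
  have h1 := hlog.hasSum.mul_left (4 * ((-1) ^ max (n 0).natAbs (n 1).natAbs *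
    (Complex.I / Real.pi) *
        (((|n 0 + n 1| : ℤ) : ℂ) / 2) * (((|n 0 - n 1| : ℤ) : ℂ) / 2) * ((z - 4) / 4)))
  simp only [← greenTerm_odd_even z n h] at h0
  simp only [← greenTerm_odd_odd z n h] at h1
  rw [greenSeries, (h0.even_add_odd h1).tsum_eq, pFq]
  ring

/-! ### Power series and the Legendre operator -/

/-- Polynomial growth of a coefficient sequence. -/
def PolyGrowth (p : ℕ → ℂ) : Prop := ∃ (C : ℝ) (j : ℕ), ∀ k, ‖p k‖ ≤ C * ((k : ℝ) + 1) ^ j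

/-- The coefficients of the derivative of a power series. -/
def derivCoeff (p : ℕ → ℂ) (k : ℕ) : ℂ := (k + 1) * p (k + 1)

/-- The sum of a power series. -/
noncomputable def powerSum (p : ℕ → ℂ) (t : ℂ) : ℂ := ∑' k, p k * t ^ k

lemma PolyGrowth.derivCoeff {p : ℕ → ℂ} (hp : PolyGrowth p) : PolyGrowth (derivCoeff p) := by
  obtain ⟨C, j, h⟩ := hp
  have hC : 0 ≤ C := by
    have := (norm_nonneg _).trans (h 0)
    simpa using this
  refine ⟨C * 2 ^ j, j + 1, fun k => ?_⟩
  have h1 := h (k + 1)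
  have e : ‖((k : ℂ) + 1)‖ = (k : ℝ) + 1 := by
    have : ((k : ℂ) + 1) = ((k + 1 : ℝ) : ℂ) := by push_cast; ring
    rw [this, Complex.norm_real, Real.norm_of_nonneg (by positivity)]
  rw [_root_.derivCoeff, norm_mul, e, pow_succ]
  have h2 : (((k + 1 : ℕ) : ℝ) + 1) ^ j ≤ (2 * ((k : ℝ) + 1)) ^ j := by
    gcongr; push_cast; linarith [(Nat.cast_nonneg k : (0 : ℝ) ≤ k)]
  calc ((k : ℝ) + 1) * ‖p (k + 1)‖ ≤ ((k : ℝ) + 1) * (C * (2 * ((k : ℝ) + 1)) ^ j) := by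
        gcongr; exact h1.trans (by gcongr)
    _ = _ := by rw [mul_pow]; ring

lemma summable_succ_pow_mul {r : ℝ} (hr0 : 0 ≤ r) (hr : r < 1) (C : ℝ) (j : ℕ) :
    Summable fun k : ℕ => C * ((k : ℝ) + 1) ^ j * r ^ k := by
  rcases hr0.eq_or_lt with rfl | hpos
  · refine summable_of_ne_finset_zero (s := {0}) fun k hk => ?_
    rw [Finset.mem_singleton] at hk
    simp [hk]
  have h := summable_pow_mul_geometric_of_norm_lt_one (R := ℝ) j
    (by rwa [Real.norm_of_nonneg hr0] : ‖r‖ < 1)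
  have h1 := ((summable_nat_add_iff 1).mpr h).mul_left (C * r⁻¹)
  refine h1.congr fun k => ?_
  push_cast
  rw [pow_succ]
  field_simp

lemma PolyGrowth.summable {p : ℕ → ℂ} (hp : PolyGrowth p) {t : ℂ} (ht : ‖t‖ < 1) :
    Summable fun k => p k * t ^ k := by
  obtain ⟨C, j, h⟩ := hp
  refine Summable.of_norm_bounded (summable_succ_pow_mul (norm_nonneg t) ht C j) fun k => ?_
  rw [norm_mul, norm_pow]
  gcongr
  exact h k

lemma PolyGrowth.hasDerivAt {p : ℕ → ℂ} (hp : PolyGrowth p) {t : ℂ} (ht : ‖t‖ < 1) :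
    HasDerivAt (powerSum p) (powerSum (_root_.derivCoeff p) t) t := by
  obtain ⟨C, j, hC⟩ := hp.derivCoeff
  obtain ⟨r, hr1, hr2⟩ := exists_between ht
  have hr0 : 0 ≤ r := (norm_nonneg t).trans hr1.le
  have hball : t ∈ Metric.ball (0 : ℂ) r := by simpa using hr1
  -- The majorant is for the differentiated terms on a disc of radius r between |t| and 1. Its entry
  -- at k = 0 is set to 0, since the derivative of the constant term vanishes whatever truncated k -
  -- 1 is.
  have hsum : Summable fun k : ℕ => if k = 0 then 0 else
      C * (((k - 1 : ℕ) : ℝ) + 1) ^ j * r ^ (k - 1) := by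
    rw [← summable_nat_add_iff 1]
    simpa using summable_succ_pow_mul hr0 hr2 C j
  have key := hasDerivAt_tsum_of_isPreconnected (g := fun k t => p k * t ^ k)
    (g' := fun k t => p k * (k * t ^ (k - 1))) (y₀ := 0) hsum Metric.isOpen_ball
    (convex_ball (0 : ℂ) r).isPreconnected
    (fun k y _ => (hasDerivAt_pow k y).const_mul (p k)) (fun k y hy => by
      rcases k with _ | k
      · simp
      · have hy' : ‖y‖ ≤ r := by simpa using (Metric.mem_ball.mp hy).le
        have h1 := hC k
        simp only [_root_.derivCoeff, Nat.add_sub_cancel, Nat.succ_ne_zero, if_false] at h1 ⊢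
        have e : p (k + 1) * (((k + 1 : ℕ) : ℂ) * y ^ k) = ((k : ℂ) + 1) * p (k + 1) * y ^ k := by
          push_cast; ring
        rw [e, norm_mul, norm_pow]
        gcongr
        exact (norm_nonneg _).trans h1) (by simpa using hr1.trans_le' (norm_nonneg t))
    (hp.summable (by simp)) hball
  have hval : ∑' k, p k * (k * t ^ (k - 1)) = powerSum (_root_.derivCoeff p) t := by
    have hs : Summable fun k => p k * (k * t ^ (k - 1)) := by
      rw [← summable_nat_add_iff 1]
      refine (hp.derivCoeff.summable ht).congr fun k => ?_
      simp only [_root_.derivCoeff, Nat.add_sub_cancel]; push_cast; ring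
    rw [hs.tsum_eq_zero_add, powerSum]
    simp only [Nat.cast_zero, zero_mul, mul_zero, zero_add, Nat.add_sub_cancel]
    refine tsum_congr fun k => ?_
    simp only [_root_.derivCoeff]; push_cast; ring
  rw [hval] at key
  exact key

lemma PolyGrowth.hasSum {p : ℕ → ℂ} (hp : PolyGrowth p) {t : ℂ} (ht : ‖t‖ < 1) :
    HasSum (fun k => p k * t ^ k) (powerSum p t) := (hp.summable ht).hasSum

lemma hasSum_mul_self_of_succ {b : ℕ → ℂ} (hb : b 0 = 0) {t S : ℂ}
    (h : HasSum (fun k => b (k + 1) * t ^ k) S) : HasSum (fun k => b k * t ^ k) (t * S) := by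
  rw [← hasSum_nat_add_iff' 1]
  simp only [Finset.range_one, Finset.sum_singleton, hb, zero_mul, sub_zero]
  refine (h.mul_left t).congr_fun ?_
  intro k
  rw [pow_succ]; ring

lemma powerSum_zero (p : ℕ → ℂ) : powerSum p 0 = p 0 := by
  rw [powerSum, tsum_eq_single 0 (fun k hk => by simp [hk])]
  simp

/-- The action of the differential operator `t (1 + t) ∂² + (1 + 2 t) ∂ + c` on power series. -/
lemma PolyGrowth.hasSum_legendre {p : ℕ → ℂ} (hp : PolyGrowth p) {t : ℂ} (ht : ‖t‖ < 1) (c : ℂ) :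
    HasSum (fun k : ℕ => (((k : ℂ) + 1) ^ 2 * p (k + 1) + ((k : ℂ) * (k + 1) + c) * p k) * t ^ k)
      (t * (1 + t) * powerSum (_root_.derivCoeff (_root_.derivCoeff p)) t
        + (1 + 2 * t) * powerSum (_root_.derivCoeff p) t + c * powerSum p t) := by
  have h0 := hp.hasSum ht
  have h1 := hp.derivCoeff.hasSum ht
  have h2 := hp.derivCoeff.derivCoeff.hasSum ht
  have h1t : HasSum (fun k : ℕ => ((k : ℂ) * p k) * t ^ k) _ :=
    hasSum_mul_self_of_succ (b := fun k => (k : ℂ) * p k) (by simp) (by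
      simpa [_root_.derivCoeff] using h1)
  have h2t : HasSum (fun k : ℕ => ((k : ℂ) * _root_.derivCoeff p k) * t ^ k) _ :=
    hasSum_mul_self_of_succ (b := fun k => (k : ℂ) * _root_.derivCoeff p k) (by simp) (by
      simpa [_root_.derivCoeff] using h2)
  have h2tt : HasSum (fun k : ℕ => ((k : ℂ) * (k - 1) * p k) * t ^ k) _ :=
    hasSum_mul_self_of_succ (b := fun k => (k : ℂ) * (k - 1) * p k) (by simp) (by
      refine h2t.congr_fun ?_
      intro k
      simp only [_root_.derivCoeff]; push_cast; ring)
  -- The five pieces are t∂², t²∂², ∂, 2t∂ and the constant c.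
  have := (((h2t.add h2tt).add h1).add (h1t.mul_left 2)).add (h0.mul_left c)
  convert! this using 1
  · funext k
    simp only [_root_.derivCoeff]
    ring
  · ring

/-! ### The diagonal series as a Frobenius solution of the Legendre equation -/

/-- The coefficients of the regular solution at `0` of the Legendre equation of the diagonal. -/
noncomputable def diagCoeff (m : ℕ) (k : ℕ) : ℂ :=
  (-16) ^ k * (latticeCoeff (2 * k) (2 * m) * latticeCoeff (2 * k) 0)

/-- The coefficients of the power series part of the logarithmic solution. -/
noncomputable def diagLogCoeff (m : ℕ) (k : ℕ) : ℂ :=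
  diagCoeff m k * (digammaSum (2 * k) (2 * m) + digammaSum (2 * k) 0)

lemma diagCoeff_zero (m : ℕ) : diagCoeff m 0 = (-1) ^ m := by
  have e : ((2 : ℤ) * m).natAbs = 2 * m := by omega
  simp [diagCoeff, latticeCoeff, centralCoeff_zero, e, pow_mul]

lemma latticeCoeff_add_two (N : ℕ) (a : ℤ) :
    latticeCoeff (N + 2) a =
      latticeCoeff N a * (((a : ℂ) ^ 2 - (N + 1) ^ 2) / (4 * ((N + 1) * (N + 2)))) := by
  rw [latticeCoeff, latticeCoeff, centralCoeff_add_two]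
  rcases natCast_natAbs_eq_or a with h | h <;> rw [h] <;> ring

lemma diagCoeff_succ (m k : ℕ) :
    ((k : ℂ) + 1) ^ 2 * diagCoeff m (k + 1) + ((k : ℂ) * (k + 1) + (1 / 4 - (m : ℂ) ^ 2)) *
      diagCoeff m k = 0 := by
  have h1 : (2 * k : ℂ) + 1 ≠ 0 := by exact_mod_cast (2 * k).succ_ne_zero
  have h2 : (k : ℂ) + 1 ≠ 0 := by exact_mod_cast k.succ_ne_zero
  have h3 : (2 * k : ℂ) + 2 = 2 * (k + 1) := by ring
  simp only [diagCoeff]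
  rw [show 2 * (k + 1) = 2 * k + 2 by ring, latticeCoeff_add_two, latticeCoeff_add_two]
  have e : (((2 * m : ℤ) : ℂ) ^ 2 - ((2 * k : ℕ) + 1) ^ 2) / (4 * (((2 * k : ℕ) + 1) *
      ((2 * k : ℕ) + 2))) * ((((0 : ℤ) : ℂ) ^ 2 - ((2 * k : ℕ) + 1) ^ 2) /
      (4 * (((2 * k : ℕ) + 1) * ((2 * k : ℕ) + 2)))) =
      -(4 * (m : ℂ) ^ 2 - (2 * k + 1) ^ 2) / (64 * (k + 1) ^ 2) := by
    push_cast
    rw [h3, div_mul_div_comm, div_eq_div_iff (by simp [h1, h2]) (by simp [h2])]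
    ring
  rw [mul_mul_mul_comm, e, pow_succ (-16)]
  field_simp
  ring

/-- This is the Frobenius recursion for the part without logarithm. The right side consists of the
coefficients of 2(1+t)P' + P, which is what the Legendre operator leaves from P log t besides log t
times the equation of P. -/
lemma diagLogCoeff_succ (m k : ℕ) :
    ((k : ℂ) + 1) ^ 2 * diagLogCoeff m (k + 1) + ((k : ℂ) * (k + 1) + (1 / 4 - (m : ℂ) ^ 2)) *
      diagLogCoeff m k = 2 * (k + 1) * diagCoeff m (k + 1) + (2 * k + 1) * diagCoeff m k := by
  have h1 : (2 * k : ℂ) + 1 ≠ 0 := by exact_mod_cast (2 * k).succ_ne_zero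
  have h2 : (k : ℂ) + 1 ≠ 0 := by exact_mod_cast k.succ_ne_zero
  have h3 : (2 * k : ℂ) + 2 = 2 * (k + 1) := by ring
  have h4 : (2 * k : ℂ) + 1 - 2 * m ≠ 0 := by
    have := int_cast_ne_zero_of_odd (k := 2 * k + 1 - 2 * m) ⟨k - m, by ring⟩
    push_cast at this; exact this
  have h5 : (2 * k : ℂ) + 1 + 2 * m ≠ 0 := by
    have := int_cast_ne_zero_of_odd (k := 2 * k + 1 + 2 * m) ⟨k + m, by ring⟩
    push_cast at this; exact this
  have hp : ((k : ℂ) + 1) ^ 2 * diagCoeff m (k + 1)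
      = ((m : ℂ) ^ 2 - (2 * k + 1) ^ 2 / 4) * diagCoeff m k := by
    linear_combination diagCoeff_succ m k
  have d1 := digammaSum_add_two (2 * k) (2 * m) (by
    push_cast; exact (even_two_mul _).add (even_two_mul _))
  have d2 := digammaSum_add_two (2 * k) 0 (by push_cast; exact (even_two_mul _).add Even.zero)
  push_cast at d1 d2
  simp only [diagLogCoeff]
  rw [show 2 * (k + 1) = 2 * k + 2 by ring, d1, d2]
  have hu : 2 / ((2 * k : ℂ) + 1 - 2 * m) * (2 * k + 1 - 2 * m) = 2 := div_mul_cancel₀ _ h4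
  have hv : 2 / ((2 * k : ℂ) + 1 + 2 * m) * (2 * k + 1 + 2 * m) = 2 := div_mul_cancel₀ _ h5
  have hs : 2 / ((2 * k : ℂ) + 2) * (k + 1) = 1 := by rw [h3]; field_simp
  rw [sub_zero, add_zero]
  generalize 2 / ((2 * k : ℂ) + 1 - 2 * m) = u at *
  generalize 2 / ((2 * k : ℂ) + 1 + 2 * m) = v at *
  generalize 2 / ((2 * k : ℂ) + 2) = s at *
  -- Here u, v and s stand for the increments 2/(2k+1-2m), 2/(2k+1+2m) and 2/(2k+2); u and v are
  -- cleared by the factors of (2k+1)² - 4m², s by k + 1.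
  linear_combination hp * (digammaSum (2 * k) (2 * m) + digammaSum (2 * k) 0 - u - v)
    + 2 * (k + 1) * diagCoeff m (k + 1) * hs
    + diagCoeff m k * ((2 * k + 1 + 2 * m) / 4 * hu + (2 * k + 1 - 2 * m) / 4 * hv)

lemma polyGrowth_diagCoeff (m : ℕ) : PolyGrowth (diagCoeff m) := by
  obtain ⟨A, hA⟩ := exists_norm_latticeCoeff_le (2 * m)
  obtain ⟨B, hB⟩ := exists_norm_latticeCoeff_le 0
  have hA0 : 0 ≤ A := le_trans (by positivity) (hA 0)
  refine ⟨A * B, 0, fun k => ?_⟩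
  have e : ‖diagCoeff m k‖ = (‖latticeCoeff (2 * k) (2 * m)‖ * 2 ^ (2 * k)) *
      (‖latticeCoeff (2 * k) 0‖ * 2 ^ (2 * k)) := by
    rw [diagCoeff, norm_mul, norm_pow, norm_mul, norm_neg, Complex.norm_ofNat, pow_mul,
      show (16 : ℝ) = 2 ^ 2 * 2 ^ 2 by norm_num, mul_pow]
    ring
  rw [e, pow_zero, mul_one]
  gcongr
  · exact hA _
  · exact hB _

lemma polyGrowth_diagLogCoeff (m : ℕ) : PolyGrowth (diagLogCoeff m) := by
  obtain ⟨A, j, hA⟩ := polyGrowth_diagCoeff m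
  obtain ⟨C, hC0, hC⟩ := exists_norm_digammaSum_le (2 * m)
  obtain ⟨D, hD0, hD⟩ := exists_norm_digammaSum_le 0
  have hA0 : 0 ≤ A := by simpa using (norm_nonneg _).trans (hA 0)
  -- The two digamma sums at N = 2k each contribute at most 4 · 2k, which accounts for 16.
  refine ⟨A * (C + D + 16), j + 1, fun k => ?_⟩
  have h1 := hC (2 * k) (by push_cast; exact (even_two_mul _).add (even_two_mul _))
  have h2 := hD (2 * k) (by push_cast; exact (even_two_mul _).add Even.zero)
  push_cast at h1 h2
  have h3 := norm_add_le (digammaSum (2 * k) (2 * m)) (digammaSum (2 * k) 0)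
  have hk : (0 : ℝ) ≤ k := by positivity
  have h4 : ‖digammaSum (2 * k) (2 * m) + digammaSum (2 * k) 0‖ ≤
      (C + D + 16) * ((k : ℝ) + 1) := by
    nlinarith
  rw [diagLogCoeff, norm_mul, pow_succ]
  refine (mul_le_mul (hA k) h4 (norm_nonneg _) (by positivity)).trans (le_of_eq ?_)
  ring

lemma digammaSum_zero_zero : digammaSum 0 0 = 2 * Real.log 2 := by
  simp only [digammaSum, Nat.cast_zero, zero_div, add_zero, sub_zero, Complex.digamma_one,
    Complex.digamma_one_half]
  rw [show Complex.log 2 = ((Real.log 2 : ℝ) : ℂ) by rw [Complex.ofReal_log (by norm_num)]; simp]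
  ring

/-- One argument moves up by 1 and its mirror image moves down by 1; both shifts contribute
-2/(2m+1). This step is compared with the one in `integral_cosQuotient`. -/
lemma digammaSum_zero_succ (m : ℕ) :
    digammaSum 0 (2 * (m + 1 : ℕ)) = digammaSum 0 (2 * m) - 4 / (2 * m + 1) := by
  have h1 : (2 * m : ℂ) + 1 ≠ 0 := by exact_mod_cast (2 * m).succ_ne_zero
  have o1 := Complex.digamma_apply_add_one (((2 * m + 1 : ℤ) : ℂ) / 2)
    (half_int_ne_neg_nat ⟨m, rfl⟩)
  have o2 := Complex.digamma_apply_add_one (((-(2 * m) - 1 : ℤ) : ℂ) / 2)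
    (half_int_ne_neg_nat ⟨-m - 1, by ring⟩)
  push_cast at o1 o2
  simp only [digammaSum]
  push_cast
  rw [show ((1 : ℂ) + 2 * (m + 1) + 0) / 2 = (2 * m + 1) / 2 + 1 by ring,
    show ((1 : ℂ) - 2 * (m + 1) + 0) / 2 = (-(2 * m) - 1) / 2 by ring,
    show ((1 : ℂ) + 2 * m + 0) / 2 = (2 * m + 1) / 2 by ring,
    show ((1 : ℂ) - 2 * m + 0) / 2 = (-(2 * m) - 1) / 2 + 1 by ring, o1, o2,
    show (-(2 * m) - 1 : ℂ) = -(2 * m + 1) by ring]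
  field_simp
  ring

/-- The series of the diagonal Green function as a function of `t = -w²`. -/
noncomputable def diagSeries (m : ℕ) (t : ℝ) : ℂ :=
  -powerSum (diagCoeff m) t * Real.log t + powerSum (diagLogCoeff m) t

/-- The derivative of the series of the diagonal Green function. -/
noncomputable def diagSeriesDeriv (m : ℕ) (t : ℝ) : ℂ :=
  -powerSum (derivCoeff (diagCoeff m)) t * Real.log t - powerSum (diagCoeff m) t / t
    + powerSum (derivCoeff (diagLogCoeff m)) t

/-- The second derivative of the series of the diagonal Green function. -/
noncomputable def diagSeriesDerivTwo (m : ℕ) (t : ℝ) : ℂ :=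
  -powerSum (derivCoeff (derivCoeff (diagCoeff m))) t * Real.log t
    - 2 * powerSum (derivCoeff (diagCoeff m)) t / t + powerSum (diagCoeff m) t / t ^ 2
    + powerSum (derivCoeff (derivCoeff (diagLogCoeff m))) t

lemma PolyGrowth.hasDerivAt_real {p : ℕ → ℂ} (hp : PolyGrowth p) {t : ℝ} (ht : |t| < 1) :
    HasDerivAt (fun t : ℝ => powerSum p t) (powerSum (_root_.derivCoeff p) t) t :=
  (hp.hasDerivAt (t := t) (by simpa using ht)).comp_ofReal

lemma hasDerivAt_diagSeries (m : ℕ) {t : ℝ} (h0 : 0 < t) (h1 : t < 1) :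
    HasDerivAt (diagSeries m) (diagSeriesDeriv m t) t := by
  have ht : |t| < 1 := by rwa [abs_of_pos h0]
  have hl : HasDerivAt (fun t : ℝ => (Real.log t : ℂ)) ((t⁻¹ : ℝ) : ℂ) t :=
    (Real.hasDerivAt_log h0.ne').ofReal_comp
  have := (((polyGrowth_diagCoeff m).hasDerivAt_real ht).neg.mul hl).add
    ((polyGrowth_diagLogCoeff m).hasDerivAt_real ht)
  refine this.congr_deriv ?_
  simp only [diagSeriesDeriv, Pi.neg_apply]
  push_cast
  ring

lemma hasDerivAt_diagSeriesDeriv (m : ℕ) {t : ℝ} (h0 : 0 < t) (h1 : t < 1) :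
    HasDerivAt (diagSeriesDeriv m) (diagSeriesDerivTwo m t) t := by
  have ht : |t| < 1 := by rwa [abs_of_pos h0]
  have htc : (t : ℂ) ≠ 0 := by exact_mod_cast h0.ne'
  have hl : HasDerivAt (fun t : ℝ => (Real.log t : ℂ)) ((t⁻¹ : ℝ) : ℂ) t :=
    (Real.hasDerivAt_log h0.ne').ofReal_comp
  have hid : HasDerivAt (fun t : ℝ => (t : ℂ)) ((1 : ℝ) : ℂ) t := (hasDerivAt_id t).ofReal_comp
  have := (((polyGrowth_diagCoeff m).derivCoeff.hasDerivAt_real ht).neg.mul hl).sub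
    (((polyGrowth_diagCoeff m).hasDerivAt_real ht).div hid htc) |>.add
    ((polyGrowth_diagLogCoeff m).derivCoeff.hasDerivAt_real ht)
  refine this.congr_deriv ?_
  simp only [diagSeriesDerivTwo, Pi.neg_apply]
  push_cast
  field_simp
  ring

lemma powerSum_diagCoeff_ode (m : ℕ) {t : ℂ} (ht : ‖t‖ < 1) :
    t * (1 + t) * powerSum (derivCoeff (derivCoeff (diagCoeff m))) t
        + (1 + 2 * t) * powerSum (derivCoeff (diagCoeff m)) t
        + (1 / 4 - (m : ℂ) ^ 2) * powerSum (diagCoeff m) t = 0 := by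
  have h := (polyGrowth_diagCoeff m).hasSum_legendre ht (1 / 4 - (m : ℂ) ^ 2)
  simp only [diagCoeff_succ, zero_mul] at h
  exact h.unique hasSum_zero

lemma powerSum_diagLogCoeff_ode (m : ℕ) {t : ℂ} (ht : ‖t‖ < 1) :
    t * (1 + t) * powerSum (derivCoeff (derivCoeff (diagLogCoeff m))) t
        + (1 + 2 * t) * powerSum (derivCoeff (diagLogCoeff m)) t
        + (1 / 4 - (m : ℂ) ^ 2) * powerSum (diagLogCoeff m) t
      = 2 * (1 + t) * powerSum (derivCoeff (diagCoeff m)) t + powerSum (diagCoeff m) t := by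
  have h := (polyGrowth_diagLogCoeff m).hasSum_legendre ht (1 / 4 - (m : ℂ) ^ 2)
  simp only [diagLogCoeff_succ] at h
  have hp := polyGrowth_diagCoeff m
  have h0 := hp.hasSum ht
  have h1 := hp.derivCoeff.hasSum ht
  have h1t : HasSum (fun k : ℕ => ((k : ℂ) * diagCoeff m k) * t ^ k) _ :=
    hasSum_mul_self_of_succ (b := fun k => (k : ℂ) * diagCoeff m k) (by simp) (by
      simpa [derivCoeff] using h1)
  refine h.unique ?_
  convert! ((h1.mul_left 2).add (h1t.mul_left 2)).add h0 using 1
  · funext k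
    simp only [derivCoeff]
    ring
  · ring

lemma diagSeries_ode (m : ℕ) {t : ℝ} (h0 : 0 < t) (h1 : t < 1) :
    t * (1 + t) * diagSeriesDerivTwo m t + (1 + 2 * t) * diagSeriesDeriv m t
      + (1 / 4 - (m : ℂ) ^ 2) * diagSeries m t = 0 := by
  have ht : ‖(t : ℂ)‖ < 1 := by simpa [abs_of_pos h0] using h1
  have htc : (t : ℂ) ≠ 0 := by exact_mod_cast h0.ne'
  have e1 := powerSum_diagCoeff_ode m ht
  have e2 := powerSum_diagLogCoeff_ode m ht
  simp only [diagSeriesDerivTwo, diagSeriesDeriv, diagSeries]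
  have e3 : (t : ℂ) * (1 + t) * (-powerSum (derivCoeff (derivCoeff (diagCoeff m))) t * Real.log t
    - 2 * powerSum (derivCoeff (diagCoeff m)) t / t + powerSum (diagCoeff m) t / t ^ 2
    + powerSum (derivCoeff (derivCoeff (diagLogCoeff m))) t) =
      (t : ℂ) * (1 + t) * (-powerSum (derivCoeff (derivCoeff (diagCoeff m))) t * Real.log t)
    - 2 * (1 + t) * powerSum (derivCoeff (diagCoeff m)) t
    + (1 + t) * powerSum (diagCoeff m) t / t
    + t * (1 + t) * powerSum (derivCoeff (derivCoeff (diagLogCoeff m))) t := by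
    field_simp
  rw [e3]
  have e4 : ((1 : ℂ) + t) * powerSum (diagCoeff m) t / t =
    powerSum (diagCoeff m) t / t + powerSum (diagCoeff m) t := by field_simp
  have e5 : powerSum (diagCoeff m) t / t * t = powerSum (diagCoeff m) t := by field_simp
  rw [e4]
  linear_combination -(Real.log t : ℂ) * e1 + e2 - 2 * e5

/-- On the diagonal b = 0, and c_N(0) = 0 for odd N, so only powers of w² survive and (4w)^(2k) =
(-16)^k t^k with t = -w². -/
lemma greenSeries_diag (m : ℕ) {w : ℂ} (hw : ‖w‖ < 1) :
    greenSeries w (2 * m) 0 = Complex.I / (4 * Real.pi) *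
      (-powerSum (diagCoeff m) (-w ^ 2) * Complex.log (-w ^ 2)
        + powerSum (diagLogCoeff m) (-w ^ 2)) := by
  have ht : ‖-w ^ 2‖ < 1 := by
    rw [norm_neg, norm_pow]; nlinarith [norm_nonneg w]
  have hP := (polyGrowth_diagCoeff m).hasSum ht
  have hQ := (polyGrowth_diagLogCoeff m).hasSum ht
  have h0 := ((hP.mul_right (-Complex.log (-w ^ 2))).add hQ).mul_left (Complex.I / Real.pi)
  have h1 : HasSum (fun k => greenTerm w (2 * m) 0 (2 * k + 1)) 0 := by
    have e : (fun k => greenTerm w (2 * m) 0 (2 * k + 1)) = fun _ => 0 := by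
      funext k
      have : latticeCoeff (2 * k + 1) 0 = 0 := by
        rw [latticeCoeff_odd]; simp
      simp [greenTerm, this]
    rw [e]; exact hasSum_zero
  have h2 : HasSum (fun k => greenTerm w (2 * m) 0 (2 * k)) (Complex.I / Real.pi *
      (powerSum (diagCoeff m) (-w ^ 2) * -Complex.log (-w ^ 2)
        + powerSum (diagLogCoeff m) (-w ^ 2))) := by
    refine h0.congr_fun fun k => ?_
    have hp : Even (((2 * k : ℕ) : ℤ) + 2 * m) := by
      push_cast; exact (even_two_mul _).add (even_two_mul _)
    simp only [greenTerm, if_pos hp, diagLogCoeff, diagCoeff]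
    have e : (4 * w) ^ (2 * k) = (-16) ^ k * (-w ^ 2) ^ k := by
      rw [pow_mul, ← mul_pow]; congr 1; ring
    rw [e]
    push_cast
    ring
  rw [greenSeries, (h2.even_add_odd h1).tsum_eq]
  ring

/-! ### The diagonal integral and its Legendre equation -/

/-- `∫ g(α) (t + sin² α)^(-n/2) dα` over a quarter period. -/
noncomputable def sinKernel (n : ℕ) (g : ℝ → ℝ) (t : ℝ) : ℝ :=
  ∫ α in (0 : ℝ)..(Real.pi / 2), g α * (√(t + Real.sin α ^ 2))⁻¹ ^ n

lemma hasDerivAt_inv_sqrt {u : ℝ → ℝ} {u' x : ℝ} (hu : HasDerivAt u u' x) (h : 0 < u x) :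
    HasDerivAt (fun x => (√(u x))⁻¹) (-(1 / 2) * u' * (√(u x))⁻¹ ^ 3) x := by
  have hs : √(u x) ≠ 0 := (Real.sqrt_pos.mpr h).ne'
  refine ((hu.sqrt h.ne').inv hs).congr_deriv ?_
  field_simp

lemma add_sin_sq_pos {t : ℝ} (ht : 0 < t) (α : ℝ) : 0 < t + Real.sin α ^ 2 := by positivity

lemma continuous_inv_sqrt_pow {t : ℝ} (ht : 0 < t) (n : ℕ) :
    Continuous fun α : ℝ => (√(t + Real.sin α ^ 2))⁻¹ ^ n := by
  have h : ∀ α : ℝ, √(t + Real.sin α ^ 2) ≠ 0 := fun α =>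
    (Real.sqrt_pos.mpr (add_sin_sq_pos ht α)).ne'
  exact ((by fun_prop : Continuous fun α : ℝ => √(t + Real.sin α ^ 2)).inv₀ h).pow n

lemma continuousOn_sinKernel_integrand {g : ℝ → ℝ} (hg : ContinuousOn g (Set.uIcc 0 (Real.pi / 2)))
    {t : ℝ} (ht : 0 < t) (n : ℕ) :
    ContinuousOn (fun α : ℝ => g α * (√(t + Real.sin α ^ 2))⁻¹ ^ n) (Set.uIcc 0 (Real.pi / 2)) :=
  hg.mul (continuous_inv_sqrt_pow ht n).continuousOn

lemma hasDerivAt_sinKernel {g : ℝ → ℝ} (hg : ContinuousOn g (Set.uIcc 0 (Real.pi / 2)))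
    {t : ℝ} (ht : 0 < t) (n : ℕ) :
    HasDerivAt (sinKernel n g) (-(n / 2) * sinKernel (n + 2) g t) t := by
  have hmeas : ∀ t > 0, ∀ n, AEStronglyMeasurable
      (fun α : ℝ => g α * (√(t + Real.sin α ^ 2))⁻¹ ^ n)
      (volume.restrict (Set.uIoc 0 (Real.pi / 2))) := fun t ht n =>
    ((continuousOn_sinKernel_integrand hg ht n).intervalIntegrable
      (μ := volume)).aestronglyMeasurable_restrict_uIoc
  have key := hasDerivAt_integral_of_dominated_loc_of_deriv_le (μ := volume)
    (F := fun (t : ℝ) α => g α * (√(t + Real.sin α ^ 2))⁻¹ ^ n)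
    (F' := fun (t : ℝ) α => -(n / 2) * (g α * (√(t + Real.sin α ^ 2))⁻¹ ^ (n + 2)))
    -- Staying above t/2 keeps x + sin² α ≥ t/2, so one bound serves all x.
    (x₀ := t) (s := Set.Ioi (t / 2)) (a := 0) (b := Real.pi / 2)
    (bound := fun α => (n / 2) * (|g α| * (√(t / 2))⁻¹ ^ (n + 2)))
    (Ioi_mem_nhds (by linarith))
    (by filter_upwards [Ioi_mem_nhds ht] with x hx using hmeas x hx n)
    (continuousOn_sinKernel_integrand hg ht n).intervalIntegrable
    ((hmeas t ht (n + 2)).const_mul _)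
    (by
      refine Eventually.of_forall fun α _ x hx => ?_
      have hx' : t / 2 < x := hx
      have h2 : 0 < √(t / 2) := Real.sqrt_pos.mpr (by linarith)
      rw [norm_mul, norm_mul, norm_neg, Real.norm_of_nonneg (by positivity), Real.norm_eq_abs,
        Real.norm_of_nonneg (by positivity)]
      gcongr
      nlinarith [sq_nonneg (Real.sin α)])
    (ContinuousOn.intervalIntegrable (by fun_prop))
    (by
      refine Eventually.of_forall fun α _ x hx => ?_
      have hx' : 0 < x := (by linarith : 0 < t / 2).trans hx
      have h1 := hasDerivAt_inv_sqrt ((hasDerivAt_id x).add_const (Real.sin α ^ 2))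
        (add_sin_sq_pos hx' α)
      refine ((h1.pow n).const_mul (g α)).congr_deriv ?_
      rcases n with _ | n
      · simp
      · simp only [id, Nat.add_sub_cancel]
        push_cast
        ring)
  refine key.2.congr_deriv ?_
  simp only [sinKernel, intervalIntegral.integral_const_mul]

/-- For s = (t + sin² α)^(-1/2) the Legendre operator in t with constant 1/4 acts as -(1/4) ∂²/∂α².
Two integrations by parts move ∂² to cos(2mα), giving the factor m². -/
lemma sinKernel_cos_ode (m : ℕ) {t : ℝ} (ht : 0 < t) :
    t * (1 + t) * (3 / 4 * sinKernel 5 (fun α => Real.cos (2 * m * α)) t)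
      + (1 + 2 * t) * (-(1 / 2) * sinKernel 3 (fun α => Real.cos (2 * m * α)) t)
      + (1 / 4 - (m : ℝ) ^ 2) * sinKernel 1 (fun α => Real.cos (2 * m * α)) t = 0 := by
  have hc : ContinuousOn (fun α : ℝ => Real.cos (2 * m * α)) (Set.uIcc 0 (Real.pi / 2)) := by
    fun_prop
  have i1 := (continuousOn_sinKernel_integrand hc ht 1).intervalIntegrable (μ := volume)
  have i3 := (continuousOn_sinKernel_integrand hc ht 3).intervalIntegrable (μ := volume)
  have i5 := (continuousOn_sinKernel_integrand hc ht 5).intervalIntegrable (μ := volume)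
  have e : t * (1 + t) * (3 / 4 * sinKernel 5 (fun α => Real.cos (2 * m * α)) t)
      + (1 + 2 * t) * (-(1 / 2) * sinKernel 3 (fun α => Real.cos (2 * m * α)) t)
      + (1 / 4 - (m : ℝ) ^ 2) * sinKernel 1 (fun α => Real.cos (2 * m * α)) t
      = ∫ α in (0 : ℝ)..(Real.pi / 2),
        ((t * (1 + t) * (3 / 4)) * (Real.cos (2 * m * α) * (√(t + Real.sin α ^ 2))⁻¹ ^ 5)
        + ((1 + 2 * t) * (-(1 / 2))) * (Real.cos (2 * m * α) * (√(t + Real.sin α ^ 2))⁻¹ ^ 3)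
        + (1 / 4 - (m : ℝ) ^ 2) * (Real.cos (2 * m * α) * (√(t + Real.sin α ^ 2))⁻¹ ^ 1)) := by
    rw [intervalIntegral.integral_add ((i5.const_mul _).add (i3.const_mul _)) (i1.const_mul _),
      intervalIntegral.integral_add (i5.const_mul _) (i3.const_mul _),
      intervalIntegral.integral_const_mul, intervalIntegral.integral_const_mul,
      intervalIntegral.integral_const_mul]
    simp only [sinKernel]
    ring
  -- The primitive is -(1/4)(c s' - c' s) with c = cos(2mα) and primes in α; sin α cos α and
  -- sin(2mα) vanish at both endpoints.
  rw [e, integral_eq_sub_of_hasDerivAt (f := fun α => -(1 / 4) *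
    (Real.cos (2 * m * α) * (-(Real.sin α * Real.cos α) * (√(t + Real.sin α ^ 2))⁻¹ ^ 3)
      + 2 * m * Real.sin (2 * m * α) * (√(t + Real.sin α ^ 2))⁻¹))]
  · have h1 : Real.sin (2 * m * (Real.pi / 2)) = 0 := by
      rw [show 2 * (m : ℝ) * (Real.pi / 2) = m * Real.pi by ring, Real.sin_nat_mul_pi]
    simp [h1]
  · intro α _
    have hpos := add_sin_sq_pos ht α
    have hs : HasDerivAt (fun α => (√(t + Real.sin α ^ 2))⁻¹) _ α := hasDerivAt_inv_sqrt
      ((((Real.hasDerivAt_sin α).pow 2).const_add t)) hpos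
    have hlin : HasDerivAt (fun α : ℝ => 2 * (m : ℝ) * α) (2 * m) α := by
      simpa using (hasDerivAt_id α).const_mul (2 * (m : ℝ))
    have h := ((hlin.cos.mul ((((Real.hasDerivAt_sin α).mul (Real.hasDerivAt_cos α)).neg).mul
      (hs.pow 3))).add ((hlin.sin.const_mul (2 * (m : ℝ))).mul hs)).const_mul (-(1 / 4 : ℝ))
    refine h.congr_deriv ?_
    have hS : (√(t + Real.sin α ^ 2))⁻¹ ^ 2 * (t + Real.sin α ^ 2) = 1 := by
      rw [inv_pow, Real.sq_sqrt hpos.le, inv_mul_cancel₀ hpos.ne']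
    have hcs := Real.sin_sq_add_cos_sq α
    simp only [Pi.mul_apply, Pi.neg_apply, Pi.pow_apply]
    generalize (√(t + Real.sin α ^ 2))⁻¹ = s at *
    generalize Real.cos (2 * m * α) = c at *
    generalize Real.sin (2 * m * α) = d at *
    generalize Real.sin α = x at *
    generalize Real.cos α = y at *
    have hy : y ^ 2 = 1 - x ^ 2 := by linear_combination hcs
    -- All powers of s are brought to s^5 through s²(t + x²) = 1, after which the identity is
    -- polynomial.
    have e3 : s ^ 3 = s ^ 5 * (t + x ^ 2) := by linear_combination -s ^ 3 * hS
    have e1 : s = s ^ 5 * (t + x ^ 2) ^ 2 := by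
      linear_combination (-s - s ^ 3 * (t + x ^ 2)) * hS
    push_cast
    linear_combination (-c * (-(1 / 2) * (1 + 2 * t) - (y ^ 2 - x ^ 2) / 4)) * e3 - c / 4 * e1
      - c * s ^ 5 * (-(1 / 4) * (t + x ^ 2) + 3 / 4 * x ^ 2) * hy
  · refine ContinuousOn.intervalIntegrable ?_
    have := continuousOn_sinKernel_integrand hc ht 1
    have := continuousOn_sinKernel_integrand hc ht 3
    have := continuousOn_sinKernel_integrand hc ht 5
    fun_prop

lemma hasDerivAt_sinKernel_one_cos (m : ℕ) {t : ℝ} (ht : 0 < t) :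
    HasDerivAt (sinKernel 1 fun α => Real.cos (2 * m * α))
      (-(1 / 2) * sinKernel 3 (fun α => Real.cos (2 * m * α)) t) t := by
  have := hasDerivAt_sinKernel (g := fun α => Real.cos (2 * m * α)) (by fun_prop) ht 1
  simpa using this

lemma hasDerivAt_sinKernel_three_cos (m : ℕ) {t : ℝ} (ht : 0 < t) :
    HasDerivAt (fun t => -(1 / 2) * sinKernel 3 (fun α => Real.cos (2 * m * α)) t)
      (3 / 4 * sinKernel 5 (fun α => Real.cos (2 * m * α)) t) t := by
  have := (hasDerivAt_sinKernel (g := fun α => Real.cos (2 * m * α)) (by fun_prop) ht 3).const_mul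
    (-(1 / 2 : ℝ))
  refine this.congr_deriv ?_
  push_cast; ring

/-! ### Behaviour of the integral as t → 0⁺ -/

/-- The quotient `(cos (2 m α) - cos α) / sin α`. -/
noncomputable def cosQuotient : ℕ → ℝ → ℝ
  | 0, α => Real.sin α / (1 + Real.cos α)
  | m + 1, α => cosQuotient m α - 2 * Real.sin ((2 * m + 1) * α)

lemma one_add_cos_pos {α : ℝ} (h : α ∈ Set.uIcc 0 (Real.pi / 2)) : 0 < 1 + Real.cos α := by
  rw [Set.uIcc_of_le (by positivity)] at h
  have := Real.cos_nonneg_of_mem_Icc ⟨by linarith [h.1, Real.pi_pos], h.2⟩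
  linarith

lemma continuousOn_cosQuotient (m : ℕ) :
    ContinuousOn (cosQuotient m) (Set.uIcc 0 (Real.pi / 2)) := by
  induction m with
  | zero =>
    exact Real.continuous_sin.continuousOn.div (by fun_prop) fun α hα => (one_add_cos_pos hα).ne'
  | succ m ih =>
    exact ih.sub (by fun_prop)

/-- The recursion telescopes cos(2(m+1)α) - cos(2mα) = -2 sin((2m+1)α) sin α. Splitting off cos α
isolates an elementary singular integral; the factor sin α in the rest cancels the singularity at α
= 0. -/
lemma cos_eq_cos_add_cosQuotient (m : ℕ) {α : ℝ} (h : α ∈ Set.uIcc 0 (Real.pi / 2)) :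
    Real.cos (2 * m * α) = Real.cos α + cosQuotient m α * Real.sin α := by
  induction m with
  | zero =>
    have h1 := (one_add_cos_pos h).ne'
    simp only [cosQuotient, Nat.cast_zero, mul_zero, zero_mul, Real.cos_zero]
    field_simp
    linear_combination -Real.sin_sq_add_cos_sq α
  | succ m ih =>
    have e1 : Real.cos (2 * (m + 1 : ℕ) * α) = Real.cos ((2 * m + 1) * α + α) := by
      congr 1; push_cast; ring
    have e2 : Real.cos (2 * m * α) = Real.cos ((2 * m + 1) * α - α) := by
      congr 1; ring
    rw [e2, Real.cos_sub] at ih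
    rw [e1, Real.cos_add]
    simp only [cosQuotient]
    linear_combination ih

/-- Both sides start at 2 log 2 and drop by 4/(2m+1) at each step. This matches the constant term of
the integral with the digamma values of the series. -/
lemma integral_cosQuotient (m : ℕ) :
    ((2 * ∫ α in (0 : ℝ)..(Real.pi / 2), cosQuotient m α : ℝ) : ℂ) = digammaSum 0 (2 * m) := by
  induction m with
  | zero =>
    have : ∫ α in (0 : ℝ)..(Real.pi / 2), cosQuotient 0 α = Real.log 2 := by
      rw [integral_eq_sub_of_hasDerivAt (f := fun α => -Real.log (1 + Real.cos α))]
      · simp; norm_num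
      · intro α hα
        refine (((Real.hasDerivAt_cos α).const_add 1).log (one_add_cos_pos hα).ne').neg.congr_deriv
          ?_
        simp [cosQuotient, neg_div]
      · exact (continuousOn_cosQuotient 0).intervalIntegrable
    rw [this]
    simp only [Nat.cast_zero, mul_zero, digammaSum_zero_zero]
    push_cast; rfl
  | succ m ih =>
    have h1 : (2 * m : ℝ) + 1 ≠ 0 := by positivity
    have : ∫ α in (0 : ℝ)..(Real.pi / 2), cosQuotient (m + 1) α =
        (∫ α in (0 : ℝ)..(Real.pi / 2), cosQuotient m α) - 2 / (2 * m + 1) := by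
      simp only [cosQuotient]
      rw [intervalIntegral.integral_sub (continuousOn_cosQuotient m).intervalIntegrable
        (by apply Continuous.intervalIntegrable; fun_prop), intervalIntegral.integral_const_mul]
      congr 1
      rw [integral_eq_sub_of_hasDerivAt
        (f := fun α => -Real.cos ((2 * m + 1) * α) / (2 * m + 1))]
      · have : Real.cos ((2 * m + 1) * (Real.pi / 2)) = 0 := by
          rw [Real.cos_eq_zero_iff]; exact ⟨m, by push_cast; ring⟩
        simp [this]; ring
      · intro α _
        have hlin : HasDerivAt (fun α : ℝ => (2 * (m : ℝ) + 1) * α) (2 * m + 1) α := by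
          simpa using (hasDerivAt_id α).const_mul (2 * (m : ℝ) + 1)
        refine (hlin.cos.neg.div_const _).congr_deriv ?_
        field_simp
      · apply Continuous.intervalIntegrable; fun_prop
    rw [this, digammaSum_zero_succ, ← ih]
    push_cast
    ring

lemma sin_pos_of_mem_quarter {α : ℝ} (h : α ∈ Set.uIoc 0 (Real.pi / 2)) : 0 < Real.sin α := by
  rw [Set.uIoc_of_le (by positivity)] at h
  exact Real.sin_pos_of_pos_of_lt_pi h.1 (by linarith [h.2, Real.pi_pos])

lemma sin_mul_inv_sqrt_le {t α : ℝ} (ht : 0 < t) (hα : 0 < Real.sin α) :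
    Real.sin α * (√(t + Real.sin α ^ 2))⁻¹ ≤ 1 := by
  have hs : 0 < √(t + Real.sin α ^ 2) := Real.sqrt_pos.mpr (by positivity)
  rw [← div_eq_mul_inv, div_le_one hs]
  exact Real.le_sqrt_of_sq_le (by linarith)

lemma mul_inv_sqrt_sq_le {t α : ℝ} (ht : 0 < t) :
    t * (√(t + Real.sin α ^ 2))⁻¹ ^ 2 ≤ 1 := by
  have hp := add_sin_sq_pos ht α
  rw [inv_pow, Real.sq_sqrt hp.le, ← div_eq_mul_inv, div_le_one hp]
  linarith [sq_nonneg (Real.sin α)]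

lemma tendsto_inv_sqrt {α : ℝ} (hα : 0 < Real.sin α) :
    Tendsto (fun t : ℝ => (√(t + Real.sin α ^ 2))⁻¹) (𝓝[>] 0) (𝓝 (Real.sin α)⁻¹) := by
  have h : ContinuousAt (fun t : ℝ => (√(t + Real.sin α ^ 2))⁻¹) 0 := by
    refine ContinuousAt.inv₀ (by fun_prop) ?_
    rw [zero_add, Real.sqrt_sq hα.le]
    exact hα.ne'
  have := h.tendsto
  rw [zero_add, Real.sqrt_sq hα.le] at this
  exact this.mono_left nhdsWithin_le_nhds

/-- Since sin α ≤ √(t + sin² α), the integrand is dominated by |g| uniformly in t. -/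
lemma tendsto_sinKernel_one {g : ℝ → ℝ} (hg : ContinuousOn g (Set.uIcc 0 (Real.pi / 2))) :
    Tendsto (sinKernel 1 fun α => g α * Real.sin α) (𝓝[>] 0)
      (𝓝 (∫ α in (0 : ℝ)..(Real.pi / 2), g α)) := by
  have hgs : ContinuousOn (fun α => g α * Real.sin α) (Set.uIcc 0 (Real.pi / 2)) :=
    hg.mul Real.continuous_sin.continuousOn
  refine tendsto_integral_filter_of_dominated_convergence (fun α => |g α|) ?_ ?_
    (hg.abs.intervalIntegrable) ?_
  · filter_upwards [self_mem_nhdsWithin] with t ht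
    exact ((continuousOn_sinKernel_integrand hgs ht 1).intervalIntegrable
      (μ := volume)).aestronglyMeasurable_restrict_uIoc
  · filter_upwards [self_mem_nhdsWithin] with t ht
    refine Eventually.of_forall fun α hα => ?_
    have hs := sin_pos_of_mem_quarter hα
    have h1 := sin_mul_inv_sqrt_le ht hs
    have h0 : 0 ≤ Real.sin α * (√(t + Real.sin α ^ 2))⁻¹ := by positivity
    rw [pow_one, mul_assoc, norm_mul, Real.norm_eq_abs, Real.norm_of_nonneg h0]
    exact mul_le_of_le_one_right (abs_nonneg _) h1
  · refine Eventually.of_forall fun α hα => ?_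
    have hs := sin_pos_of_mem_quarter hα
    have := ((tendsto_inv_sqrt hs).pow 1).const_mul (g α * Real.sin α)
    have e : g α * Real.sin α * (Real.sin α)⁻¹ ^ 1 = g α := by field_simp
    rwa [e] at this

lemma tendsto_mul_sinKernel_three {g : ℝ → ℝ}
    (hg : ContinuousOn g (Set.uIcc 0 (Real.pi / 2))) :
    Tendsto (fun t => t * sinKernel 3 (fun α => g α * Real.sin α) t) (𝓝[>] 0) (𝓝 0) := by
  have hgs : ContinuousOn (fun α => g α * Real.sin α) (Set.uIcc 0 (Real.pi / 2)) :=
    hg.mul Real.continuous_sin.continuousOn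
  simp only [sinKernel, ← intervalIntegral.integral_const_mul]
  have h0 : (∫ _ in (0 : ℝ)..(Real.pi / 2), (0 : ℝ)) = 0 := by simp
  conv => enter [3, 1]; rw [← h0]
  refine tendsto_integral_filter_of_dominated_convergence (fun α => |g α|) ?_ ?_
    (hg.abs.intervalIntegrable) ?_
  · filter_upwards [self_mem_nhdsWithin] with t ht
    exact (((continuousOn_sinKernel_integrand hgs ht 3).intervalIntegrable
      (μ := volume)).const_mul t).aestronglyMeasurable_restrict_uIoc
  · filter_upwards [self_mem_nhdsWithin] with t ht
    have ht : 0 < t := ht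
    refine Eventually.of_forall fun α hα => ?_
    have hs := sin_pos_of_mem_quarter hα
    have h1 := sin_mul_inv_sqrt_le ht hs
    have h2 := mul_inv_sqrt_sq_le (α := α) ht
    have h3 : 0 ≤ Real.sin α * (√(t + Real.sin α ^ 2))⁻¹ := by positivity
    have h4 : 0 ≤ t * (√(t + Real.sin α ^ 2))⁻¹ ^ 2 := by positivity
    have e : t * (g α * Real.sin α * (√(t + Real.sin α ^ 2))⁻¹ ^ 3) =
      g α * ((Real.sin α * (√(t + Real.sin α ^ 2))⁻¹) * (t * (√(t + Real.sin α ^ 2))⁻¹ ^ 2)) := by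
      ring
    rw [e, norm_mul, Real.norm_eq_abs, Real.norm_of_nonneg (by positivity)]
    exact mul_le_of_le_one_right (abs_nonneg _) (mul_le_one₀ h1 h4 h2)
  · refine Eventually.of_forall fun α hα => ?_
    have hs := sin_pos_of_mem_quarter hα
    have ht : Tendsto (fun t : ℝ => t) (𝓝[>] 0) (𝓝 0) := tendsto_id.mono_left nhdsWithin_le_nhds
    have := ht.mul (((tendsto_inv_sqrt hs).pow 3).const_mul (g α * Real.sin α))
    rwa [zero_mul] at this

/-- The substitution x = sin α gives ∫₀¹ (t + x²)^(-1/2) dx, with primitive log(x + √(t + x²)). The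
entire logarithmic singularity comes from here. -/
lemma sinKernel_one_cos_base {t : ℝ} (ht : 0 < t) :
    sinKernel 1 Real.cos t = Real.log (1 + √(1 + t)) - Real.log t / 2 := by
  have hpos : ∀ α ∈ Set.uIcc 0 (Real.pi / 2), 0 < Real.sin α + √(t + Real.sin α ^ 2) := by
    intro α hα
    rw [Set.uIcc_of_le (by positivity)] at hα
    have h1 := Real.sin_nonneg_of_nonneg_of_le_pi hα.1 (by linarith [hα.2, Real.pi_pos])
    have h2 : 0 < √(t + Real.sin α ^ 2) := Real.sqrt_pos.mpr (by positivity)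
    linarith
  rw [sinKernel, integral_eq_sub_of_hasDerivAt
    (f := fun α => Real.log (Real.sin α + √(t + Real.sin α ^ 2)))]
  · rw [Real.sin_pi_div_two, Real.sin_zero]
    simp only [one_pow, ne_eq, OfNat.ofNat_ne_zero, not_false_eq_true, zero_pow, add_zero, zero_add]
    rw [Real.log_sqrt ht.le, add_comm t 1]
  · intro α hα
    have hp := hpos α hα
    have hs : 0 < √(t + Real.sin α ^ 2) := Real.sqrt_pos.mpr (by positivity)
    have h := ((Real.hasDerivAt_sin α).add
      ((((Real.hasDerivAt_sin α).pow 2).const_add t).sqrt (add_sin_sq_pos ht α).ne')).log hp.ne'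
    refine h.congr_deriv ?_
    simp only [Pi.add_apply, Pi.pow_apply] at *
    field_simp
    push_cast
    ring
  · exact (continuousOn_sinKernel_integrand (by fun_prop) ht 1).intervalIntegrable

lemma sinKernel_three_cos_base {t : ℝ} (ht : 0 < t) :
    t * sinKernel 3 Real.cos t = (√(1 + t))⁻¹ := by
  rw [sinKernel, ← intervalIntegral.integral_const_mul, integral_eq_sub_of_hasDerivAt
    (f := fun α => Real.sin α * (√(t + Real.sin α ^ 2))⁻¹)]
  · rw [Real.sin_pi_div_two, Real.sin_zero]
    simp [add_comm t 1]
  · intro α _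
    have hpos := add_sin_sq_pos ht α
    have hs : HasDerivAt (fun α => (√(t + Real.sin α ^ 2))⁻¹) _ α := hasDerivAt_inv_sqrt
      ((((Real.hasDerivAt_sin α).pow 2).const_add t)) hpos
    refine ((Real.hasDerivAt_sin α).mul hs).congr_deriv ?_
    have hS : (√(t + Real.sin α ^ 2))⁻¹ ^ 2 * (t + Real.sin α ^ 2) = 1 := by
      rw [inv_pow, Real.sq_sqrt hpos.le, inv_mul_cancel₀ hpos.ne']
    generalize (√(t + Real.sin α ^ 2))⁻¹ = s at *
    push_cast
    linear_combination -Real.cos α * s * hS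
  · exact ((continuousOn_sinKernel_integrand (by fun_prop) ht 3).intervalIntegrable).const_mul t

lemma sinKernel_cos_eq_add (n m : ℕ) {t : ℝ} (ht : 0 < t) :
    sinKernel n (fun α => Real.cos (2 * m * α)) t = sinKernel n Real.cos t
      + sinKernel n (fun α => cosQuotient m α * Real.sin α) t := by
  have hgs : ContinuousOn (fun α => cosQuotient m α * Real.sin α) (Set.uIcc 0 (Real.pi / 2)) :=
    (continuousOn_cosQuotient m).mul Real.continuous_sin.continuousOn
  simp only [sinKernel]
  rw [← intervalIntegral.integral_add
    (continuousOn_sinKernel_integrand (by fun_prop) ht n).intervalIntegrable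
    (continuousOn_sinKernel_integrand hgs ht n).intervalIntegrable]
  refine intervalIntegral.integral_congr fun α hα => ?_
  rw [cos_eq_cos_add_cosQuotient m hα]
  ring

lemma tendsto_sinKernel_one_add_log (m : ℕ) :
    Tendsto (fun t => sinKernel 1 (fun α => Real.cos (2 * m * α)) t + Real.log t / 2) (𝓝[>] 0)
      (𝓝 (Real.log 2 + ∫ α in (0 : ℝ)..(Real.pi / 2), cosQuotient m α)) := by
  have h1 : Tendsto (fun t : ℝ => Real.log (1 + √(1 + t))) (𝓝[>] 0) (𝓝 (Real.log 2)) := by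
    have : ContinuousAt (fun t : ℝ => Real.log (1 + √(1 + t))) 0 := by
      refine ContinuousAt.log (by fun_prop) ?_
      simp
    have := this.tendsto
    rw [add_zero, Real.sqrt_one, one_add_one_eq_two] at this
    exact this.mono_left nhdsWithin_le_nhds
  refine (h1.add (tendsto_sinKernel_one (continuousOn_cosQuotient m))).congr' ?_
  filter_upwards [self_mem_nhdsWithin] with t ht
  rw [sinKernel_cos_eq_add 1 m ht, sinKernel_one_cos_base ht]
  ring

lemma tendsto_mul_sinKernel_three_cos (m : ℕ) :
    Tendsto (fun t => t * sinKernel 3 (fun α => Real.cos (2 * m * α)) t) (𝓝[>] 0) (𝓝 1) := by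
  have h1 : Tendsto (fun t : ℝ => (√(1 + t))⁻¹) (𝓝[>] 0) (𝓝 1) := by
    have : ContinuousAt (fun t : ℝ => (√(1 + t))⁻¹) 0 :=
      ContinuousAt.inv₀ (by fun_prop) (by simp)
    have := this.tendsto
    rw [add_zero, Real.sqrt_one, inv_one] at this
    exact this.mono_left nhdsWithin_le_nhds
  have h := h1.add (tendsto_mul_sinKernel_three (continuousOn_cosQuotient m))
  rw [add_zero] at h
  refine h.congr' ?_
  filter_upwards [self_mem_nhdsWithin] with t ht
  rw [sinKernel_cos_eq_add 3 m ht, mul_add, sinKernel_three_cos_base ht]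

/-! ### Behaviour of the series as t → 0⁺, and matching -/

lemma tendsto_powerSum {p : ℕ → ℂ} (hp : PolyGrowth p) :
    Tendsto (fun t : ℝ => powerSum p t) (𝓝[>] 0) (𝓝 (p 0)) := by
  have := (hp.hasDerivAt_real (t := 0) (by simp)).continuousAt.tendsto
  rw [Complex.ofReal_zero, powerSum_zero] at this
  exact this.mono_left nhdsWithin_le_nhds

lemma tendsto_ofReal_nhdsGT_zero : Tendsto (fun t : ℝ => (t : ℂ)) (𝓝[>] 0) (𝓝 0) := by
  have : Tendsto (fun t : ℝ => (t : ℂ)) (𝓝 0) (𝓝 ((0 : ℝ) : ℂ)) :=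
    Complex.continuous_ofReal.tendsto 0
  rw [Complex.ofReal_zero] at this
  exact this.mono_left nhdsWithin_le_nhds

lemma tendsto_ofReal_mul_log : Tendsto (fun t : ℝ => ((t * Real.log t : ℝ) : ℂ)) (𝓝[>] 0) (𝓝 0) := by
  have h := tendsto_log_mul_rpow_nhdsGT_zero one_pos
  simp only [Real.rpow_one] at h
  have h2 := (Complex.continuous_ofReal.tendsto 0).comp h
  rw [Complex.ofReal_zero] at h2
  refine h2.congr fun t => ?_
  simp [mul_comm]

/-- Write the product as the difference quotient of the power series at 0, which converges, times t
log t → 0. -/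
lemma tendsto_powerSum_sub_mul_log {p : ℕ → ℂ} (hp : PolyGrowth p) :
    Tendsto (fun t : ℝ => (powerSum p t - p 0) * Real.log t) (𝓝[>] 0) (𝓝 0) := by
  have hd := hp.hasDerivAt_real (t := 0) (by simp)
  have h1 := hd.tendsto_slope.mono_left (nhdsWithin_mono 0 (fun t (ht : 0 < t) => ht.ne'))
  have h2 := h1.mul tendsto_ofReal_mul_log
  rw [mul_zero] at h2
  refine h2.congr' ?_
  filter_upwards [self_mem_nhdsWithin] with t ht
  have htc : (t : ℂ) ≠ 0 := by exact_mod_cast (ne_of_gt ht)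
  rw [slope_def_module, Complex.ofReal_zero, powerSum_zero]
  simp only [sub_zero, Complex.real_smul]
  push_cast
  field_simp

lemma tendsto_diagSeries_add_log (m : ℕ) :
    Tendsto (fun t => diagSeries m t + (-1) ^ m * Real.log t) (𝓝[>] 0) (𝓝 (diagLogCoeff m 0)) := by
  have h := (tendsto_powerSum_sub_mul_log (polyGrowth_diagCoeff m)).neg.add
    (tendsto_powerSum (polyGrowth_diagLogCoeff m))
  rw [neg_zero, zero_add] at h
  refine h.congr fun t => ?_
  rw [diagSeries, diagCoeff_zero]
  ring

/-- The logarithm forces a derivative of size 1/t, so the vanishing of the Wronskian at 0 needs t y'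
to be matched as well as y. -/
lemma tendsto_mul_diagSeriesDeriv (m : ℕ) :
    Tendsto (fun t : ℝ => t * diagSeriesDeriv m t) (𝓝[>] 0) (𝓝 (-(-1) ^ m)) := by
  have hp := polyGrowth_diagCoeff m
  have h := (((tendsto_powerSum hp.derivCoeff).neg.mul tendsto_ofReal_mul_log).sub
    (tendsto_powerSum hp)).add (tendsto_ofReal_nhdsGT_zero.mul
      (tendsto_powerSum (polyGrowth_diagLogCoeff m).derivCoeff))
  rw [mul_zero, zero_mul, zero_sub, add_zero, diagCoeff_zero] at h
  refine h.congr' ?_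
  filter_upwards [self_mem_nhdsWithin] with t ht
  have htc : (t : ℂ) ≠ 0 := by exact_mod_cast (ne_of_gt ht)
  rw [diagSeriesDeriv]
  push_cast
  field_simp

lemma eq_zero_of_hasDerivAt_zero {f : ℝ → ℂ} {δ : ℝ}
    (hf : ∀ t, 0 < t → t < δ → HasDerivAt f 0 t) (h0 : Tendsto f (𝓝[>] 0) (𝓝 0)) {t : ℝ}
    (ht : 0 < t) (ht' : t < δ) : f t = 0 := by
  have hd : DifferentiableOn ℝ f (Set.Ioo 0 δ) := fun x hx =>
    (hf x hx.1 hx.2).differentiableAt.differentiableWithinAt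
  have hc : ∀ x ∈ Set.Ioo 0 δ, f x = f t := fun x hx =>
    isOpen_Ioo.is_const_of_deriv_eq_zero (convex_Ioo 0 δ).isPreconnected hd
      (fun y hy => (hf y hy.1 hy.2).deriv) hx ⟨ht, ht'⟩
  have hlim : Tendsto f (𝓝[>] 0) (𝓝 (f t)) := by
    refine tendsto_const_nhds.congr' ?_
    filter_upwards [Ioo_mem_nhdsGT (ht.trans ht')] with x hx using (hc x hx).symm
  exact tendsto_nhds_unique hlim h0

/-- A solution of the Legendre equation that is small at the singular point `0` vanishes. -/
lemma legendre_unique (m : ℕ) {h h' h'' : ℝ → ℂ}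
    (hd : ∀ t, 0 < t → t < 1 → HasDerivAt h (h' t) t)
    (hd' : ∀ t, 0 < t → t < 1 → HasDerivAt h' (h'' t) t)
    (hode : ∀ t : ℝ, 0 < t → t < 1 →
      t * (1 + t) * h'' t + (1 + 2 * t) * h' t + (1 / 4 - (m : ℂ) ^ 2) * h t = 0)
    (h0 : Tendsto h (𝓝[>] 0) (𝓝 0)) (h1 : Tendsto (fun t : ℝ => t * h' t) (𝓝[>] 0) (𝓝 0)) :
    ∃ δ > 0, δ ≤ 1 ∧ ∀ t, 0 < t → t < δ → h t = 0 := by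
  have hp := polyGrowth_diagCoeff m
  set P : ℝ → ℂ := fun t => powerSum (diagCoeff m) t with hP
  set P' : ℝ → ℂ := fun t => powerSum (derivCoeff (diagCoeff m)) t with hP'
  set P'' : ℝ → ℂ := fun t => powerSum (derivCoeff (derivCoeff (diagCoeff m))) t with hP''
  have abs_lt : ∀ t : ℝ, 0 < t → t < 1 → |t| < 1 := fun t h0 h1 => by rwa [abs_of_pos h0]
  have hPd : ∀ t, 0 < t → t < 1 → HasDerivAt P (P' t) t := fun t h0 h1 =>
    hp.hasDerivAt_real (abs_lt t h0 h1)
  have hPd' : ∀ t, 0 < t → t < 1 → HasDerivAt P' (P'' t) t := fun t h0 h1 =>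
    hp.derivCoeff.hasDerivAt_real (abs_lt t h0 h1)
  have hPode : ∀ t : ℝ, 0 < t → t < 1 →
      t * (1 + t) * P'' t + (1 + 2 * t) * P' t + (1 / 4 - (m : ℂ) ^ 2) * P t = 0 :=
    fun t h0 h1 => powerSum_diagCoeff_ode m (by simpa using abs_lt t h0 h1)
  have hid : ∀ t : ℝ, HasDerivAt (fun t : ℝ => (t : ℂ)) 1 t := fun t => by
    simpa using (hasDerivAt_id t).ofReal_comp
  -- In self-adjoint form (t(1+t)y')' + (1/4 - m²)y = 0, the product of t(1+t) and the Wronskian of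
  -- h and P is constant; it tends to 0 at 0⁺.
  have hW : ∀ t : ℝ, 0 < t → t < 1 → ((t : ℝ) : ℂ) * (1 + t) * (h t * P' t - h' t * P t) = 0 := by
    intro t ht ht'
    refine eq_zero_of_hasDerivAt_zero (δ := 1)
      (f := fun t : ℝ => (t : ℂ) * (1 + t) * (h t * P' t - h' t * P t)) (fun x hx hx' => ?_) ?_
      ht ht'
    · refine (((hid x).mul ((hid x).const_add 1)).mul
        (((hd x hx hx').mul (hPd' x hx hx')).sub ((hd' x hx hx').mul (hPd x hx hx')))).congr_deriv ?_
      simp only [Pi.mul_apply, Pi.sub_apply]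
      linear_combination h x * hPode x hx hx' - P x * hode x hx hx'
    · have ht0 := tendsto_ofReal_nhdsGT_zero
      have := (((h0.mul (tendsto_powerSum hp.derivCoeff)).mul ht0).sub
        (h1.mul (tendsto_powerSum hp))).mul (ht0.const_add 1)
      simp only [zero_mul, mul_zero, sub_zero] at this
      refine this.congr fun t => ?_
      ring
  have hP0 : ∀ᶠ t in 𝓝[>] (0 : ℝ), P t ≠ 0 := by
    refine (tendsto_powerSum hp).eventually_ne ?_
    rw [diagCoeff_zero]; simp
  obtain ⟨δ, hδ, hPδ⟩ := (mem_nhdsGT_iff_exists_Ioo_subset.mp hP0)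
  have hδ : 0 < δ := hδ
  have hne : ∀ t, 0 < t → t < min δ 1 → P t ≠ 0 := fun t h0 h1 =>
    hPδ ⟨h0, h1.trans_le (min_le_left _ _)⟩
  refine ⟨min δ 1, by positivity, min_le_right _ _, fun t ht ht' => ?_⟩
  -- With zero Wronskian h/P is constant where P ≠ 0, which holds near 0 because P(0) = (-1)^m; its
  -- limit at 0 is 0.
  have hq : h t / P t = 0 := by
    refine eq_zero_of_hasDerivAt_zero (δ := min δ 1) (f := fun t => h t / P t)
      (fun x hx hx' => ?_) ?_ ht ht'
    · have hx1 := hx'.trans_le (min_le_right δ 1)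
      refine ((hd x hx hx1).div (hPd x hx hx1) (hne x hx hx')).congr_deriv ?_
      have hxx : (x : ℂ) * (1 + x) ≠ 0 := by
        have : x * (1 + x) ≠ 0 := by positivity
        exact_mod_cast this
      have := (mul_eq_zero.mp (hW x hx hx1)).resolve_left hxx
      rw [div_eq_zero_iff]
      left
      linear_combination -this
    · have := h0.div (tendsto_powerSum hp) (by rw [diagCoeff_zero]; simp)
      rwa [zero_div] at this
  exact (div_eq_zero_iff.mp hq).resolve_right (hne t ht ht')

lemma diagLogCoeff_zero (m : ℕ) :
    diagLogCoeff m 0 = (-1) ^ m * ((2 * (Real.log 2 +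
      ∫ α in (0 : ℝ)..(Real.pi / 2), cosQuotient m α) : ℝ) : ℂ) := by
  rw [diagLogCoeff, diagCoeff_zero, mul_zero, ← integral_cosQuotient, digammaSum_zero_zero]
  push_cast
  ring

lemma exists_sinKernel_eq_diagSeries (m : ℕ) : ∃ δ > 0, δ ≤ 1 ∧ ∀ t, 0 < t → t < δ →
    ((-1) ^ m * (2 * sinKernel 1 (fun α => Real.cos (2 * m * α)) t : ℝ) : ℂ) = diagSeries m t := by
  set K := sinKernel 1 (fun α => Real.cos (2 * m * α)) with hK
  set K' := fun t => -(1 / 2) * sinKernel 3 (fun α => Real.cos (2 * m * α)) t with hK'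
  set K'' := fun t => 3 / 4 * sinKernel 5 (fun α => Real.cos (2 * m * α)) t with hK''
  obtain ⟨δ, hδ, hδ1, h⟩ := legendre_unique m
    (h := fun t => (-1) ^ m * ((2 * K t : ℝ) : ℂ) - diagSeries m t)
    (h' := fun t => (-1) ^ m * ((2 * K' t : ℝ) : ℂ) - diagSeriesDeriv m t)
    (h'' := fun t => (-1) ^ m * ((2 * K'' t : ℝ) : ℂ) - diagSeriesDerivTwo m t)
    (fun t ht ht' => ((((hasDerivAt_sinKernel_one_cos m ht).const_mul 2).ofReal_comp).const_mul
      _).sub (hasDerivAt_diagSeries m ht ht'))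
    (fun t ht ht' => ((((hasDerivAt_sinKernel_three_cos m ht).const_mul 2).ofReal_comp).const_mul
      _).sub (hasDerivAt_diagSeriesDeriv m ht ht'))
    (fun t ht ht' => by
      have e1 := diagSeries_ode m ht ht'
      have e2 : ((t * (1 + t) * K'' t + (1 + 2 * t) * K' t + (1 / 4 - (m : ℝ) ^ 2) * K t : ℝ) : ℂ)
        = 0 := by
        rw [Complex.ofReal_eq_zero]; exact sinKernel_cos_ode m ht
      push_cast at e2 ⊢
      linear_combination 2 * (-1) ^ m * e2 - e1)
    (by
      have h1 := ((Complex.continuous_ofReal.tendsto _).comp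
        ((tendsto_sinKernel_one_add_log m).const_mul 2)).const_mul ((-1 : ℂ) ^ m)
      have h2 := h1.sub (tendsto_diagSeries_add_log m)
      rw [diagLogCoeff_zero, sub_self] at h2
      refine h2.congr fun t => ?_
      simp only [Function.comp_apply, hK]
      push_cast
      ring)
    (by
      have h1 := ((Complex.continuous_ofReal.tendsto _).comp
        (tendsto_mul_sinKernel_three_cos m)).const_mul (-(-1 : ℂ) ^ m)
      have h2 := h1.sub (tendsto_mul_diagSeriesDeriv m)
      simp only [Complex.ofReal_one, mul_one, sub_self] at h2
      refine h2.congr fun t => ?_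
      simp only [Function.comp_apply, hK']
      push_cast
      ring)
  exact ⟨δ, hδ, hδ1, fun t ht ht' => sub_eq_zero.mp (h t ht ht')⟩

/-! ### The Green kernel: lattice equation, symmetries, holomorphy -/

/-- The integrand of the Green kernel of the square lattice. -/
noncomputable def torusIntegrand (z : ℂ) (m n : ℤ) (x y : ℝ) : ℂ :=
  Complex.exp (Complex.I * (m * x + n * y)) / (4 - 2 * Complex.cos x - 2 * Complex.cos y - z)

/-- The Green kernel of the square lattice as an iterated integral. -/
noncomputable def torusGreen (z : ℂ) (m n : ℤ) : ℂ :=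
  (∫ x in (-Real.pi)..Real.pi, ∫ y in (-Real.pi)..Real.pi, torusIntegrand z m n x y) /
    (4 * Real.pi ^ 2)

lemma torus_denominator_ne_zero {z : ℂ} (hz : 0 < z.im) (x y : ℝ) :
    4 - 2 * Complex.cos x - 2 * Complex.cos y - z ≠ 0 := by
  intro h
  have e : ((4 - 2 * Real.cos x - 2 * Real.cos y : ℝ) : ℂ) = z := by
    push_cast
    linear_combination h
  rw [← e, Complex.ofReal_im] at hz
  exact lt_irrefl _ hz

lemma continuous_torusIntegrand {z : ℂ} (hz : 0 < z.im) (m n : ℤ) :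
    Continuous (torusIntegrand z m n).uncurry := by
  unfold torusIntegrand Function.uncurry
  exact Continuous.div (by fun_prop) (by fun_prop) fun p => torus_denominator_ne_zero hz p.1 p.2

lemma iterated_integral_add {f g : ℝ → ℝ → ℂ} (hf : Continuous f.uncurry)
    (hg : Continuous g.uncurry) (a b : ℝ) :
    ∫ x in a..b, ∫ y in a..b, (f x y + g x y) =
      (∫ x in a..b, ∫ y in a..b, f x y) + ∫ x in a..b, ∫ y in a..b, g x y := by
  have h1 := (continuous_parametric_intervalIntegral_of_continuous' (μ := volume) hf a b)
  have h2 := (continuous_parametric_intervalIntegral_of_continuous' (μ := volume) hg a b)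
  rw [← intervalIntegral.integral_add (h1.intervalIntegrable _ _) (h2.intervalIntegrable _ _)]
  refine intervalIntegral.integral_congr fun x _ => ?_
  exact intervalIntegral.integral_add
    ((hf.comp (by fun_prop : Continuous fun y : ℝ => (x, y))).intervalIntegrable _ _)
    ((hg.comp (by fun_prop : Continuous fun y : ℝ => (x, y))).intervalIntegrable _ _)

lemma integral_integral_swap_of_continuous {f : ℝ → ℝ → ℂ} (hf : Continuous f.uncurry)
    (a b c d : ℝ) :
    ∫ x in a..b, ∫ y in c..d, f x y = ∫ y in c..d, ∫ x in a..b, f x y := by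
  refine intervalIntegral_intervalIntegral_swap ?_
  refine (hf.continuousOn.integrableOn_compact (K := Set.uIcc a b ×ˢ Set.uIcc c d)
    (isCompact_uIcc.prod isCompact_uIcc)).mono_set ?_
  exact Set.prod_mono Set.uIoc_subset_uIcc Set.uIoc_subset_uIcc

lemma integral_exp_int_mul (m : ℤ) :
    ∫ x in (-Real.pi)..Real.pi, Complex.exp (Complex.I * m * x) =
      if m = 0 then 2 * (Real.pi : ℂ) else 0 := by
  split_ifs with h
  · subst h
    simp
    ring
  · have hc : Complex.I * (m : ℂ) ≠ 0 := mul_ne_zero Complex.I_ne_zero (by exact_mod_cast h)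
    rw [integral_exp_mul_complex hc]
    have : Complex.exp (Complex.I * m * (Real.pi : ℝ)) =
        Complex.exp (Complex.I * m * ((-Real.pi : ℝ) : ℂ)) := by
      rw [Complex.exp_eq_exp_iff_exists_int]
      exact ⟨m, by push_cast; ring⟩
    rw [this, sub_self, zero_div]

lemma integral_integral_exp (m n : ℤ) :
    ∫ x in (-Real.pi)..Real.pi, ∫ y in (-Real.pi)..Real.pi,
      Complex.exp (Complex.I * (m * x + n * y)) =
      if m = 0 ∧ n = 0 then 4 * (Real.pi : ℂ) ^ 2 else 0 := by
  have e : ∀ x y : ℝ, Complex.exp (Complex.I * (m * x + n * y)) =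
      Complex.exp (Complex.I * m * x) * Complex.exp (Complex.I * n * y) := fun x y => by
    rw [← Complex.exp_add]; congr 1; ring
  simp only [e, intervalIntegral.integral_const_mul, intervalIntegral.integral_mul_const,
    integral_exp_int_mul]
  by_cases h1 : m = 0 <;> by_cases h2 : n = 0 <;> simp [h1, h2]
  ring

/-- Summing over neighbours multiplies the integrand by 2 cos x + 2 cos y, which is 4 - z minus the
denominator; the denominator cancels and leaves the bare exponential. -/
lemma torusIntegrand_neighbours {z : ℂ} (hz : 0 < z.im) (m n : ℤ) (x y : ℝ) :
    torusIntegrand z (m + 1) n x y + torusIntegrand z (m - 1) n x y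
      + torusIntegrand z m (n + 1) x y + torusIntegrand z m (n - 1) x y
      + Complex.exp (Complex.I * (m * x + n * y)) = (4 - z) * torusIntegrand z m n x y := by
  have hd := torus_denominator_ne_zero hz x y
  have h1 : Complex.exp (Complex.I * (((m + 1 : ℤ) : ℂ) * x + n * y)) =
      Complex.exp (Complex.I * (m * x + n * y)) * Complex.exp (x * Complex.I) := by
    rw [← Complex.exp_add]; congr 1; push_cast; ring
  have h2 : Complex.exp (Complex.I * (((m - 1 : ℤ) : ℂ) * x + n * y)) =
      Complex.exp (Complex.I * (m * x + n * y)) * Complex.exp (-x * Complex.I) := by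
    rw [← Complex.exp_add]; congr 1; push_cast; ring
  have h3 : Complex.exp (Complex.I * (m * x + ((n + 1 : ℤ) : ℂ) * y)) =
      Complex.exp (Complex.I * (m * x + n * y)) * Complex.exp (y * Complex.I) := by
    rw [← Complex.exp_add]; congr 1; push_cast; ring
  have h4 : Complex.exp (Complex.I * (m * x + ((n - 1 : ℤ) : ℂ) * y)) =
      Complex.exp (Complex.I * (m * x + n * y)) * Complex.exp (-y * Complex.I) := by
    rw [← Complex.exp_add]; congr 1; push_cast; ring
  have cx := Complex.two_cos (x : ℂ)
  have cy := Complex.two_cos (y : ℂ)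
  simp only [torusIntegrand, h1, h2, h3, h4]
  generalize Complex.exp (Complex.I * (m * x + n * y)) = E
  generalize e : 4 - 2 * Complex.cos x - 2 * Complex.cos y - z = d at *
  generalize Complex.exp (x * Complex.I) = p1 at *
  generalize Complex.exp (-x * Complex.I) = p2 at *
  generalize Complex.exp (y * Complex.I) = p3 at *
  generalize Complex.exp (-y * Complex.I) = p4 at *
  field_simp
  linear_combination -E * cx - E * cy - E * e

lemma torusGreen_recursion {z : ℂ} (hz : 0 < z.im) (m n : ℤ) :
    torusGreen z (m + 1) n + torusGreen z (m - 1) n + torusGreen z m (n + 1)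
      + torusGreen z m (n - 1) =
      (4 - z) * torusGreen z m n - if m = 0 ∧ n = 0 then 1 else 0 := by
  have c := continuous_torusIntegrand hz
  have cE : Continuous (fun x y : ℝ => Complex.exp (Complex.I * (m * x + n * y))).uncurry := by
    unfold Function.uncurry; fun_prop
  have c12 : Continuous (fun x y : ℝ => torusIntegrand z (m + 1) n x y
      + torusIntegrand z (m - 1) n x y).uncurry := (c (m + 1) n).add (c (m - 1) n)
  have c123 : Continuous (fun x y : ℝ => torusIntegrand z (m + 1) n x y
      + torusIntegrand z (m - 1) n x y + torusIntegrand z m (n + 1) x y).uncurry :=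
    c12.add (c m (n + 1))
  have c1234 : Continuous (fun x y : ℝ => torusIntegrand z (m + 1) n x y
      + torusIntegrand z (m - 1) n x y + torusIntegrand z m (n + 1) x y
      + torusIntegrand z m (n - 1) x y).uncurry := c123.add (c m (n - 1))
  have key : ∫ x in (-Real.pi)..Real.pi, ∫ y in (-Real.pi)..Real.pi,
      (torusIntegrand z (m + 1) n x y + torusIntegrand z (m - 1) n x y
      + torusIntegrand z m (n + 1) x y + torusIntegrand z m (n - 1) x y
      + Complex.exp (Complex.I * (m * x + n * y))) =
      ∫ x in (-Real.pi)..Real.pi, ∫ y in (-Real.pi)..Real.pi,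
        (4 - z) * torusIntegrand z m n x y := by
    simp only [torusIntegrand_neighbours hz]
  rw [iterated_integral_add c1234 cE, iterated_integral_add c123 (c m (n - 1)),
    iterated_integral_add c12 (c m (n + 1)), iterated_integral_add (c (m + 1) n) (c (m - 1) n),
    integral_integral_exp] at key
  simp only [intervalIntegral.integral_const_mul] at key
  have hpi : (4 * (Real.pi : ℂ) ^ 2) ≠ 0 := by
    have : (Real.pi : ℂ) ≠ 0 := by exact_mod_cast Real.pi_ne_zero
    simp [this]
  have e : (if m = 0 ∧ n = 0 then 4 * (Real.pi : ℂ) ^ 2 else 0) =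
      (4 * (Real.pi : ℂ) ^ 2) * if m = 0 ∧ n = 0 then 1 else 0 := by split_ifs <;> simp
  rw [e] at key
  simp only [torusGreen]
  generalize (4 * (Real.pi : ℂ) ^ 2) = p at *
  field_simp
  linear_combination key

lemma torusGreen_swap {z : ℂ} (hz : 0 < z.im) (m n : ℤ) :
    torusGreen z n m = torusGreen z m n := by
  rw [torusGreen, integral_integral_swap_of_continuous (continuous_torusIntegrand hz n m),
    torusGreen]
  congr 1
  refine intervalIntegral.integral_congr fun x _ => intervalIntegral.integral_congr fun y _ => ?_
  simp only [torusIntegrand]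
  congr 2 <;> ring

lemma torusGreen_neg_right (z : ℂ) (m n : ℤ) : torusGreen z m (-n) = torusGreen z m n := by
  simp only [torusGreen]
  congr 1
  refine intervalIntegral.integral_congr fun x _ => ?_
  have h := intervalIntegral.integral_comp_neg (a := -Real.pi) (b := Real.pi)
    (fun y => torusIntegrand z m n x y)
  rw [neg_neg] at h
  rw [← h]
  refine intervalIntegral.integral_congr fun y _ => ?_
  simp [torusIntegrand]

lemma latticeGreen_two {z : ℂ} (hz : 0 < z.im) (n : Fin 2 → ℤ) :
    latticeGreen 2 z n = torusGreen z (n 0) (n 1) := by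
  have hle : -Real.pi ≤ Real.pi := by linarith [Real.pi_pos]
  have hint : IntegrableOn (torusIntegrand z (n 0) (n 1)).uncurry
      (Set.Ioc (-Real.pi) Real.pi ×ˢ Set.Ioc (-Real.pi) Real.pi) :=
    ((continuous_torusIntegrand hz _ _).continuousOn.integrableOn_compact
      (isCompact_Icc.prod isCompact_Icc)).mono_set
      (Set.prod_mono Set.Ioc_subset_Icc_self Set.Ioc_subset_Icc_self)
  have h1 := ((volume_preserving_finTwoArrow ℝ)).setIntegral_preimage_emb
    (MeasurableEquiv.measurableEmbedding _) (torusIntegrand z (n 0) (n 1)).uncurry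
    (Set.Ioc (-Real.pi) Real.pi ×ˢ Set.Ioc (-Real.pi) Real.pi)
  rw [Measure.volume_eq_prod] at h1 hint
  rw [setIntegral_prod _ hint] at h1
  have hset : (MeasurableEquiv.finTwoArrow : (Fin 2 → ℝ) ≃ᵐ ℝ × ℝ) ⁻¹'
      (Set.Ioc (-Real.pi) Real.pi ×ˢ Set.Ioc (-Real.pi) Real.pi) =
      Set.univ.pi (fun _ : Fin 2 => Set.Ioc (-Real.pi) Real.pi) := by
    ext θ
    simp [Fin.forall_fin_two]
  rw [hset] at h1
  simp only [latticeGreen, torusGreen, intervalIntegral.integral_of_le hle]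
  have h2 : ∀ θ : Fin 2 → ℝ, Complex.exp (Complex.I * ∑ j, (n j : ℂ) * (θ j : ℂ)) /
        (2 * ((2 : ℕ) : ℂ) - ∑ j, 2 * Complex.cos (θ j : ℂ) - z) =
      (torusIntegrand z (n 0) (n 1)).uncurry (MeasurableEquiv.finTwoArrow θ) := by
    intro θ
    simp only [Fin.sum_univ_two, Function.uncurry, torusIntegrand]
    congr 1
    push_cast
    simp
    ring
  simp only [h2]
  rw [h1]
  push_cast
  rw [zpow_neg, show (2 : ℤ) = ((2 : ℕ) : ℤ) by rfl, zpow_natCast, mul_pow]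
  simp only [Function.uncurry]
  ring

lemma norm_exp_I_mul_ofReal_sum (n : Fin 2 → ℤ) (θ : Fin 2 → ℝ) :
    ‖Complex.exp (Complex.I * ∑ j, (n j : ℂ) * (θ j : ℂ))‖ = 1 := by
  have : ∑ j, (n j : ℂ) * (θ j : ℂ) = ((∑ j, (n j : ℝ) * θ j : ℝ) : ℂ) := by push_cast; rfl
  rw [this, mul_comm, Complex.norm_exp_ofReal_mul_I]

lemma lattice_denominator {z : ℂ} (θ : Fin 2 → ℝ) :
    z.im ≤ ‖2 * ((2 : ℕ) : ℂ) - ∑ j, 2 * Complex.cos (θ j : ℂ) - z‖ := by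
  have e : 2 * ((2 : ℕ) : ℂ) - ∑ j, 2 * Complex.cos (θ j : ℂ) =
      ((4 - ∑ j, 2 * Real.cos (θ j) : ℝ) : ℂ) := by push_cast; ring
  rw [e]
  refine le_trans ?_ (Complex.abs_im_le_norm _)
  rw [Complex.sub_im, Complex.ofReal_im, zero_sub, abs_neg]
  exact le_abs_self _

/-- Differentiation under the integral is legitimate because the denominator has modulus at least Im
w, which stays above Im z / 2 near z. -/
lemma differentiableAt_latticeGreen {z : ℂ} (hz : 0 < z.im) (n : Fin 2 → ℤ) :
    DifferentiableAt ℂ (fun z => latticeGreen 2 z n) z := by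
  set S := Set.univ.pi (fun _ : Fin 2 => Set.Ioc (-Real.pi) Real.pi)
  have hne : ∀ w : ℂ, 0 < w.im → ∀ θ : Fin 2 → ℝ,
      2 * ((2 : ℕ) : ℂ) - ∑ j, 2 * Complex.cos (θ j : ℂ) - w ≠ 0 := fun w hw θ => by
    rw [← norm_pos_iff]; exact hw.trans_le (lattice_denominator θ)
  have hcont : ∀ w : ℂ, 0 < w.im → Continuous fun θ : Fin 2 → ℝ =>
      Complex.exp (Complex.I * ∑ j, (n j : ℂ) * (θ j : ℂ)) /
        (2 * ((2 : ℕ) : ℂ) - ∑ j, 2 * Complex.cos (θ j : ℂ) - w) := fun w hw =>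
    Continuous.div (by fun_prop) (by fun_prop) (hne w hw)
  have hcont' : Continuous fun θ : Fin 2 → ℝ =>
      Complex.exp (Complex.I * ∑ j, (n j : ℂ) * (θ j : ℂ)) /
        (2 * ((2 : ℕ) : ℂ) - ∑ j, 2 * Complex.cos (θ j : ℂ) - z) ^ 2 :=
    Continuous.div (by fun_prop) (by fun_prop) fun θ => pow_ne_zero 2 (hne z hz θ)
  have hS : volume S ≠ ⊤ := by
    have : Bornology.IsBounded S := Bornology.IsBounded.pi fun _ => Metric.isBounded_Ioc _ _
    exact this.measure_lt_top.ne
  have hfin : IsFiniteMeasure (volume.restrict S) := ⟨by simpa using hS.lt_top⟩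
  have hU : {w : ℂ | z.im / 2 < w.im} ∈ 𝓝 z :=
    (isOpen_lt continuous_const Complex.continuous_im).mem_nhds (by simp; linarith)
  have key := hasDerivAt_integral_of_dominated_loc_of_deriv_le (μ := volume.restrict S)
    (F := fun (w : ℂ) (θ : Fin 2 → ℝ) => Complex.exp (Complex.I * ∑ j, (n j : ℂ) * (θ j : ℂ)) /
        (2 * ((2 : ℕ) : ℂ) - ∑ j, 2 * Complex.cos (θ j : ℂ) - w))
    (F' := fun (w : ℂ) (θ : Fin 2 → ℝ) => Complex.exp (Complex.I * ∑ j, (n j : ℂ) * (θ j : ℂ)) /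
        (2 * ((2 : ℕ) : ℂ) - ∑ j, 2 * Complex.cos (θ j : ℂ) - w) ^ 2)
    (x₀ := z) (bound := fun _ => 1 / (z.im / 2) ^ 2) hU
    (by filter_upwards [hU] with w hw using
      (hcont w ((half_pos hz).trans hw)).aestronglyMeasurable)
    (by
      refine Integrable.of_bound (hcont z hz).aestronglyMeasurable (1 / z.im)
        (Eventually.of_forall fun θ => ?_)
      rw [norm_div, norm_exp_I_mul_ofReal_sum]
      gcongr
      exact lattice_denominator θ)
    hcont'.aestronglyMeasurable
    (by
      refine Eventually.of_forall fun θ w hw => ?_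
      have hw' : z.im / 2 < w.im := hw
      rw [norm_div, norm_exp_I_mul_ofReal_sum, norm_pow]
      gcongr
      exact hw'.le.trans (lattice_denominator θ))
    (integrable_const _)
    (by
      refine Eventually.of_forall fun θ w hw => ?_
      have hw' : 0 < w.im := (half_pos hz).trans hw
      have h1 := ((hasDerivAt_id w).const_sub
        (2 * ((2 : ℕ) : ℂ) - ∑ j, 2 * Complex.cos (θ j : ℂ)))
      have h2 := (hasDerivAt_const w (Complex.exp (Complex.I * ∑ j, (n j : ℂ) * (θ j : ℂ)))).div h1
        (hne w hw' θ)
      refine h2.congr_deriv ?_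
      simp)
  exact (key.2.differentiableAt).const_mul _

/-! ### The diagonal kernel on the line Re z = 4 -/

lemma periodic_integral_eq {f : ℝ → ℂ} (hf : Function.Periodic f (2 * Real.pi)) (a : ℝ) :
    ∫ x in (-Real.pi + a)..(Real.pi + a), f x = ∫ x in (-Real.pi)..Real.pi, f x := by
  have h := hf.intervalIntegral_add_eq (-Real.pi + a) (-Real.pi)
  rwa [show -Real.pi + a + 2 * Real.pi = Real.pi + a by ring,
    show -Real.pi + 2 * Real.pi = Real.pi by ring] at h

lemma one_sub_mul_circleMap_ne_zero {r : ℂ} (hr : ‖r‖ < 1) (u : ℝ) :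
    1 - r * Complex.exp (u * Complex.I) ≠ 0 := by
  intro h
  have : ‖r * Complex.exp (u * Complex.I)‖ = 1 := by
    rw [← sub_eq_zero.mp h, norm_one]
  rw [norm_mul, Complex.norm_exp_ofReal_mul_I, mul_one] at this
  exact hr.ne this

/-- Mean value property of ζ ↦ 1/(1 - rζ), holomorphic on the closed unit disc, with value 1 at the
centre. -/
lemma integral_one_div_one_sub_mul_exp {r : ℂ} (hr : ‖r‖ < 1) :
    ∫ u in (-Real.pi)..Real.pi, 1 / (1 - r * Complex.exp (u * Complex.I)) = 2 * Real.pi := by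
  have hne : ∀ ζ ∈ Metric.closedBall (0 : ℂ) 1, 1 - r * ζ ≠ 0 := by
    intro ζ hζ h
    have h1 : ‖r * ζ‖ = 1 := by rw [← sub_eq_zero.mp h, norm_one]
    rw [norm_mul] at h1
    have h2 : ‖ζ‖ ≤ 1 := by simpa using hζ
    nlinarith [norm_nonneg r, norm_nonneg ζ]
  have hd : DiffContOnCl ℂ (fun ζ => 1 / (1 - r * ζ)) (Metric.ball 0 |1|) := by
    rw [abs_one]
    refine DifferentiableOn.diffContOnCl ?_
    rw [closure_ball _ one_ne_zero]
    exact DifferentiableOn.div (by fun_prop) (by fun_prop) hne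
  have h := hd.circleAverage
  rw [Real.circleAverage_def, mul_zero, sub_zero, div_one] at h
  have hper : Function.Periodic (fun u : ℝ => 1 / (1 - r * Complex.exp (u * Complex.I)))
      (2 * Real.pi) := by
    intro u
    have : Complex.exp (((u + 2 * Real.pi : ℝ) : ℂ) * Complex.I) = Complex.exp (u * Complex.I) := by
      rw [Complex.exp_eq_exp_iff_exists_int]
      exact ⟨1, by push_cast; ring⟩
    simp only [this]
  have h2 := periodic_integral_eq hper Real.pi
  rw [show -Real.pi + Real.pi = 0 by ring, show Real.pi + Real.pi = 2 * Real.pi by ring] at h2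
  rw [← h2]
  simp only [circleMap_zero, Complex.ofReal_one, one_mul] at h
  have hpi : (2 * Real.pi : ℝ) ≠ 0 := by positivity
  rw [inv_smul_eq_iff₀ hpi] at h
  rw [h]
  simp

/-- With R = √(y² + c²) and ρ = c/(R + y), one has c/R = 2ρ/(1+ρ²) and y/R = (1-ρ²)/(1+ρ²). Hence
the denominator is iR/(1+ρ²) times (1 - iρe^{iu})(1 - iρe^{-iu}), and partial fractions reduce the
integral to the mean value property, since |ρ| < 1. -/
lemma integral_one_div_I_mul_add_cos {y : ℝ} (hy : 0 < y) (c : ℝ) :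
    ∫ u in (-Real.pi)..Real.pi, 1 / (Complex.I * y + c * Complex.cos u) =
      -(2 * Real.pi * Complex.I) * ((√(y ^ 2 + c ^ 2))⁻¹ : ℝ) := by
  set R := √(y ^ 2 + c ^ 2) with hR
  have hpos : 0 < y ^ 2 + c ^ 2 := by positivity
  have hRpos : 0 < R := Real.sqrt_pos.mpr hpos
  have hR2 : R ^ 2 = y ^ 2 + c ^ 2 := Real.sq_sqrt hpos.le
  have hcR : |c| ≤ R := Real.abs_le_sqrt (by nlinarith)
  set ρ := c / (R + y) with hρ
  have hRy : 0 < R + y := by positivity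
  have hc : c = ρ * (R + y) := by rw [hρ]; field_simp
  have hr : ‖Complex.I * (ρ : ℂ)‖ < 1 := by
    rw [norm_mul, Complex.norm_I, one_mul, Complex.norm_real, Real.norm_eq_abs, hρ, abs_div,
      abs_of_pos hRy, div_lt_one hRy]
    linarith
  have hρ1 : R * (1 - ρ ^ 2) = y * (1 + ρ ^ 2) := by
    have : (R + y) * (R * (1 - ρ ^ 2) - y * (1 + ρ ^ 2)) = 0 := by
      have h3 : c ^ 2 = ρ ^ 2 * (R + y) ^ 2 := by rw [hc]; ring
      linear_combination hR2 + h3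
    rcases mul_eq_zero.mp this with h | h
    · exact absurd h hRy.ne'
    · linarith
  have hρ2 : 2 * ρ * R = (1 + ρ ^ 2) * c := by
    rw [hc]; linear_combination ρ * hρ1
  have hi := integral_one_div_one_sub_mul_exp hr
  have hi' : ∫ u in (-Real.pi)..Real.pi,
      1 / (1 - Complex.I * ρ * Complex.exp (-u * Complex.I)) = 2 * Real.pi := by
    have h := intervalIntegral.integral_comp_neg (a := -Real.pi) (b := Real.pi)
      (fun u : ℝ => 1 / (1 - Complex.I * ρ * Complex.exp (u * Complex.I)))
    rw [neg_neg, hi] at h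
    rw [← h]
    refine intervalIntegral.integral_congr fun u _ => ?_
    simp
  have hne := one_sub_mul_circleMap_ne_zero hr
  have hne' : ∀ u : ℝ, 1 - Complex.I * ρ * Complex.exp (-u * Complex.I) ≠ 0 := fun u => by
    have := hne (-u); push_cast at this; exact this
  have c1 : Continuous fun u : ℝ => 1 / (1 - Complex.I * ρ * Complex.exp (u * Complex.I)) :=
    Continuous.div (by fun_prop) (by fun_prop) hne
  have c2 : Continuous fun u : ℝ => 1 / (1 - Complex.I * ρ * Complex.exp (-u * Complex.I)) :=
    Continuous.div (by fun_prop) (by fun_prop) hne'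
  have key : ∀ u : ℝ, 1 / (Complex.I * y + c * Complex.cos u) = (Complex.I * R)⁻¹ *
      (1 / (1 - Complex.I * ρ * Complex.exp (u * Complex.I))
        + 1 / (1 - Complex.I * ρ * Complex.exp (-u * Complex.I)) - 1) := by
    intro u
    have h1 := hne u
    have h2 := hne' u
    have hRc : (R : ℂ) ≠ 0 := by exact_mod_cast hRpos.ne'
    have hden : Complex.I * y + c * Complex.cos u ≠ 0 := by
      intro h
      have := congrArg Complex.im h
      rw [← Complex.ofReal_cos] at this
      simp at this
      exact hy.ne' this
    have hcos := Complex.two_cos (u : ℂ)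
    have hee : Complex.exp (u * Complex.I) * Complex.exp (-u * Complex.I) = 1 := by
      rw [← Complex.exp_add]; simp
    have e1 : (R : ℂ) * (1 - (ρ : ℂ) ^ 2) = y * (1 + (ρ : ℂ) ^ 2) := by exact_mod_cast hρ1
    have e2 : 2 * (ρ : ℂ) * R = (1 + (ρ : ℂ) ^ 2) * c := by exact_mod_cast hρ2
    have hI : Complex.I * Complex.I = -1 := Complex.I_mul_I
    generalize Complex.exp (u * Complex.I) = p at *
    generalize Complex.exp (-u * Complex.I) = q at *
    have hsum : 1 / (1 - Complex.I * ρ * p) + 1 / (1 - Complex.I * ρ * q) - 1 =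
        (1 + (ρ : ℂ) ^ 2) / ((1 - Complex.I * ρ * p) * (1 - Complex.I * ρ * q)) := by
      rw [div_add_div _ _ h1 h2, div_sub_one (mul_ne_zero h1 h2)]
      congr 1
      linear_combination -(Complex.I * Complex.I * (ρ : ℂ) ^ 2) * hee - (ρ : ℂ) ^ 2 * hI
    rw [hsum, inv_mul_eq_div, div_div, div_eq_div_iff hden (by
      exact mul_ne_zero (mul_ne_zero h1 h2) (mul_ne_zero Complex.I_ne_zero hRc))]
    linear_combination Complex.I * e1 + (p + q) / 2 * e2 - (1 + (ρ : ℂ) ^ 2) * c / 2 * hcos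
      - ρ * R * (p + q) * hI + Complex.I * (ρ : ℂ) ^ 2 * R * p * q * hI
      - Complex.I * (ρ : ℂ) ^ 2 * R * hee
  have c12 : Continuous fun u : ℝ => 1 / (1 - Complex.I * ρ * Complex.exp (u * Complex.I))
      + 1 / (1 - Complex.I * ρ * Complex.exp (-u * Complex.I)) := c1.add c2
  simp only [key]
  rw [intervalIntegral.integral_const_mul, intervalIntegral.integral_sub
    (c12.intervalIntegrable _ _) (by simp),
    intervalIntegral.integral_add (c1.intervalIntegrable _ _) (c2.intervalIntegrable _ _), hi, hi']
  simp only [intervalIntegral.integral_const, Complex.real_smul]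
  rw [mul_inv, Complex.inv_I]
  push_cast
  ring

/-- On the diagonal the exponential depends only on φ = x + y, with y the second angle, and the
cosines combine to 4 cos(φ/2) cos(x - φ/2). For fixed φ the x-integral is therefore the one just
evaluated. -/
lemma torusGreen_diag_eq {y : ℝ} (hy : 0 < y) (m : ℤ) :
    torusGreen (4 + 4 * (Complex.I * y)) m m = Complex.I / (8 * Real.pi) *
      ∫ φ in (-Real.pi)..Real.pi, Complex.exp (Complex.I * m * φ) *
        ((√(y ^ 2 + Real.cos (φ / 2) ^ 2))⁻¹ : ℝ) := by
  have hz : 0 < (4 + 4 * (Complex.I * y) : ℂ).im := by simp [hy]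
  set z : ℂ := 4 + 4 * (Complex.I * y) with hzdef
  have hcont := continuous_torusIntegrand hz m m
  have hper : ∀ x, Function.Periodic (fun y : ℝ => torusIntegrand z m m x y) (2 * Real.pi) := by
    intro x y
    have h1 : Complex.exp (Complex.I * (m * x + m * ((y + 2 * Real.pi : ℝ) : ℂ))) =
        Complex.exp (Complex.I * (m * x + m * y)) := by
      rw [Complex.exp_eq_exp_iff_exists_int]
      exact ⟨m, by push_cast; ring⟩
    have h2 : Complex.cos ((y + 2 * Real.pi : ℝ) : ℂ) = Complex.cos y := by
      rw [← Complex.ofReal_cos, Real.cos_add_two_pi, Complex.ofReal_cos]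
    simp only [torusIntegrand, h1, h2]
  have e1 : ∀ x, ∫ y in (-Real.pi)..Real.pi, torusIntegrand z m m x y =
      ∫ φ in (-Real.pi)..Real.pi, torusIntegrand z m m x (φ - x) := fun x => by
    rw [intervalIntegral.integral_comp_sub_right (fun y => torusIntegrand z m m x y) x,
      sub_eq_add_neg, sub_eq_add_neg, periodic_integral_eq (hper x)]
  have hpi : (Real.pi : ℂ) ≠ 0 := by exact_mod_cast Real.pi_ne_zero
  have e2 : ∀ φ : ℝ, ∫ x in (-Real.pi)..Real.pi, torusIntegrand z m m x (φ - x) =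
      (Complex.I * Real.pi / 2) * (Complex.exp (Complex.I * m * φ) *
        ((√(y ^ 2 + Real.cos (φ / 2) ^ 2))⁻¹ : ℝ)) := by
    intro φ
    have hpt : ∀ x : ℝ, torusIntegrand z m m x (φ - x) = -(Complex.exp (Complex.I * m * φ) / 4) *
        (1 / (Complex.I * y + (Real.cos (φ / 2) : ℝ) * Complex.cos ((x + -(φ / 2) : ℝ) : ℂ))) := by
      intro x
      have hcos : 2 * Real.cos x + 2 * Real.cos (φ - x) =
          4 * (Real.cos (φ / 2) * Real.cos (x + -(φ / 2))) := by
        rw [← mul_add, Real.cos_add_cos, show (x + (φ - x)) / 2 = φ / 2 by ring,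
          show (x - (φ - x)) / 2 = x + -(φ / 2) by ring]
        ring
      have hcosc : 2 * Complex.cos x + 2 * Complex.cos ((φ - x : ℝ) : ℂ) =
          4 * ((Real.cos (φ / 2) : ℝ) * Complex.cos ((x + -(φ / 2) : ℝ) : ℂ)) := by
        rw [← Complex.ofReal_cos, ← Complex.ofReal_cos, ← Complex.ofReal_cos]
        exact_mod_cast hcos
      have hden : 4 - 2 * Complex.cos x - 2 * Complex.cos ((φ - x : ℝ) : ℂ) - z =
          -4 * (Complex.I * y + (Real.cos (φ / 2) : ℝ) *
            Complex.cos ((x + -(φ / 2) : ℝ) : ℂ)) := by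
        rw [hzdef]; linear_combination -hcosc
      rw [torusIntegrand, hden, show Complex.I * ((m : ℂ) * x + m * ((φ - x : ℝ) : ℂ)) =
        Complex.I * m * φ by push_cast; ring, ← div_div, mul_one_div]
      congr 1
      ring
    simp only [hpt]
    rw [intervalIntegral.integral_const_mul, intervalIntegral.integral_comp_add_right
      (fun u : ℝ => 1 / (Complex.I * y + (Real.cos (φ / 2) : ℝ) * Complex.cos (u : ℂ))),
      periodic_integral_eq, integral_one_div_I_mul_add_cos hy]
    · ring
    · intro u
      simp only
      rw [← Complex.ofReal_cos, ← Complex.ofReal_cos, Real.cos_add_two_pi]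
  rw [torusGreen]
  simp only [e1]
  rw [integral_integral_swap_of_continuous (f := fun x φ => torusIntegrand z m m x (φ - x))
    (hcont.comp (by fun_prop : Continuous fun p : ℝ × ℝ => (p.1, p.2 - p.1)))]
  simp only [e2]
  rw [intervalIntegral.integral_const_mul]
  field_simp
  ring

/-- Shifting φ by π turns cos²(φ/2) into sin²(φ/2) at the price of (-1)^m. Then the even part is
kept and φ = 2α is substituted. -/
lemma integral_exp_mul_inv_sqrt {y : ℝ} (hy : 0 < y) (m : ℕ) :
    ∫ φ in (-Real.pi)..Real.pi, Complex.exp (Complex.I * (m : ℤ) * φ) *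
        ((√(y ^ 2 + Real.cos (φ / 2) ^ 2))⁻¹ : ℝ) =
      2 * ((-1) ^ m * (2 * sinKernel 1 (fun α => Real.cos (2 * m * α)) (y ^ 2) : ℝ)) := by
  have ht : 0 < y ^ 2 := by positivity
  set f : ℝ → ℂ := fun φ => Complex.exp (Complex.I * (m : ℤ) * φ) *
        ((√(y ^ 2 + Real.cos (φ / 2) ^ 2))⁻¹ : ℝ) with hf
  set g : ℝ → ℂ := fun φ => Complex.exp (Complex.I * m * φ) *
        ((√(y ^ 2 + Real.sin (φ / 2) ^ 2))⁻¹ : ℝ) with hg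
  have hper : Function.Periodic f (2 * Real.pi) := by
    intro φ
    have e1 : Complex.exp (Complex.I * (m : ℤ) * ((φ + 2 * Real.pi : ℝ) : ℂ)) =
      Complex.exp (Complex.I * (m : ℤ) * φ) := by
      rw [Complex.exp_eq_exp_iff_exists_int]
      exact ⟨m, by push_cast; ring⟩
    have e2 : Real.cos ((φ + 2 * Real.pi) / 2) ^ 2 = Real.cos (φ / 2) ^ 2 := by
      rw [show (φ + 2 * Real.pi) / 2 = φ / 2 + Real.pi by ring, Real.cos_add_pi, neg_sq]
    simp only [hf, e1, e2]
  have hshift : ∀ φ, f (φ + Real.pi) = (-1) ^ m * g φ := by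
    intro φ
    have e1 : Complex.exp (Complex.I * (m : ℤ) * ((φ + Real.pi : ℝ) : ℂ)) =
      (-1) ^ m * Complex.exp (Complex.I * m * φ) := by
      rw [← Complex.exp_pi_mul_I, ← Complex.exp_nat_mul, ← Complex.exp_add]
      congr 1; push_cast; ring
    have e2 : Real.cos ((φ + Real.pi) / 2) ^ 2 = Real.sin (φ / 2) ^ 2 := by
      rw [show (φ + Real.pi) / 2 = φ / 2 + Real.pi / 2 by ring, Real.cos_add_pi_div_two, neg_sq]
    simp only [hf, hg, e1, e2]
    ring
  have h1 : ∫ φ in (-Real.pi)..Real.pi, f φ = (-1) ^ m * ∫ φ in (-Real.pi)..Real.pi, g φ := by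
    rw [← periodic_integral_eq hper Real.pi, ← intervalIntegral.integral_comp_add_right f]
    simp only [hshift, intervalIntegral.integral_const_mul]
  have hcg : Continuous g := by
    have := continuous_inv_sqrt_pow ht 1
    simp only [pow_one] at this
    have h2 : Continuous fun φ : ℝ => (√(y ^ 2 + Real.sin (φ / 2) ^ 2))⁻¹ :=
      this.comp (by fun_prop : Continuous fun φ : ℝ => φ / 2)
    simp only [hg]
    fun_prop
  have h2 : ∫ φ in (-Real.pi)..Real.pi, g φ = ∫ φ in (0 : ℝ)..Real.pi, (g φ + g (-φ)) := by
    have hcg' : Continuous fun φ => g (-φ) := hcg.comp continuous_neg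
    rw [intervalIntegral.integral_add (hcg.intervalIntegrable _ _)
      (hcg'.intervalIntegrable _ _),
      intervalIntegral.integral_comp_neg, neg_zero, add_comm,
      intervalIntegral.integral_add_adjacent_intervals (hcg.intervalIntegrable _ _)
      (hcg.intervalIntegrable _ _)]
  have h3 : ∀ φ : ℝ, g φ + g (-φ) = ((2 * (Real.cos (2 * m * (φ / 2)) *
      (√(y ^ 2 + Real.sin (φ / 2) ^ 2))⁻¹ ^ 1) : ℝ) : ℂ) := by
    intro φ
    have e1 := Complex.two_cos ((m : ℂ) * φ)
    have e2 : Real.sin (-φ / 2) ^ 2 = Real.sin (φ / 2) ^ 2 := by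
      rw [neg_div, Real.sin_neg, neg_sq]
    have e3 : 2 * (m : ℝ) * (φ / 2) = m * φ := by ring
    simp only [hg, e2, e3, pow_one]
    push_cast
    rw [← mul_assoc 2, e1, show (m : ℂ) * φ * Complex.I = Complex.I * m * φ by ring,
      show -((m : ℂ) * φ) * Complex.I = Complex.I * m * -φ by ring]
    ring
  rw [h1, h2]
  simp only [h3]
  rw [intervalIntegral.integral_ofReal, intervalIntegral.integral_const_mul,
    intervalIntegral.integral_comp_div (fun α => Real.cos (2 * m * α) *
      (√(y ^ 2 + Real.sin α ^ 2))⁻¹ ^ 1) two_ne_zero, zero_div, smul_eq_mul]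
  simp only [sinKernel]
  push_cast
  ring

/-! ### Analytic continuation of the diagonal identity -/

/-- If Im w > 0 then w² avoids [0, ∞), so the principal logarithm of -w² is holomorphic on the whole
upper half disc. -/
lemma neg_sq_mem_slitPlane {w : ℂ} (hw : 0 < w.im) : -w ^ 2 ∈ Complex.slitPlane := by
  rw [Complex.mem_slitPlane_iff]
  by_cases h : w.re = 0
  · left
    simp [pow_two, h, hw]
  · right
    simp only [pow_two, Complex.neg_im, Complex.mul_im, neg_ne_zero]
    intro h0
    have : w.re * w.im = 0 := by linarith
    rcases mul_eq_zero.mp this with h1 | h1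
    · exact h h1
    · exact hw.ne' h1

lemma differentiableAt_greenSeries_diag (m : ℕ) {w : ℂ} (hw : ‖w‖ < 1) (hw' : 0 < w.im) :
    DifferentiableAt ℂ (fun w => greenSeries w (2 * m) 0) w := by
  have ht : ‖-w ^ 2‖ < 1 := by
    rw [norm_neg, norm_pow]; nlinarith [norm_nonneg w]
  have hsq : DifferentiableAt ℂ (fun w : ℂ => -w ^ 2) w := by fun_prop
  have hP := ((polyGrowth_diagCoeff m).hasDerivAt ht).differentiableAt.comp w hsq
  have hQ := ((polyGrowth_diagLogCoeff m).hasDerivAt ht).differentiableAt.comp w hsq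
  have hl := hsq.clog (neg_sq_mem_slitPlane hw')
  have := ((hP.neg.mul hl).add hQ).const_mul (Complex.I / (4 * Real.pi))
  refine this.congr_of_eventuallyEq ?_
  have hopen : Metric.ball (0 : ℂ) 1 ∈ 𝓝 w := Metric.isOpen_ball.mem_nhds (by simpa using hw)
  filter_upwards [hopen] with v hv
  exact greenSeries_diag m (by simpa using hv)

lemma exists_torusGreen_diag_eq_on_axis (m : ℕ) : ∃ δ > 0, δ ≤ 1 ∧ ∀ y : ℝ, 0 < y → y < δ →
    torusGreen (4 + 4 * (Complex.I * y)) m m = greenSeries (Complex.I * y) (2 * m) 0 := by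
  obtain ⟨δ, hδ, hδ1, h⟩ := exists_sinKernel_eq_diagSeries m
  refine ⟨δ, hδ, hδ1, fun y hy hyδ => ?_⟩
  have hy1 : y < 1 := hyδ.trans_le hδ1
  have hw : ‖Complex.I * (y : ℂ)‖ < 1 := by
    simpa [abs_of_pos hy] using hy1
  have hsq : -(Complex.I * (y : ℂ)) ^ 2 = ((y ^ 2 : ℝ) : ℂ) := by
    rw [mul_pow, Complex.I_sq]; push_cast; ring
  -- The series identity is applied at t = y², which is below δ because δ ≤ 1 gives y² < y < δ.
  rw [torusGreen_diag_eq hy, integral_exp_mul_inv_sqrt hy, h (y ^ 2) (by positivity) (by nlinarith),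
    greenSeries_diag m hw, hsq, ← Complex.ofReal_log (by positivity), diagSeries]
  have hpi : (Real.pi : ℂ) ≠ 0 := by exact_mod_cast Real.pi_ne_zero
  field_simp
  ring

/-- Both sides are holomorphic on a convex half disc and agree on a segment of the line Re z = 4, so
the identity theorem applies at an interior point of that segment. -/
lemma torusGreen_diag (m : ℕ) {z : ℂ} (hz : ‖z - 4‖ < 4) (hz' : 0 < z.im) :
    torusGreen z m m = greenSeries ((z - 4) / 4) (2 * m) 0 := by
  set U : Set ℂ := Metric.ball 4 4 ∩ {z | 0 < z.im} with hU
  have hUo : IsOpen U := Metric.isOpen_ball.inter (isOpen_lt continuous_const Complex.continuous_im)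
  have hUc : IsPreconnected U :=
    ((convex_ball (4 : ℂ) 4).inter (convex_halfSpace_im_gt 0)).isPreconnected
  have hmem : ∀ z : ℂ, z ∈ U ↔ ‖z - 4‖ < 4 ∧ 0 < z.im := fun z => by
    simp [hU, dist_eq_norm]
  set f : ℂ → ℂ := fun z => latticeGreen 2 z (fun _ => (m : ℤ)) with hf
  set g : ℂ → ℂ := fun z => greenSeries ((z - 4) / 4) (2 * m) 0 with hg
  have hfa : AnalyticOnNhd ℂ f U := DifferentiableOn.analyticOnNhd (fun z hz =>
    (differentiableAt_latticeGreen ((hmem z).mp hz).2 _).differentiableWithinAt) hUo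
  have hga : AnalyticOnNhd ℂ g U := DifferentiableOn.analyticOnNhd (fun z hz => by
    obtain ⟨h1, h2⟩ := (hmem z).mp hz
    have hd := differentiableAt_greenSeries_diag m (w := (z - 4) / 4) (by
      rw [norm_div, Complex.norm_ofNat, div_lt_one (by norm_num)]; exact h1) (by
      simp only [Complex.div_ofNat_im, Complex.sub_im, Complex.im_ofNat, sub_zero]; positivity)
    exact (hd.comp z (by fun_prop : DifferentiableAt ℂ (fun z : ℂ => (z - 4) / 4) z)
      ).differentiableWithinAt) hUo
  obtain ⟨δ, hδ, hδ1, heq⟩ := exists_torusGreen_diag_eq_on_axis m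
  have hfz : ∀ z, 0 < z.im → f z = torusGreen z m m := fun z hz => latticeGreen_two hz _
  set γ : ℝ → ℂ := fun y => 4 + 4 * (Complex.I * y) with hγ
  have hγim : ∀ y, (γ y).im = 4 * y := fun y => by simp [hγ]
  have hinj : Function.Injective γ := fun a b hab => by
    have := congrArg Complex.im hab
    rw [hγim, hγim] at this
    linarith
  have hγc : Continuous γ := by fun_prop
  have htend : Tendsto γ (𝓝[≠] (δ / 2)) (𝓝[≠] (γ (δ / 2))) :=
    tendsto_nhdsWithin_of_tendsto_nhds_of_eventually_within _
      (hγc.continuousAt.tendsto.mono_left nhdsWithin_le_nhds)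
      (by filter_upwards [self_mem_nhdsWithin] with y hy using hinj.ne hy)
  have hev : ∀ᶠ y in 𝓝[≠] (δ / 2), f (γ y) = g (γ y) := by
    filter_upwards [nhdsWithin_le_nhds (Ioo_mem_nhds (half_pos hδ) (half_lt_self hδ))] with y hy
    rw [hfz _ (by rw [hγim]; linarith [hy.1]), hg, heq y hy.1 hy.2]
    simp only [hγ]
    congr 1
    ring
  have h0 : γ (δ / 2) ∈ U := by
    rw [hmem, hγim]
    refine ⟨?_, by linarith⟩
    have : γ (δ / 2) - 4 = 4 * (Complex.I * ((δ / 2 : ℝ) : ℂ)) := by simp only [hγ]; ring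
    rw [this, norm_mul, norm_mul, Complex.norm_I, Complex.norm_ofNat, Complex.norm_real,
      Real.norm_of_nonneg (by positivity)]
    linarith
  have := hfa.eqOn_of_preconnected_of_frequently_eq hga hUc h0 (htend.frequently hev.frequently)
    ((hmem z).mpr ⟨hz, hz'⟩)
  rw [← hfz z hz']
  exact this

/-! ### From the diagonal to the whole lattice -/

/-- A symmetric lattice function that satisfies the homogeneous recursion and vanishes on the
diagonal is zero. -/
lemma lattice_unique {D : ℤ → ℤ → ℂ} {c : ℂ}
    (hrec : ∀ m n, D (m + 1) n + D (m - 1) n + D m (n + 1) + D m (n - 1) = c * D m n)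
    (hswap : ∀ m n, D n m = D m n) (hneg : ∀ m n, D m (-n) = D m n)
    (hdiag : ∀ m : ℕ, D m m = 0) (m n : ℤ) : D m n = 0 := by
  have hneg' : ∀ m n, D (-m) n = D m n := fun m n => by rw [hswap, hneg, hswap]
  have hdiag' : ∀ m : ℤ, D m m = 0 := fun m => by
    rcases Int.natAbs_eq m with h | h
    · rw [h]; exact hdiag _
    · rw [h, hneg, hneg']; exact hdiag _
  -- If the values on the off-diagonal of index k + 1 alternate in sign, a single zero makes the
  -- whole line vanish.
  have step : ∀ k : ℕ, (∀ m : ℤ, D (m + (k + 1)) m = -D (m - 1 + (k + 1)) (m - 1)) →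
      ∀ m : ℤ, D (m + (k + 1)) m = 0 := by
    intro k hf
    -- For k + 1 = 2j the point (j, -j) reflects to the diagonal. For k + 1 = 2j + 1 the adjacent
    -- points (j+1, -j) and (j, -j-1) are equal by symmetry and opposite by alternation, hence zero.
    have hbase : ∃ m0 : ℤ, D (m0 + (k + 1)) m0 = 0 := by
      rcases Nat.even_or_odd' (k + 1) with ⟨j, hj | hj⟩
      · refine ⟨-j, ?_⟩
        rw [hneg, show (-(j : ℤ) + ((k : ℤ) + 1)) = j by omega]
        exact hdiag' _
      · refine ⟨-j, ?_⟩
        have h1 := hf (-j)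
        have h2 : D (-(j : ℤ) - 1 + (k + 1)) (-(j : ℤ) - 1) = D (-(j : ℤ) + (k + 1)) (-j) := by
          rw [show -(j : ℤ) - 1 = -(j + 1) by ring, hneg, hneg, hswap]
          congr 1 <;> omega
        rw [h2] at h1
        exact self_eq_neg.mp h1
    obtain ⟨m0, h0⟩ := hbase
    intro m
    induction m using Int.inductionOn' (b := m0) with
    | zero => exact h0
    | succ a _ ih =>
      have := hf (a + 1)
      rw [add_sub_cancel_right, ih, neg_zero] at this
      exact this
    | pred a _ ih =>
      have := hf a
      rw [ih] at this
      exact neg_eq_zero.mp this.symm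
  have main : ∀ k : ℕ, ∀ m : ℤ, D (m + k) m = 0 := by
    intro k
    induction k using Nat.strong_induction_on with
    | _ k ih =>
      rcases k with _ | _ | k
      · intro m; simpa using hdiag' m
      -- The equation at (m, m) has zero right side, and the swap symmetry pairs its four
      -- neighbours, giving alternation on the first off-diagonal.
      · have := step 0 (fun m => by
          have h := hrec m m
          rw [hdiag' m, mul_zero] at h
          have e1 : D (m - 1) m = D m (m - 1) := hswap _ _
          rw [e1] at h
          have e2 : D m (m + 1) = D (m + 1) m := hswap _ _
          simp only [Nat.cast_zero, zero_add, sub_add_cancel]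
          linear_combination h / 2 - e2 / 2)
        simpa using this
      -- In the equation centred on off-diagonal k + 1, the centre and the two neighbours on
      -- off-diagonal k vanish by induction; the two on k + 2 must be opposite.
      · have := step (k + 1) (fun m => by
          have h := hrec (m + (k + 1)) m
          have i0 := ih (k + 1) (by omega) m
          have i1 := ih k (by omega) m
          have i2 := ih k (by omega) (m + 1)
          push_cast at i0 i1 i2 ⊢
          rw [i0, show m + ((k : ℤ) + 1) - 1 = m + k by ring, i1,
            show m + ((k : ℤ) + 1) = m + 1 + k by ring, i2] at h
          rw [show m + ((k : ℤ) + 1 + 1) = m + 1 + k + 1 by ring,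
            show m - 1 + ((k : ℤ) + 1 + 1) = m + 1 + k by ring]
          linear_combination h)
        intro m
        have h := this m
        push_cast at h ⊢
        exact h
  rcases le_total n m with h | h
  · obtain ⟨k, hk⟩ := Int.le.dest h
    rw [← hk]; exact main k n
  · obtain ⟨k, hk⟩ := Int.le.dest h
    rw [hswap, ← hk]; exact main k m

/-- The expansion of the Green kernel of the square lattice at the middle of the spectrum. -/
lemma torusGreen_eq_greenSeries {z : ℂ} (hz : ‖z - 4‖ < 4) (hz' : 0 < z.im) (m n : ℤ) :
    torusGreen z m n = greenSeries ((z - 4) / 4) (m + n) (m - n) := by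
  have hw : ‖(z - 4) / 4‖ < 1 := by
    rw [norm_div, Complex.norm_ofNat, div_lt_one (by norm_num)]; exact hz
  have heven : ∀ m n : ℤ, Even (m + n + (m - n)) := fun m n => ⟨m, by ring⟩
  refine sub_eq_zero.mp (lattice_unique (c := 4 - z)
    (D := fun m n => torusGreen z m n - greenSeries ((z - 4) / 4) (m + n) (m - n))
    (fun m n => ?_) (fun m n => ?_) (fun m n => ?_) (fun m => ?_) m n)
  · have h1 := torusGreen_recursion hz' m n
    have h2 := greenSeries_recursion hw (m + n) (m - n) (heven m n)
    have hc : (m + n = 0 ∧ m - n = 0) ↔ (m = 0 ∧ n = 0) := by omega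
    simp only [hc] at h2
    rw [show m + 1 + n = m + n + 1 by ring, show m + 1 - n = m - n + 1 by ring,
      show m - 1 + n = m + n - 1 by ring, show m - 1 - n = m - n - 1 by ring,
      show m + (n + 1) = m + n + 1 by ring, show m - (n + 1) = m - n - 1 by ring,
      show m + (n - 1) = m + n - 1 by ring, show m - (n - 1) = m - n + 1 by ring]
    linear_combination h1 - h2
  · have e : greenSeries ((z - 4) / 4) (n + m) (n - m)
        = greenSeries ((z - 4) / 4) (m + n) (m - n) := by
      rw [← greenSeries_neg_right, neg_sub, add_comm]
    rw [torusGreen_swap hz', e]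
  · have e : greenSeries ((z - 4) / 4) (m + -n) (m - -n)
        = greenSeries ((z - 4) / 4) (m + n) (m - n) := by
      rw [sub_neg_eq_add, ← sub_eq_add_neg, greenSeries_comm _ _ _ (heven m n)]
    rw [torusGreen_neg_right, e]
  · rw [torusGreen_diag m hz hz', sub_self, ← two_mul, sub_self]

/-! ### The two parity cases -/

lemma even_latticeNorm_iff (n : Fin 2 → ℤ) : Even (latticeNorm n) ↔ Even (n 0 + n 1) := by
  simp [latticeNorm, Fin.sum_univ_two, Nat.even_add, Int.even_add, Int.natAbs_even]

theorem theorem19083122 (z : ℂ) (hz : ‖z - 4‖ < 4) (hz' : 0 < z.im) (n : Fin 2 → ℤ) :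
    (Even (latticeNorm n) →
      Summable (pFqTerm
        [(2 + n 0 + n 1) / 2, (2 - n 0 - n 1) / 2, (2 + n 0 - n 1) / 2, (2 - n 0 + n 1) / 2]
        [1, 3 / 2, 3 / 2] ((z - 4) ^ 2 / 16)) ∧
      Summable (evenLogTerm z n) ∧
      latticeGreen 2 z n =
        (-1) ^ max (n 0).natAbs (n 1).natAbs *
            (((|n 0 + n 1| : ℤ) : ℂ) / 2) * (((|n 0 - n 1| : ℤ) : ℂ) / 2) * ((z - 4) / 4) *
            pFq [(2 + n 0 + n 1) / 2, (2 - n 0 - n 1) / 2, (2 + n 0 - n 1) / 2,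
                (2 - n 0 + n 1) / 2]
              [1, 3 / 2, 3 / 2] ((z - 4) ^ 2 / 16) +
          Complex.I * (-1) ^ max (n 0).natAbs (n 1).natAbs / (4 * (Real.pi : ℂ)) *
            ∑' k, evenLogTerm z n k) ∧
    (Odd (latticeNorm n) →
      Summable (pFqTerm
        [(1 + n 0 + n 1) / 2, (1 + n 0 - n 1) / 2, (1 - n 0 + n 1) / 2, (1 - n 0 - n 1) / 2]
        [1, 1 / 2, 1 / 2] ((z - 4) ^ 2 / 16)) ∧
      Summable (oddLogTerm z n) ∧
      latticeGreen 2 z n =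
        (-1) ^ max (n 0).natAbs (n 1).natAbs / 4 *
            pFq [(1 + n 0 + n 1) / 2, (1 + n 0 - n 1) / 2, (1 - n 0 + n 1) / 2,
                (1 - n 0 - n 1) / 2]
              [1, 1 / 2, 1 / 2] ((z - 4) ^ 2 / 16) +
          Complex.I * (-1) ^ max (n 0).natAbs (n 1).natAbs / (Real.pi : ℂ) *
            (((|n 0 + n 1| : ℤ) : ℂ) / 2) * (((|n 0 - n 1| : ℤ) : ℂ) / 2) * ((z - 4) / 4) *
            ∑' k, oddLogTerm z n k) := by
  rw [latticeGreen_two hz', torusGreen_eq_greenSeries hz hz']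
  refine ⟨fun h => ?_, fun h => ?_⟩
  · have h' := (even_latticeNorm_iff n).mp h
    exact ⟨summable_pFqTerm_three_halves hz n, summable_and_greenSeries_of_even hz n h'⟩
  · refine summable_and_greenSeries_of_odd hz hz' n ?_
    rw [← Int.not_even_iff_odd, ← even_latticeNorm_iff, Nat.not_even_iff_odd]
    exact h
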